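/- Let $a,\sigma,\gamma,T>0$, $x_L<x_R$, $L=x_R-x_L$, $\mu=2\pi/L$, $F(u)=\gamma u^3/6$, and let $r>1/2$ be real. For real $s\ge 0$ let $H^s_p$ be the Sobolev space of $L$-periodic functions with norm $\big(\sum_{k\in\mathbb Z}(1+\mu^2k^2)^s|\hat f_k|^2\big)^{1/2}$, where $\hat f_k$ are the Fourier coefficients of $f$. Suppose that the real function $u(x,t)$ is an exact solution (with the equation understood in the sense of distributions in $x$, for every $t$) of $$u_t+au_x-\sigma u_{xxt}+(F'(u))_x=0,\qquad u(x,0)=u_0(x),\qquad u(x+L,t)=u(x,t),\qquad t\in[0,T],$$ that $u(\cdot,t)$ is continuous for every $t$, and that $u\in C^3([0,T];H_p^{r+1})$. For an even integer $N\ge 2$ put $h=L/N$, $x_j=x_L+jh$ ($0\le j\le N-1$) and $$g_j(x)=\frac1N\sum_{k=-N/2}^{N/2}\frac1{c_k}e^{ik\mu(x-x_j)},\qquad c_{\pm N/2}=2,\quad c_k=1\ (|k|<N/2).$$ Let $\mathbb D_k$ be the $N\times N$ matrix with entries $(\mathbb D_k)_{jl}=g_l^{(k)}(x_j)$, and for $\mathbf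 U\in\mathbb R^N$ let $\mathbb D(\mathbf U)=a\mathbb D_1+\frac{\gamma}{3}\big(\mathrm{diag}(\mathbf U)\mathbb D_1+\mathbb D_1\mathrm{diag}(\mathbf U)\big)$. For an integer $N_t\ge1$ let $\tau=T/N_t$. Let $\mathbf U^0,\dots,\mathbf U^{N_t}\in\mathbb R^N$ be a numerical solution of the linear-implicit Crank–Nicolson momentum-preserving Fourier pseudo-spectral scheme (LCN-MP), that is, $U^0_j=u_0(x_j)$, $$(\mathbb I-\sigma\mathbb D_2)\frac{\mathbf U^1-\mathbf U^0}{\tau}+\mathbb D\Big(\frac{\mathbf U^1+\mathbf U^0}{2}\Big)\frac{\mathbf U^1+\mathbf U^0}{2}=0,$$ $$(\mathbb I-\sigma\mathbb D_2)\frac{\mathbf U^{n+1}-\mathbf U^n}{\tau}+\mathbb D\Big(\frac{3\mathbf U^n-\mathbf U^{n-1}}{2}\Big)\frac{\mathbf U^{n+1}+\mathbf U^n}{2}=0,\qquad 1\le n\le N_t-1.$$ Then there is a constant $C>0$, independent of $N$, $N_t$, $n$ and of the numerical solution, such that for all even $N\ge2$, all $N_t\ge1$ (with no restriction relating $\tau$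 and $h$), all such numerical solutions and all $0\le n\le N_t$, the error $e^n_j=u(x_j,n\tau)-U^n_j$ satisfies $$\max_{j}|e^n_j|\le C(\tau^2+N^{-r}),\qquad \Big(h\sum_j|e^n_j|^2\Big)^{1/2}\le C(\tau^2+N^{-r}),\qquad \Big(h\sum_j(-\mathbb D_2e^n)_j\,e^n_j\Big)^{1/2}\le C(\tau^2+N^{-r}).$$ -/

import Mathlib

open Set Finset
open scoped ContDiff Matrix

noncomputable section

namespace RLW

/-! ### The continuous problem -/

/-- The potential `F(u) = γ u³ / 6`. -/
def potential (γ : ℝ) (w : ℝ) : ℝ := γ * w ^ 3 / 6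

/-- The weight `(1 + |2πk/L|²)^{s/2}` of the periodic Sobolev space `H_p^s` of period `L`. -/
def sobolevWeight (L s : ℝ) (k : ℤ) : ℝ := (1 + (2 * Real.pi * k / L) ^ 2) ^ (s / 2)

/-- `u ∈ C^m([0,T]; H_p^s(Ω))`, `Ω = [xL, xR]`, for a function `u(x,t)` whose spatial slices are
continuous and periodic with period `xR - xL`. The map `f ↦ (weight k * f̂ k)_k` is an isometric
isomorphism of `H_p^s` (with the norm `(∑ₖ (1 + |2πk/L|²)^s |f̂ k|²)^{1/2}`) onto `ℓ²(ℤ)`; the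
condition says that the curve `t ↦ u(·,t)`, read through this isomorphism, takes values in `ℓ²(ℤ)`
and is `m` times continuously differentiable on the closed interval `[0,T]`. -/
structure MemCmSobolev {xL xR : ℝ} (hx : xL < xR) (m : ℕ) (T s : ℝ) (u : ℝ → ℝ → ℝ) : Prop where
  continuous : ∀ t ∈ Set.Icc 0 T, Continuous fun x => u x t
  periodic : ∀ t ∈ Set.Icc 0 T, Function.Periodic (fun x => u x t) (xR - xL)
  curve : ∃ v : ℝ → lp (fun _ : ℤ => ℂ) 2, ContDiffOn ℝ m v (Set.Icc 0 T) ∧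
    ∀ t ∈ Set.Icc 0 T, ∀ k : ℤ,
      v t k = (sobolevWeight (xR - xL) s k : ℂ) * fourierCoeffOn hx (fun x => (u x t : ℂ)) k

/-- `u(x,t)` is a solution on `[0,T]` of the periodic initial value problem
`u_t + a u_x - σ u_xxt + (F'(u))_x = 0`, `u(x,0) = u₀(x)`, `u(x + L, t) = u(x,t)`,
`L = xR - xL`. The equation is understood in the sense of periodic distributions in `x`, at every
time `t ∈ [0,T]`: for every smooth `L`-periodic test function `φ`,
`d/dt ∫ u (φ - σ φ'') dx = ∫ (a u + F'(u)) φ' dx`. -/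
structure IsSolution (a σ γ xL xR T : ℝ) (u₀ : ℝ → ℝ) (u : ℝ → ℝ → ℝ) : Prop where
  continuous : ∀ t ∈ Set.Icc 0 T, Continuous fun x => u x t
  periodic : ∀ t ∈ Set.Icc 0 T, ∀ x, u x t = u (x + (xR - xL)) t
  initial : ∀ x ∈ Set.Icc xL xR, u x 0 = u₀ x
  equation : ∀ φ : ℝ → ℝ, ContDiff ℝ ∞ φ → Function.Periodic φ (xR - xL) →
    ∀ t ∈ Set.Icc 0 T,
      HasDerivWithinAt
        (fun t' => ∫ x in xL..xR, u x t' * (φ x - σ * iteratedDeriv 2 φ x))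
        (∫ x in xL..xR, (a * u x t + deriv (potential γ) (u x t)) * deriv φ x)
        (Set.Icc 0 T) t

/-! ### The Fourier pseudo-spectral space discretization -/

/-- The mesh size `h = (xR - xL) / N`. -/
def meshSize (xL xR : ℝ) (N : ℕ) : ℝ := (xR - xL) / N

/-- The collocation point `x_j = xL + j h`. -/
def gridPoint (xL xR : ℝ) (N : ℕ) (j : Fin N) : ℝ := xL + (j : ℕ) * meshSize xL xR N

/-- The numbers `c_k`: `2` if `|k| = N/2` and `1` otherwise. -/
def modeFactor (N : ℕ) (k : ℤ) : ℝ := if |k| = (N : ℤ) / 2 then 2 else 1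

/-- The trigonometric polynomial
`g_j(x) = (1/N) ∑_{k=-N/2}^{N/2} (1/c_k) exp(i k μ (x - x_j))`, `μ = 2π / (xR - xL)`. -/
def cardinalC (xL xR : ℝ) (N : ℕ) (j : Fin N) (x : ℝ) : ℂ :=
  (1 / (N : ℂ)) * ∑ k ∈ Finset.Icc (-((N : ℤ) / 2)) ((N : ℤ) / 2),
    (1 / (modeFactor N k : ℂ)) *
      Complex.exp (Complex.I * k * ((2 * Real.pi / (xR - xL) * (x - gridPoint xL xR N j) : ℝ) : ℂ))

/-- `g_j` as a real function; it is real valued, see `cardinal_coe`. -/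
def cardinal (xL xR : ℝ) (N : ℕ) (j : Fin N) (x : ℝ) : ℝ := (cardinalC xL xR N j x).re

theorem cardinal_coe (xL xR : ℝ) (N : ℕ) (j : Fin N) (x : ℝ) :
    (cardinal xL xR N j x : ℂ) = cardinalC xL xR N j x := by
  unfold cardinal
  rw [← Complex.conj_eq_iff_re]
  unfold cardinalC
  simp only [map_mul, map_div₀, map_one, map_sum, Complex.conj_ofReal, map_natCast,
    ← Complex.exp_conj, Complex.conj_I, map_intCast]
  congr 1
  refine Finset.sum_nbij' (fun k => -k) (fun k => -k) ?_ ?_ ?_ ?_ ?_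
  · intro k hk
    simp only [Finset.mem_Icc] at hk ⊢
    omega
  · intro k hk
    simp only [Finset.mem_Icc] at hk ⊢
    omega
  · intro k _
    simp
  · intro k _
    simp
  · intro k _
    simp only [modeFactor, abs_neg, Int.cast_neg]
    congr 2
    ring

/-- The `k`-th order spectral differentiation matrix, `(𝔻_k)_{jl} = g_l^{(k)}(x_j)`. -/
def diffMatrix (xL xR : ℝ) (N k : ℕ) : Matrix (Fin N) (Fin N) ℝ :=
  Matrix.of fun j l => iteratedDeriv k (cardinal xL xR N l) (gridPoint xL xR N j)

/-- `𝔻(U) = a 𝔻₁ + (γ/3) (diag(U) 𝔻₁ + 𝔻₁ diag(U))`. -/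
def convMatrix (a γ xL xR : ℝ) (N : ℕ) (U : Fin N → ℝ) : Matrix (Fin N) (Fin N) ℝ :=
  a • diffMatrix xL xR N 1 +
    (γ / 3) • (Matrix.diagonal U * diffMatrix xL xR N 1 +
      diffMatrix xL xR N 1 * Matrix.diagonal U)

/-- The discrete inner product `(U, V)_h = h ∑_j U_j V_j` of real grid functions. -/
def gridInner (xL xR : ℝ) {N : ℕ} (U V : Fin N → ℝ) : ℝ :=
  meshSize xL xR N * ∑ j, U j * V j

/-- The discrete `L²` norm `‖U‖_h = √(U, U)_h`. -/
def gridL2 (xL xR : ℝ) {N : ℕ} (U : Fin N → ℝ) : ℝ :=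
  Real.sqrt (gridInner xL xR U U)

/-- The discrete `H¹` seminorm `|U|_h = √(-𝔻₂ U, U)_h` (for even `N`, `𝔻₂` is symmetric and
negative semidefinite). -/
def gridH1 (xL xR : ℝ) {N : ℕ} (U : Fin N → ℝ) : ℝ :=
  Real.sqrt (gridInner xL xR ((-diffMatrix xL xR N 2) *ᵥ U) U)

/-- The discrete `L^∞` norm `max_j |U_j|`. -/
def gridSup {N : ℕ} (U : Fin N → ℝ) : ℝ := ⨆ j, |U j|

/-! ### The fully discrete scheme -/

/-- `U⁰, …, U^{Nt}` is a numerical solution of the linear-implicit Crank-Nicolson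
momentum-preserving scheme with time step `τ` and initial datum `u₀`: each step solves
`(𝕀 - σ 𝔻₂) (U^{n+1} - U^n)/τ + 𝔻(W) (U^{n+1} + U^n)/2 = 0`, where `W = (3 U^n - U^{n-1})/2`
for `n ≥ 1`, and `W = (U¹ + U⁰)/2` in the first step. -/
structure IsLCNMP (a σ γ xL xR : ℝ) (u₀ : ℝ → ℝ) (N Nt : ℕ) (τ : ℝ)
    (U : ℕ → Fin N → ℝ) : Prop where
  initial : ∀ j, U 0 j = u₀ (gridPoint xL xR N j)
  first :
    (1 - σ • diffMatrix xL xR N 2) *ᵥ (τ⁻¹ • (U 1 - U 0)) +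
      convMatrix a γ xL xR N ((1 / 2 : ℝ) • (U 1 + U 0)) *ᵥ ((1 / 2 : ℝ) • (U 1 + U 0)) = 0
  step : ∀ n, 1 ≤ n → n + 1 ≤ Nt →
    (1 - σ • diffMatrix xL xR N 2) *ᵥ (τ⁻¹ • (U (n + 1) - U n)) +
      convMatrix a γ xL xR N ((1 / 2 : ℝ) • ((3 : ℝ) • U n - U (n - 1))) *ᵥ
        ((1 / 2 : ℝ) • (U (n + 1) + U n)) = 0

end RLW

end

/-!
# Convergence of a linearly implicit momentum-preserving scheme for the RLW equation

The proof is an energy argument in the discrete `H¹` norm whose square is the quadratic form of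
`1 - σ 𝔻₂` (`RLW.energyNorm`, normalized by the length of the period).

*Stability.* Written for the error and paired with the mean error of a step, the convective matrix
at the numerical state drops out, because it is skew (`RLW.pair_schemeOp_self`). Only the error of
the extrapolated state, multiplied by the exact solution, and the residual of the exact solution
remain, and both are bounded in the dual of the energy norm. So neither an a priori bound on the
numerical solution nor a relation between `τ` and `h` is needed (`RLW.energyNorm_error_step`,
`RLW.two_step_gronwall`). The first step is implicit in the error; there the term is absorbed for
small `τ`, while for large `τ` the conservation of the discrete momentum bounds the error by a
constant, hence by a multiple of `τ²` (`RLW.first_step_bound`).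

*Consistency.* Everything is expressed through the Fourier coefficients of the exact solution, split
at the frequency `N/4`. Below it, differentiation matrices act exactly, even on products, so the
equation and the product rule `u u_x = (u²)_x / 2` hold exactly on the grid. Above it, orthogonality
of the residue classes modulo `N` gives the full rate `N^{-r-1}` in `L²`, and the inverse inequality
the rate `N^{-r}` in the energy norm (`RLW.gridNorm_le_of_hasSum_high`,
`RLW.energyNorm_synth_highPart_le`). The equation expresses the Fourier coefficients of the flux
`a u + γ u² / 2` through those of `u_t`, which shows that the flux is in `H_p^r` without using that
Sobolev spaces are algebras (`RLW.exists_isFluxCoeff`). In time, the Taylor formula for the curve in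
`ℓ²(ℤ)` gives the second order (`RLW.exists_midpoint_bounds`).

The errors in the maximum norm, the `L²` norm and the `H¹` seminorm are all bounded by the energy
norm, the first one by the discrete Sobolev inequality (`RLW.norm_apply_le_energyNorm`).
-/

noncomputable section

namespace RLW

/-! ### Grid modes and the discrete Fourier transform -/

/-- The resolved frequencies `-N/2, …, N/2`; the two extreme ones agree on the grid. -/
def freqs (N : ℕ) : Finset ℤ := Finset.Icc (-((N : ℤ) / 2)) ((N : ℤ) / 2)

/-- The grid vector `j ↦ exp(2πi k j / N)`. -/
def mode (N : ℕ) (k : ℤ) (j : Fin N) : ℂ :=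
  Complex.exp (2 * Real.pi * Complex.I * k * (j : ℕ) / N)

/-- The base frequency `μ = 2π / (xR - xL)`. -/
def baseFreq (xL xR : ℝ) : ℝ := 2 * Real.pi / (xR - xL)

/-- The discrete Fourier coefficient `N⁻¹ ∑_l V_l exp(2πi p l / N)` of a complex grid vector. With
this sign, the coefficient at `p` picks out the mode `-p`. -/
def dft {N : ℕ} (V : Fin N → ℂ) (p : ℤ) : ℂ := (1 / (N : ℂ)) * ∑ l, V l * mode N p l

/-- The normalized bilinear pairing `N⁻¹ ∑_j V_j W_j`. -/
def pair {N : ℕ} (V W : Fin N → ℂ) : ℂ := (1 / (N : ℂ)) * ∑ j, V j * W j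

theorem neg_mem_freqs {N : ℕ} {p : ℤ} : -p ∈ freqs N ↔ p ∈ freqs N := by
  simp only [freqs, Finset.mem_Icc]; omega

theorem sum_freqs_neg {N : ℕ} {β : Type*} [AddCommMonoid β] (f : ℤ → β) :
    ∑ p ∈ freqs N, f (-p) = ∑ p ∈ freqs N, f p :=
  Finset.sum_nbij' (fun k => -k) (fun k => -k) (by simp [neg_mem_freqs])
    (by simp [neg_mem_freqs]) (by simp) (by simp) (by simp)

theorem modeFactor_neg (N : ℕ) (k : ℤ) : modeFactor N (-k) = modeFactor N k := by
  simp [modeFactor]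

theorem modeFactor_pos (N : ℕ) (k : ℤ) : 0 < modeFactor N k := by
  unfold modeFactor; split_ifs <;> norm_num

theorem mode_add (N : ℕ) (k l : ℤ) (j : Fin N) : mode N (k + l) j = mode N k j * mode N l j := by
  rw [mode, mode, mode, ← Complex.exp_add]; push_cast; ring_nf

theorem mode_zero (N : ℕ) (j : Fin N) : mode N 0 j = 1 := by simp [mode]

theorem norm_mode (N : ℕ) (k : ℤ) (j : Fin N) : ‖mode N k j‖ = 1 := by
  have : mode N k j = Complex.exp ((2 * Real.pi * k * (j : ℕ) / N : ℝ) * Complex.I) := by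
    rw [mode]; push_cast; ring_nf
  rw [this, Complex.norm_exp_ofReal_mul_I]

theorem conj_mode (N : ℕ) (k : ℤ) (j : Fin N) :
    (starRingEnd ℂ) (mode N k j) = mode N (-k) j := by
  rw [mode, mode, ← Complex.exp_conj]
  simp [Complex.conj_ofNat]

theorem mode_eq_pow (N : ℕ) (k : ℤ) (j : Fin N) :
    mode N k j = Complex.exp (2 * Real.pi * Complex.I * k / N) ^ (j : ℕ) := by
  rw [mode, ← Complex.exp_nat_mul]; ring_nf

theorem exp_eq_one_iff_dvd {N : ℕ} (hN : 0 < N) (k : ℤ) :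
    Complex.exp (2 * Real.pi * Complex.I * k / N) = 1 ↔ (N : ℤ) ∣ k := by
  have hN' : (N : ℂ) ≠ 0 := by exact_mod_cast hN.ne'
  have hp : (2 * Real.pi * Complex.I : ℂ) ≠ 0 := Complex.two_pi_I_ne_zero
  rw [Complex.exp_eq_one_iff]
  constructor
  · rintro ⟨n, hn⟩
    refine ⟨n, ?_⟩
    have : (k : ℂ) = (N : ℂ) * n := by
      field_simp at hn
      exact hn
    exact_mod_cast this
  · rintro ⟨n, rfl⟩
    refine ⟨n, ?_⟩
    push_cast
    field_simp

/-- Discrete orthogonality of the grid modes. -/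
theorem sum_mode {N : ℕ} (hN : 0 < N) (k : ℤ) :
    ∑ j : Fin N, mode N k j = if (N : ℤ) ∣ k then (N : ℂ) else 0 := by
  have hN' : (N : ℂ) ≠ 0 := by exact_mod_cast hN.ne'
  simp_rw [mode_eq_pow]
  rw [Fin.sum_univ_eq_sum_range
    (fun i => Complex.exp (2 * Real.pi * Complex.I * k / N) ^ i) N]
  split_ifs with h
  · simp [(exp_eq_one_iff_dvd hN k).2 h]
  · have h1 : Complex.exp (2 * Real.pi * Complex.I * k / N) ≠ 1 :=
      fun h' => h ((exp_eq_one_iff_dvd hN k).1 h')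
    have h2 : Complex.exp (2 * Real.pi * Complex.I * k / N) ^ N = 1 := by
      rw [← Complex.exp_nat_mul, Complex.exp_eq_one_iff]
      exact ⟨k, by field_simp⟩
    rw [geom_sum_eq h1, h2]; simp

/-- For even `N`, the half weights at `±N/2` turn the sum of a function with `f (N/2) = f (-N/2)`
over the resolved frequencies into a sum over one full period. -/
theorem sum_freqs_eq_sum_range {N : ℕ} (hN : 0 < N) (hE : Even N) (f : ℤ → ℂ)
    (hf : f ((N : ℤ) / 2) = f (-((N : ℤ) / 2))) :
    ∑ p ∈ freqs N, (1 / (modeFactor N p : ℂ)) * f p =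
      ∑ i ∈ Finset.range N, f ((i : ℤ) - (N : ℤ) / 2) := by
  obtain ⟨m, hm⟩ := hE
  have hM : (N : ℤ) / 2 = m := by omega
  have hm0 : 0 < m := by omega
  have hfac : ∀ p ∈ Finset.Ioo (-(m : ℤ)) m, (1 / (modeFactor N p : ℂ)) * f p = f p := by
    intro p hp
    have : |p| ≠ (N : ℤ) / 2 := by
      rw [Finset.mem_Ioo] at hp
      rw [hM]; rcases abs_cases p with h | h <;> omega
    simp [modeFactor, this]
  rw [hM] at hf
  have h1 : freqs N = insert (-(m : ℤ)) (insert (m : ℤ) (Finset.Ioo (-(m : ℤ)) m)) := by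
    ext p; simp only [freqs, hM, Finset.mem_Icc, Finset.mem_insert, Finset.mem_Ioo]; omega
  have h2 : ∑ i ∈ Finset.range N, f ((i : ℤ) - (N : ℤ) / 2) =
      ∑ p ∈ insert (-(m : ℤ)) (Finset.Ioo (-(m : ℤ)) m), f p := by
    rw [hM]
    refine Finset.sum_nbij' (fun i => (i : ℤ) - m) (fun p => (p + m).toNat) ?_ ?_ ?_ ?_ ?_
    · intro i hi
      simp only [Finset.mem_range, Finset.mem_insert, Finset.mem_Ioo] at hi ⊢; omega
    · intro i hi
      simp only [Finset.mem_range, Finset.mem_insert, Finset.mem_Ioo] at hi ⊢; omega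
    · intro i hi; simp
    · intro i hi
      simp only [Finset.mem_insert, Finset.mem_Ioo] at hi ⊢; omega
    · intro i hi; rfl
  rw [h2, h1, Finset.sum_insert, Finset.sum_insert, Finset.sum_insert, Finset.sum_congr rfl hfac]
  · have e1 : modeFactor N (-(m : ℤ)) = 2 := by
      simp [modeFactor, hM]
    have e2 : modeFactor N (m : ℤ) = 2 := by
      simp [modeFactor, hM]
    rw [e1, e2, hf]; push_cast; ring
  · simp
  · simp
  · simp only [Finset.mem_insert, Finset.mem_Ioo]; omega

theorem mode_half {N : ℕ} (hN : 0 < N) (hE : Even N) (j : Fin N) :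
    mode N ((N : ℤ) / 2) j = mode N (-((N : ℤ) / 2)) j := by
  have hN' : (N : ℂ) ≠ 0 := by exact_mod_cast hN.ne'
  have h : (N : ℤ) / 2 = N + -((N : ℤ) / 2) := by obtain ⟨m, hm⟩ := hE; omega
  have h1 : mode N (N : ℤ) j = 1 := by
    rw [mode, Complex.exp_eq_one_iff]
    exact ⟨(j : ℕ), by push_cast; field_simp⟩
  conv_lhs => rw [h, mode_add, h1, one_mul]

/-- Completeness of the resolved modes: the weighted sum reproduces the Kronecker delta. -/
theorem sum_freqs_mode {N : ℕ} (hN : 0 < N) (hE : Even N) (j l : Fin N) :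
    ∑ p ∈ freqs N, (1 / (modeFactor N p : ℂ)) * (mode N p j * mode N (-p) l) =
      if j = l then (N : ℂ) else 0 := by
  have hN' : (N : ℂ) ≠ 0 := by exact_mod_cast hN.ne'
  rw [sum_freqs_eq_sum_range hN hE (fun p => mode N p j * mode N (-p) l)]
  · set d : ℤ := (j : ℕ) - ((l : ℕ) : ℤ) with hd
    have key : ∀ i ∈ Finset.range N, mode N ((i : ℤ) - (N : ℤ) / 2) j *
        mode N (-((i : ℤ) - (N : ℤ) / 2)) l =
        (mode N (-((N : ℤ) / 2)) j * mode N ((N : ℤ) / 2) l) *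
          Complex.exp (2 * Real.pi * Complex.I * d / N) ^ i := by
      intro i _
      rw [sub_eq_add_neg, mode_add, neg_add, neg_neg, mode_add, ← Complex.exp_nat_mul]
      have : mode N i j * mode N (-(i : ℤ)) l =
          Complex.exp (i * (2 * Real.pi * Complex.I * d / N)) := by
        rw [mode, mode, ← Complex.exp_add, hd]
        push_cast
        ring_nf
      rw [← this]; ring
    have hgeom := sum_mode hN d
    simp_rw [mode_eq_pow] at hgeom
    rw [Fin.sum_univ_eq_sum_range
      (fun i => Complex.exp (2 * Real.pi * Complex.I * d / N) ^ i) N] at hgeom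
    rw [Finset.sum_congr rfl key, ← Finset.mul_sum, hgeom]
    have hdvd : (N : ℤ) ∣ d ↔ j = l := by
      constructor
      · intro h
        have hj := j.2
        have hl := l.2
        have : d = 0 := by
          apply Int.eq_zero_of_abs_lt_dvd h
          rw [abs_lt]; constructor <;> omega
        apply Fin.ext; omega
      · rintro rfl; simp [hd]
    by_cases hjl : j = l
    · subst hjl
      rw [if_pos (hdvd.2 rfl), if_pos rfl, ← mode_add]
      simp [mode_zero]
    · rw [if_neg (fun h => hjl (hdvd.1 h)), if_neg hjl, mul_zero]
  · rw [mode_half hN hE j, neg_neg, ← mode_half hN hE l]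

/-- Fourier inversion on the grid. -/
theorem sum_freqs_dft {N : ℕ} (hN : 0 < N) (hE : Even N) (V : Fin N → ℂ) (j : Fin N) :
    V j = ∑ p ∈ freqs N, (1 / (modeFactor N p : ℂ)) * (dft V p * mode N (-p) j) := by
  have hN' : (N : ℂ) ≠ 0 := by exact_mod_cast hN.ne'
  have : ∀ p ∈ freqs N, (1 / (modeFactor N p : ℂ)) * (dft V p * mode N (-p) j) =
      ∑ l, (1 / (N : ℂ)) * V l * ((1 / (modeFactor N p : ℂ)) * (mode N p l * mode N (-p) j)) := by
    intro p _
    rw [dft, Finset.mul_sum, Finset.sum_mul, Finset.mul_sum]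
    refine Finset.sum_congr rfl fun l _ => by ring
  rw [Finset.sum_congr rfl this, Finset.sum_comm]
  simp_rw [← Finset.mul_sum, sum_freqs_mode hN hE]
  simp
  field_simp

/-- Parseval's identity in bilinear form. -/
theorem pair_eq_sum_dft {N : ℕ} (hN : 0 < N) (hE : Even N) (V W : Fin N → ℂ) :
    pair V W = ∑ p ∈ freqs N, (1 / (modeFactor N p : ℂ)) * (dft V p * dft W (-p)) := by
  have : ∀ p ∈ freqs N, (1 / (modeFactor N p : ℂ)) * (dft V p * dft W (-p)) =
      ∑ j, (1 / (N : ℂ)) * W j *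
        ((1 / (modeFactor N p : ℂ)) * (dft V p * mode N (-p) j)) := by
    intro p _
    rw [dft.eq_1 W, Finset.mul_sum, Finset.mul_sum, Finset.mul_sum]
    refine Finset.sum_congr rfl fun l _ => by ring
  rw [Finset.sum_congr rfl this, Finset.sum_comm, pair, Finset.mul_sum]
  refine Finset.sum_congr rfl fun j _ => ?_
  rw [← Finset.mul_sum, ← sum_freqs_dft hN hE V j]; ring

theorem dft_mode {N : ℕ} (hN : 0 < N) (k p : ℤ) :
    dft (mode N k) p = if (N : ℤ) ∣ k + p then 1 else 0 := by
  have hN' : (N : ℂ) ≠ 0 := by exact_mod_cast hN.ne'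
  simp_rw [dft, ← mode_add, sum_mode hN]
  split_ifs <;> simp [hN']

theorem dft_mode_of_low {N : ℕ} (hN : 0 < N) {k p : ℤ} (hk : 2 * |k| < N) (hp : p ∈ freqs N) :
    dft (mode N k) p = if p = -k then 1 else 0 := by
  rw [dft_mode hN]
  have hp' : -((N : ℤ) / 2) ≤ p ∧ p ≤ (N : ℤ) / 2 := by simpa [freqs] using hp
  have : (N : ℤ) ∣ k + p ↔ p = -k := by
    constructor
    · intro h
      have : k + p = 0 := by
        apply Int.eq_zero_of_abs_lt_dvd h
        rw [abs_lt]
        rcases abs_cases k with h | h <;> constructor <;> omega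
      omega
    · rintro rfl; simp
  simp only [this]

/-! ### The differentiation matrices in Fourier variables -/

/-- The differentiation matrix acting on complex grid vectors. -/
def diffC (xL xR : ℝ) (N m : ℕ) : Matrix (Fin N) (Fin N) ℂ :=
  Matrix.of fun j l => (diffMatrix xL xR N m j l : ℂ)

/-- The `m`-th derivative of `cardinalC`, obtained by differentiating under the sum. -/
def cardinalDeriv (xL xR : ℝ) (N m : ℕ) (l : Fin N) (x : ℝ) : ℂ :=
  (1 / (N : ℂ)) * ∑ k ∈ freqs N, (1 / (modeFactor N k : ℂ)) *
    ((Complex.I * k * baseFreq xL xR) ^ m *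
      Complex.exp (Complex.I * k * ((baseFreq xL xR * (x - gridPoint xL xR N l) : ℝ) : ℂ)))

theorem hasDerivAt_cardinalDeriv (xL xR : ℝ) (N m : ℕ) (l : Fin N) (x : ℝ) :
    HasDerivAt (cardinalDeriv xL xR N m l) (cardinalDeriv xL xR N (m + 1) l x) x := by
  unfold cardinalDeriv
  refine HasDerivAt.const_mul _ (HasDerivAt.fun_sum fun k _ => HasDerivAt.const_mul _ ?_)
  have h1 : HasDerivAt (fun x : ℝ => ((baseFreq xL xR * (x - gridPoint xL xR N l) : ℝ) : ℂ))
      ((baseFreq xL xR * 1 : ℝ) : ℂ) x :=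
    (((hasDerivAt_id x).sub_const _).const_mul _).ofReal_comp
  have h2 := (h1.const_mul (Complex.I * k)).cexp.const_mul
    ((Complex.I * k * (baseFreq xL xR : ℂ)) ^ m)
  refine h2.congr_deriv ?_
  push_cast; ring

theorem iteratedDeriv_cardinal (xL xR : ℝ) (N m : ℕ) (l : Fin N) (x : ℝ) :
    ((iteratedDeriv m (cardinal xL xR N l) x : ℝ) : ℂ) = cardinalDeriv xL xR N m l x := by
  induction m generalizing x with
  | zero =>
    rw [iteratedDeriv_zero, cardinal_coe]
    simp [cardinalC, cardinalDeriv, baseFreq, freqs]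
  | succ m ih =>
    have hd := hasDerivAt_cardinalDeriv xL xR N m l x
    have hre : HasDerivAt (iteratedDeriv m (cardinal xL xR N l))
        (cardinalDeriv xL xR N (m + 1) l x).re x := by
      have := (Complex.reCLM.hasFDerivAt.comp_hasDerivAt x hd)
      refine this.congr_of_eventuallyEq (Filter.Eventually.of_forall fun y => ?_)
      simp [← ih y]
    have him : (cardinalDeriv xL xR N (m + 1) l x).im = 0 := by
      have h1 := (Complex.imCLM.hasFDerivAt.comp_hasDerivAt x hd)
      have h2 : HasDerivAt (fun _ : ℝ => (0 : ℝ)) (cardinalDeriv xL xR N (m + 1) l x).im x := by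
        refine h1.congr_of_eventuallyEq (Filter.Eventually.of_forall fun y => ?_)
        simp [← ih y]
      exact h2.unique (hasDerivAt_const x 0)
    rw [iteratedDeriv_succ, hre.deriv]
    exact Complex.ext (by simp) (by simp [him])

theorem diffC_apply {xL xR : ℝ} (hx : xL < xR) {N : ℕ} (hN : 0 < N) (m : ℕ) (j l : Fin N) :
    diffC xL xR N m j l = (1 / (N : ℂ)) * ∑ p ∈ freqs N, (1 / (modeFactor N p : ℂ)) *
      ((Complex.I * p * baseFreq xL xR) ^ m * (mode N p j * mode N (-p) l)) := by
  have hN' : (N : ℂ) ≠ 0 := by exact_mod_cast hN.ne'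
  have hL : ((xR : ℂ) - xL) ≠ 0 := by
    have := (sub_pos.2 hx).ne'
    exact_mod_cast this
  rw [diffC, Matrix.of_apply, diffMatrix, Matrix.of_apply, iteratedDeriv_cardinal, cardinalDeriv]
  congr 1
  refine Finset.sum_congr rfl fun p _ => ?_
  congr 2
  rw [mode, mode, ← Complex.exp_add]
  congr 1
  simp only [baseFreq, gridPoint, meshSize]
  push_cast
  field_simp
  ring

/-- The differentiation matrices are Fourier multipliers: `𝔻_m` has symbol `(ipμ)^m` on the
resolved frequencies. -/
theorem pair_diffC {xL xR : ℝ} (hx : xL < xR) {N : ℕ} (hN : 0 < N) (m : ℕ) (V W : Fin N → ℂ) :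
    pair V (diffC xL xR N m *ᵥ W) = ∑ p ∈ freqs N, (1 / (modeFactor N p : ℂ)) *
      ((Complex.I * p * baseFreq xL xR) ^ m * (dft V p * dft W (-p))) := by
  simp_rw [pair, Matrix.mulVec, dotProduct, diffC_apply hx hN, dft, Finset.mul_sum,
    Finset.sum_mul, Finset.mul_sum]
  rw [Finset.sum_comm_cycle]
  refine Finset.sum_congr rfl fun p _ => ?_
  rw [Finset.sum_comm]
  refine Finset.sum_congr rfl fun j _ => Finset.sum_congr rfl fun l _ => by ring

theorem diffC_mulVec_mode {xL xR : ℝ} (hx : xL < xR) {N : ℕ} (hN : 0 < N) (hE : Even N) (m : ℕ)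
    {k : ℤ} (hk : 2 * |k| < N) :
    diffC xL xR N m *ᵥ mode N k = (Complex.I * k * baseFreq xL xR) ^ m • mode N k := by
  have hN' : (N : ℂ) ≠ 0 := by exact_mod_cast hN.ne'
  ext j
  have h1 : (diffC xL xR N m *ᵥ mode N k) j =
      N * pair (Pi.single j 1) (diffC xL xR N m *ᵥ mode N k) := by
    simp [pair, Pi.single_apply, hN']
  have hkm : k ∈ freqs N := by
    simp only [freqs, Finset.mem_Icc]
    rcases abs_cases k with h | h <;> omega
  have hfac : modeFactor N k = 1 := by
    have : |k| ≠ (N : ℤ) / 2 := by obtain ⟨n, hn⟩ := hE; omega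
    simp [modeFactor, this]
  rw [h1, pair_diffC hx hN, Finset.sum_eq_single_of_mem k hkm]
  · rw [dft_mode_of_low hN hk (neg_mem_freqs.2 hkm), if_pos rfl, hfac, dft]
    simp [Pi.single_apply]
    field_simp
  · intro p hp hpk
    rw [dft_mode_of_low hN hk (neg_mem_freqs.2 hp), if_neg (by simpa using hpk)]
    simp

/-! ### Weighted norms of grid vectors -/

/-- The discrete Fourier coefficients of `V` on the resolved frequencies, scaled so that the square
of the Euclidean norm is `∑_p w_p |V̂_p|² / c_p`. -/
def weightedDft (N : ℕ) (w : ℤ → ℝ) : (Fin N → ℂ) →ₗ[ℂ] EuclideanSpace ℂ (freqs N) where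
  toFun V := WithLp.toLp 2 fun p => ((√(w p / modeFactor N p) : ℝ) : ℂ) * dft V p
  map_add' V W := by
    ext p; simp only [dft, Pi.add_apply, PiLp.add_apply, add_mul, Finset.sum_add_distrib]; ring
  map_smul' c V := by
    ext p
    simp only [dft, Pi.smul_apply, PiLp.smul_apply, smul_eq_mul, mul_assoc, ← Finset.mul_sum,
      RingHom.id_apply]
    ring

/-- The norm with square `∑_p w_p |V̂_p|² / c_p`. -/
def weightedNorm {N : ℕ} (w : ℤ → ℝ) (V : Fin N → ℂ) : ℝ := ‖weightedDft N w V‖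

/-- The normalized discrete `L²` norm; its square is `N⁻¹ ∑_j |V_j|²`, see `gridNorm_sq`. -/
def gridNorm {N : ℕ} (V : Fin N → ℂ) : ℝ := weightedNorm (fun _ => 1) V

/-- The symbol `1 + σ (μ p)²` of `1 - σ ∂ₓ²`. -/
def symbol (xL xR σ : ℝ) (p : ℤ) : ℝ := 1 + σ * (baseFreq xL xR * p) ^ 2

/-- The normalized discrete energy norm, with square `∑_p (1 + σ (μ p)²) |V̂_p|² / c_p`, that is
`L⁻¹ (‖V‖_h² + σ |V|_h²)`. -/
def energyNorm (xL xR σ : ℝ) {N : ℕ} (V : Fin N → ℂ) : ℝ := weightedNorm (symbol xL xR σ) V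

theorem weightedNorm_nonneg {N : ℕ} (w : ℤ → ℝ) (V : Fin N → ℂ) : 0 ≤ weightedNorm w V :=
  norm_nonneg _

theorem weightedNorm_sq {N : ℕ} {w : ℤ → ℝ} (hw : ∀ p, 0 ≤ w p) (V : Fin N → ℂ) :
    weightedNorm w V ^ 2 = ∑ p ∈ freqs N, 1 / modeFactor N p * (w p * ‖dft V p‖ ^ 2) := by
  rw [weightedNorm, EuclideanSpace.norm_sq_eq, ← Finset.sum_coe_sort (freqs N)]
  refine Finset.sum_congr rfl fun p _ => ?_
  simp only [weightedDft, LinearMap.coe_mk, AddHom.coe_mk, norm_mul, Complex.norm_real,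
    Real.norm_eq_abs, mul_pow, sq_abs]
  rw [Real.sq_sqrt (div_nonneg (hw _) (modeFactor_pos _ _).le)]
  ring

theorem weightedNorm_add_le {N : ℕ} (w : ℤ → ℝ) (V W : Fin N → ℂ) :
    weightedNorm w (V + W) ≤ weightedNorm w V + weightedNorm w W := by
  simp only [weightedNorm, map_add]; exact norm_add_le _ _

theorem weightedNorm_sub_le {N : ℕ} (w : ℤ → ℝ) (V W : Fin N → ℂ) :
    weightedNorm w (V - W) ≤ weightedNorm w V + weightedNorm w W := by
  simp only [weightedNorm, map_sub]; exact norm_sub_le _ _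

theorem weightedNorm_smul {N : ℕ} (w : ℤ → ℝ) (c : ℂ) (V : Fin N → ℂ) :
    weightedNorm w (c • V) = ‖c‖ * weightedNorm w V := by
  simp only [weightedNorm, map_smul, norm_smul]

/-- Cauchy-Schwarz for a Fourier multiplier `m` dominated by `C √(w w')`. -/
theorem norm_sum_multiplier_le {N : ℕ} {w w' : ℤ → ℝ} (hw : ∀ p, 0 ≤ w p) (hw' : ∀ p, 0 ≤ w' p)
    (heven : ∀ p, w' (-p) = w' p) {m : ℤ → ℂ} {C : ℝ} (hC : 0 ≤ C)
    (hm : ∀ p ∈ freqs N, ‖m p‖ ^ 2 ≤ C ^ 2 * (w p * w' p)) (V W : Fin N → ℂ) :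
    ‖∑ p ∈ freqs N, (1 / (modeFactor N p : ℂ)) * (m p * (dft V p * dft W (-p)))‖ ≤
      C * weightedNorm w V * weightedNorm w' W := by
  set f : ℤ → ℝ := fun p => √(1 / modeFactor N p * w p) * ‖dft V p‖ with hf
  set g : ℤ → ℝ := fun p => √(1 / modeFactor N p * w' p) * ‖dft W (-p)‖ with hg
  have hb : ∀ p, 0 ≤ 1 / modeFactor N p := fun p => (one_div_pos.2 (modeFactor_pos _ _)).le
  have hfs : ∑ p ∈ freqs N, f p ^ 2 = weightedNorm w V ^ 2 := by
    rw [weightedNorm_sq hw]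
    refine Finset.sum_congr rfl fun p _ => ?_
    rw [hf]; simp only [mul_pow]; rw [Real.sq_sqrt (mul_nonneg (hb p) (hw p))]; ring
  have hgs : ∑ p ∈ freqs N, g p ^ 2 = weightedNorm w' W ^ 2 := by
    rw [weightedNorm_sq hw', ← sum_freqs_neg]
    refine Finset.sum_congr rfl fun p _ => ?_
    rw [hg]; simp only [mul_pow, neg_neg, heven, modeFactor_neg]
    rw [Real.sq_sqrt (mul_nonneg (hb p) (hw' p))]; ring
  have hterm : ∀ p ∈ freqs N,
      ‖(1 / (modeFactor N p : ℂ)) * (m p * (dft V p * dft W (-p)))‖ ≤ C * (f p * g p) := by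
    intro p hp
    have h1 : ‖m p‖ ≤ C * (√(w p) * √(w' p)) := by
      rw [← Real.sqrt_mul (hw p)]
      refine (Real.le_sqrt_of_sq_le (hm p hp)).trans (le_of_eq ?_)
      rw [Real.sqrt_mul (sq_nonneg C), Real.sqrt_sq hC]
    have h2 : f p * g p = 1 / modeFactor N p * ((√(w p) * √(w' p)) *
        (‖dft V p‖ * ‖dft W (-p)‖)) := by
      rw [hf, hg]; simp only
      rw [Real.sqrt_mul (hb p), Real.sqrt_mul (hb p)]
      have := Real.mul_self_sqrt (hb p)
      linear_combination (√(w p) * √(w' p)) * (‖dft V p‖ * ‖dft W (-p)‖) * this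
    rw [h2]
    have h3 : ‖(1 / (modeFactor N p : ℂ))‖ = 1 / modeFactor N p := by
      rw [norm_div, norm_one, Complex.norm_real, Real.norm_of_nonneg (modeFactor_pos _ _).le]
    rw [norm_mul, norm_mul, norm_mul, h3]
    calc 1 / modeFactor N p * (‖m p‖ * (‖dft V p‖ * ‖dft W (-p)‖))
        ≤ 1 / modeFactor N p * (C * (√(w p) * √(w' p)) * (‖dft V p‖ * ‖dft W (-p)‖)) := by
          have := hb p
          gcongr
      _ = _ := by ring
  refine (norm_sum_le _ _).trans ((Finset.sum_le_sum hterm).trans ?_)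
  rw [← Finset.mul_sum, mul_assoc]
  refine mul_le_mul_of_nonneg_left ?_ hC
  refine (Real.sum_mul_le_sqrt_mul_sqrt _ f g).trans ?_
  rw [hfs, hgs, Real.sqrt_sq (weightedNorm_nonneg _ _), Real.sqrt_sq (weightedNorm_nonneg _ _)]

theorem dft_conj {N : ℕ} (V : Fin N → ℂ) (p : ℤ) :
    dft (fun j => (starRingEnd ℂ) (V j)) (-p) = (starRingEnd ℂ) (dft V p) := by
  simp only [dft, map_mul, map_sum, map_div₀, map_one, map_natCast, conj_mode]

theorem gridNorm_sq {N : ℕ} (hN : 0 < N) (hE : Even N) (V : Fin N → ℂ) :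
    gridNorm V ^ 2 = 1 / N * ∑ j, ‖V j‖ ^ 2 := by
  have h := pair_eq_sum_dft hN hE V (fun j => (starRingEnd ℂ) (V j))
  simp only [dft_conj, pair, Complex.mul_conj'] at h
  rw [gridNorm, weightedNorm_sq (fun _ => zero_le_one)]
  have : ((1 / N * ∑ j, ‖V j‖ ^ 2 : ℝ) : ℂ) =
      ((∑ p ∈ freqs N, 1 / modeFactor N p * (1 * ‖dft V p‖ ^ 2) : ℝ) : ℂ) := by
    push_cast
    simpa using h
  exact_mod_cast this.symm

theorem symbol_nonneg {σ : ℝ} (hσ : 0 ≤ σ) (xL xR : ℝ) (p : ℤ) : 0 ≤ symbol xL xR σ p := by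
  unfold symbol; positivity

theorem one_le_symbol {σ : ℝ} (hσ : 0 ≤ σ) (xL xR : ℝ) (p : ℤ) : 1 ≤ symbol xL xR σ p := by
  have : 0 ≤ σ * (baseFreq xL xR * p) ^ 2 := by positivity
  unfold symbol; linarith

theorem symbol_neg (xL xR σ : ℝ) (p : ℤ) : symbol xL xR σ (-p) = symbol xL xR σ p := by
  unfold symbol; push_cast; ring

theorem weightedNorm_mono {N : ℕ} {w w' : ℤ → ℝ} {C : ℝ} (hC : 0 ≤ C) (hw : ∀ p, 0 ≤ w p)
    (hw' : ∀ p, 0 ≤ w' p) (h : ∀ p ∈ freqs N, w p ≤ C ^ 2 * w' p) (V : Fin N → ℂ) :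
    weightedNorm w V ≤ C * weightedNorm w' V := by
  refine le_of_sq_le_sq ?_ (mul_nonneg hC (weightedNorm_nonneg _ _))
  rw [mul_pow, weightedNorm_sq hw, weightedNorm_sq hw', Finset.mul_sum]
  refine Finset.sum_le_sum fun p hp => ?_
  have h1 : 0 ≤ 1 / modeFactor N p := (one_div_pos.2 (modeFactor_pos _ _)).le
  calc 1 / modeFactor N p * (w p * ‖dft V p‖ ^ 2)
      ≤ 1 / modeFactor N p * (C ^ 2 * w' p * ‖dft V p‖ ^ 2) := by
        have := h p hp
        gcongr
    _ = _ := by ring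

theorem gridNorm_nonneg {N : ℕ} (V : Fin N → ℂ) : 0 ≤ gridNorm V := weightedNorm_nonneg _ _

theorem energyNorm_nonneg (xL xR σ : ℝ) {N : ℕ} (V : Fin N → ℂ) : 0 ≤ energyNorm xL xR σ V :=
  weightedNorm_nonneg _ _

theorem gridNorm_le_energyNorm {σ : ℝ} (hσ : 0 ≤ σ) (xL xR : ℝ) {N : ℕ} (V : Fin N → ℂ) :
    gridNorm V ≤ energyNorm xL xR σ V := by
  have := weightedNorm_mono (N := N) (w := fun _ => 1) (w' := symbol xL xR σ) zero_le_one
    (fun _ => zero_le_one) (symbol_nonneg hσ xL xR)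
    (fun p _ => by simpa using one_le_symbol hσ xL xR p) V
  simpa [gridNorm, energyNorm] using this

theorem abs_le_of_mem_freqs {N : ℕ} {p : ℤ} (hp : p ∈ freqs N) : |(p : ℝ)| ≤ N / 2 := by
  have hp' : -((N : ℤ) / 2) ≤ p ∧ p ≤ (N : ℤ) / 2 := by simpa [freqs] using hp
  have : 2 * |p| ≤ N := by rcases abs_cases p with h | h <;> omega
  have : 2 * |(p : ℝ)| ≤ N := by exact_mod_cast this
  linarith

theorem symbol_le_of_abs_le {σ : ℝ} (hσ : 0 ≤ σ) (xL xR : ℝ) {p : ℤ} {B : ℝ}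
    (h : |(p : ℝ)| ≤ B) : symbol xL xR σ p ≤ 1 + σ * (baseFreq xL xR * B) ^ 2 := by
  unfold symbol
  have : (p : ℝ) ^ 2 ≤ B ^ 2 := by rw [← sq_abs]; gcongr
  rw [mul_pow, mul_pow]
  gcongr

/-- Inverse inequality: on the grid, one derivative costs a factor `N`. -/
theorem energyNorm_le_gridNorm {σ : ℝ} (hσ : 0 ≤ σ) (xL xR : ℝ) {N : ℕ} (V : Fin N → ℂ) :
    energyNorm xL xR σ V ≤ √(1 + σ * (baseFreq xL xR * (N / 2)) ^ 2) * gridNorm V := by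
  refine weightedNorm_mono (Real.sqrt_nonneg _) (symbol_nonneg hσ xL xR)
    (fun _ => zero_le_one) (fun p hp => ?_) V
  rw [Real.sq_sqrt (by positivity), mul_one]
  exact symbol_le_of_abs_le hσ xL xR (abs_le_of_mem_freqs hp)

theorem pair_comm {N : ℕ} (V W : Fin N → ℂ) : pair V W = pair W V := by
  simp only [pair, mul_comm]

theorem norm_pair_le {N : ℕ} (hN : 0 < N) (hE : Even N) (V W : Fin N → ℂ) :
    ‖pair V W‖ ≤ gridNorm V * gridNorm W := by
  rw [pair_eq_sum_dft hN hE]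
  have := norm_sum_multiplier_le (N := N) (w := fun _ => 1) (w' := fun _ => 1) (m := fun _ => 1)
    (fun _ => zero_le_one) (fun _ => zero_le_one) (fun _ => rfl) zero_le_one (by simp) V W
  simpa [gridNorm] using this

theorem norm_pair_diffC_one_le {σ : ℝ} (hσ : 0 < σ) {xL xR : ℝ} (hx : xL < xR) {N : ℕ}
    (hN : 0 < N) (V W : Fin N → ℂ) :
    ‖pair V (diffC xL xR N 1 *ᵥ W)‖ ≤ 1 / √σ * gridNorm V * energyNorm xL xR σ W := by
  rw [pair_diffC hx hN]
  refine norm_sum_multiplier_le (fun _ => zero_le_one) (symbol_nonneg hσ.le xL xR)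
    (symbol_neg xL xR σ) (by positivity) (fun p _ => ?_) V W
  rw [pow_one, norm_mul, norm_mul, Complex.norm_I, Complex.norm_intCast, Complex.norm_real,
    Real.norm_eq_abs, one_mul, mul_pow, sq_abs, sq_abs, div_pow, Real.sq_sqrt hσ.le, symbol]
  field_simp
  nlinarith

/-- The operator `1 - σ 𝔻₂` is bounded with respect to the energy norm. -/
theorem norm_pair_helmholtz_le {σ : ℝ} (hσ : 0 ≤ σ) {xL xR : ℝ} (hx : xL < xR) {N : ℕ}
    (hN : 0 < N) (hE : Even N) (V W : Fin N → ℂ) :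
    ‖pair V W - σ * pair V (diffC xL xR N 2 *ᵥ W)‖ ≤
      energyNorm xL xR σ V * energyNorm xL xR σ W := by
  rw [pair_diffC hx hN, pair_eq_sum_dft hN hE, Finset.mul_sum, ← Finset.sum_sub_distrib]
  have := norm_sum_multiplier_le (N := N) (m := fun p => (symbol xL xR σ p : ℂ))
    (symbol_nonneg hσ xL xR) (symbol_nonneg hσ xL xR) (symbol_neg xL xR σ) zero_le_one
    (fun p _ => by
      rw [Complex.norm_real, Real.norm_of_nonneg (symbol_nonneg hσ xL xR p)]
      exact le_of_eq (by ring)) V W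
  rw [one_mul] at this
  refine le_trans (le_of_eq ?_) this
  congr 1
  refine Finset.sum_congr rfl fun p _ => ?_
  simp only [symbol]
  push_cast
  linear_combination (-1 / (modeFactor N p : ℂ)) * σ * (p * baseFreq xL xR) ^ 2 *
    (dft V p * dft W (-p)) * Complex.I_sq

theorem pair_diffC_one_left {xL xR : ℝ} (hx : xL < xR) {N : ℕ} (hN : 0 < N) (V W : Fin N → ℂ) :
    pair (diffC xL xR N 1 *ᵥ V) W = -pair V (diffC xL xR N 1 *ᵥ W) := by
  rw [pair_comm, pair_diffC hx hN, pair_diffC hx hN, ← sum_freqs_neg, ← Finset.sum_neg_distrib]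
  refine Finset.sum_congr rfl fun p _ => ?_
  rw [modeFactor_neg, neg_neg]; push_cast; ring

theorem pair_diffC_two_left {xL xR : ℝ} (hx : xL < xR) {N : ℕ} (hN : 0 < N) (V W : Fin N → ℂ) :
    pair (diffC xL xR N 2 *ᵥ V) W = pair V (diffC xL xR N 2 *ᵥ W) := by
  rw [pair_comm, pair_diffC hx hN, pair_diffC hx hN, ← sum_freqs_neg]
  refine Finset.sum_congr rfl fun p _ => ?_
  rw [modeFactor_neg, neg_neg]; push_cast; ring

theorem gridNorm_le_of_norm_pair_le {N : ℕ} (hN : 0 < N) (hE : Even N) {V : Fin N → ℂ} {B : ℝ}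
    (hB : 0 ≤ B) (h : ∀ W : Fin N → ℂ, ‖pair W V‖ ≤ gridNorm W * B) : gridNorm V ≤ B := by
  have h1 := h (fun j => (starRingEnd ℂ) (V j))
  have h2 : gridNorm (fun j => (starRingEnd ℂ) (V j)) = gridNorm V := by
    rw [← sq_eq_sq₀ (gridNorm_nonneg _) (gridNorm_nonneg _), gridNorm_sq hN hE, gridNorm_sq hN hE]
    simp
  have h3 : ‖pair (fun j => (starRingEnd ℂ) (V j)) V‖ = gridNorm V ^ 2 := by
    have : pair (fun j => (starRingEnd ℂ) (V j)) V = ((gridNorm V ^ 2 : ℝ) : ℂ) := by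
      rw [gridNorm_sq hN hE]; simp [pair, Complex.conj_mul']
    rw [this, Complex.norm_real, Real.norm_of_nonneg (sq_nonneg _)]
  rw [h2, h3, sq] at h1
  rcases (gridNorm_nonneg V).eq_or_lt with h0 | h0
  · rw [← h0]; exact hB
  · exact le_of_mul_le_mul_left h1 h0

theorem gridNorm_diffC_one_le {σ : ℝ} (hσ : 0 < σ) {xL xR : ℝ} (hx : xL < xR) {N : ℕ}
    (hN : 0 < N) (hE : Even N) (W : Fin N → ℂ) :
    gridNorm (diffC xL xR N 1 *ᵥ W) ≤ 1 / √σ * energyNorm xL xR σ W := by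
  refine gridNorm_le_of_norm_pair_le hN hE
    (mul_nonneg (by positivity) (energyNorm_nonneg _ _ _ _)) fun V => ?_
  refine (norm_pair_diffC_one_le hσ hx hN V W).trans (le_of_eq (by ring))

theorem summable_one_add_abs_rpow {q : ℝ} (hq : 1 < q) :
    Summable fun m : ℤ => (1 + |(m : ℝ)|) ^ (-q) := by
  have h : Summable fun n : ℕ => (1 + (n : ℝ)) ^ (-q) := by
    have := (summable_nat_add_iff 1).2 (Real.summable_nat_rpow.2 (neg_lt_neg hq))
    refine this.congr fun n => ?_
    push_cast; rw [add_comm]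
  refine Summable.of_nat_of_neg (f := fun m : ℤ => (1 + |(m : ℝ)|) ^ (-q)) ?_ ?_ <;> simpa using h

theorem one_add_abs_sq_le {σ : ℝ} (hσ : 0 < σ) {xL xR : ℝ} (hx : xL < xR) (p : ℤ) :
    (1 + |(p : ℝ)|) ^ 2 ≤ 2 * (1 + 1 / (σ * baseFreq xL xR ^ 2)) * symbol xL xR σ p := by
  have hμ : 0 < baseFreq xL xR := div_pos (by positivity) (sub_pos.2 hx)
  have hc : 0 < σ * baseFreq xL xR ^ 2 := by positivity
  unfold symbol
  set c := σ * baseFreq xL xR ^ 2 with hcdef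
  have h1 : σ * (baseFreq xL xR * p) ^ 2 = c * (p : ℝ) ^ 2 := by rw [hcdef]; ring
  rw [h1]
  have h2 : (1 + 1 / c) * (1 + c * (p : ℝ) ^ 2) = 1 + (p : ℝ) ^ 2 + (1 / c + c * (p : ℝ) ^ 2) := by
    field_simp; ring
  have h3 : 0 ≤ 1 / c + c * (p : ℝ) ^ 2 := by positivity
  nlinarith [sq_abs (p : ℝ), sq_nonneg (|(p : ℝ)| - 1)]

theorem summable_one_div_symbol {σ : ℝ} (hσ : 0 < σ) {xL xR : ℝ} (hx : xL < xR) :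
    Summable fun p : ℤ => 1 / symbol xL xR σ p := by
  have h := (summable_one_add_abs_rpow (q := 2) (by norm_num)).mul_left
    (2 * (1 + 1 / (σ * baseFreq xL xR ^ 2)))
  refine Summable.of_nonneg_of_le (fun p => div_nonneg zero_le_one (symbol_nonneg hσ.le _ _ _))
    (fun p => ?_) h
  have hs : 0 < symbol xL xR σ p := zero_lt_one.trans_le (one_le_symbol hσ.le _ _ _)
  have hp : 0 < 1 + |(p : ℝ)| := by positivity
  rw [Real.rpow_neg hp.le, Real.rpow_two, ← div_eq_mul_inv, div_le_div_iff₀ hs (by positivity)]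
  simpa using one_add_abs_sq_le hσ hx p

/-- The constant of the discrete Sobolev inequality. -/
def sobolevConst (xL xR σ : ℝ) : ℝ := √(∑' p : ℤ, 1 / symbol xL xR σ p)

/-- Discrete Sobolev inequality. -/
theorem norm_apply_le_energyNorm {σ : ℝ} (hσ : 0 < σ) {xL xR : ℝ} (hx : xL < xR) {N : ℕ}
    (hN : 0 < N) (hE : Even N) (V : Fin N → ℂ) (j : Fin N) :
    ‖V j‖ ≤ sobolevConst xL xR σ * energyNorm xL xR σ V := by
  have hs : ∀ p, 0 < symbol xL xR σ p := fun p =>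
    zero_lt_one.trans_le (one_le_symbol hσ.le _ _ _)
  have hb : ∀ p, 0 < 1 / modeFactor N p := fun p => one_div_pos.2 (modeFactor_pos _ _)
  have hb1 : ∀ p, 1 / modeFactor N p ≤ 1 := fun p => by
    unfold modeFactor; split_ifs <;> norm_num
  rw [sum_freqs_dft hN hE V j]
  refine (norm_sum_le _ _).trans ?_
  have hterm : ∀ p ∈ freqs N, ‖(1 / (modeFactor N p : ℂ)) * (dft V p * mode N (-p) j)‖ =
      √(1 / modeFactor N p * (1 / symbol xL xR σ p)) *
        (√(1 / modeFactor N p * symbol xL xR σ p) * ‖dft V p‖) := by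
    intro p _
    rw [norm_mul, norm_mul, norm_mode, mul_one, norm_div, norm_one, Complex.norm_real,
      Real.norm_of_nonneg (modeFactor_pos _ _).le, ← mul_assoc,
      ← Real.sqrt_mul (mul_pos (hb p) (one_div_pos.2 (hs p))).le]
    have : 1 / modeFactor N p * (1 / symbol xL xR σ p) * (1 / modeFactor N p * symbol xL xR σ p)
        = (1 / modeFactor N p) ^ 2 := by
      have := (hs p).ne'
      field_simp
    rw [this, Real.sqrt_sq (hb p).le]
  rw [Finset.sum_congr rfl hterm]
  refine (Real.sum_mul_le_sqrt_mul_sqrt _ _ _).trans ?_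
  refine mul_le_mul ?_ (le_of_eq ?_) (Real.sqrt_nonneg _) (Real.sqrt_nonneg _)
  · refine Real.sqrt_le_sqrt ?_
    refine le_trans (Finset.sum_le_sum fun p _ => ?_)
      ((summable_one_div_symbol hσ hx).sum_le_tsum (freqs N)
        (fun p _ => (one_div_pos.2 (hs p)).le))
    rw [Real.sq_sqrt (mul_pos (hb p) (one_div_pos.2 (hs p))).le]
    exact mul_le_of_le_one_left (one_div_pos.2 (hs p)).le (hb1 p)
  · rw [← Real.sqrt_sq (energyNorm_nonneg xL xR σ V), energyNorm,
      weightedNorm_sq fun p => (hs p).le]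
    congr 1
    refine Finset.sum_congr rfl fun p _ => ?_
    rw [mul_pow, Real.sq_sqrt (mul_pos (hb p) (hs p)).le]; ring

theorem sobolevConst_nonneg (xL xR σ : ℝ) : 0 ≤ sobolevConst xL xR σ := Real.sqrt_nonneg _

theorem gridNorm_mul_le {N : ℕ} (hN : 0 < N) (hE : Even N) {X Y : Fin N → ℂ} {B : ℝ}
    (hB : 0 ≤ B) (h : ∀ j, ‖X j‖ ≤ B) : gridNorm (X * Y) ≤ B * gridNorm Y := by
  refine le_of_sq_le_sq ?_ (mul_nonneg hB (gridNorm_nonneg _))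
  rw [mul_pow, gridNorm_sq hN hE, gridNorm_sq hN hE, mul_left_comm]
  refine mul_le_mul_of_nonneg_left ?_ (by positivity)
  rw [Finset.mul_sum]
  refine Finset.sum_le_sum fun j _ => ?_
  rw [Pi.mul_apply, norm_mul, mul_pow]
  have := h j
  gcongr

/-- The constant bounding the convective trilinear forms by energy norms. -/
def convConst (xL xR σ : ℝ) : ℝ := sobolevConst xL xR σ / √σ

theorem convConst_nonneg (xL xR σ : ℝ) : 0 ≤ convConst xL xR σ :=
  div_nonneg (sobolevConst_nonneg _ _ _) (Real.sqrt_nonneg _)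

theorem norm_pair_mul_diffC_le {σ : ℝ} (hσ : 0 < σ) {xL xR : ℝ} (hx : xL < xR) {N : ℕ}
    (hN : 0 < N) (hE : Even N) (X Y Z : Fin N → ℂ) :
    ‖pair (X * (diffC xL xR N 1 *ᵥ Y)) Z‖ ≤ convConst xL xR σ *
      (energyNorm xL xR σ X * energyNorm xL xR σ Y * energyNorm xL xR σ Z) := by
  have hX := energyNorm_nonneg xL xR σ X
  have hY := energyNorm_nonneg xL xR σ Y
  have hS := sobolevConst_nonneg xL xR σ
  calc _ ≤ gridNorm (X * (diffC xL xR N 1 *ᵥ Y)) * gridNorm Z := norm_pair_le hN hE _ _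
    _ ≤ ((sobolevConst xL xR σ * energyNorm xL xR σ X) * (1 / √σ * energyNorm xL xR σ Y)) *
        energyNorm xL xR σ Z := by
      refine mul_le_mul ?_ (gridNorm_le_energyNorm hσ.le _ _ _) (gridNorm_nonneg _) (by positivity)
      refine (gridNorm_mul_le hN hE (by positivity)
        (norm_apply_le_energyNorm hσ hx hN hE X)).trans ?_
      exact mul_le_mul_of_nonneg_left (gridNorm_diffC_one_le hσ hx hN hE Y) (by positivity)
    _ = _ := by rw [convConst]; ring

theorem norm_pair_diffC_left_le {σ : ℝ} (hσ : 0 < σ) {xL xR : ℝ} (hx : xL < xR) {N : ℕ}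
    (hN : 0 < N) (X Z : Fin N → ℂ) :
    ‖pair (diffC xL xR N 1 *ᵥ X) Z‖ ≤ 1 / √σ * gridNorm X * energyNorm xL xR σ Z := by
  rw [pair_diffC_one_left hx hN, norm_neg]
  exact norm_pair_diffC_one_le hσ hx hN X Z

theorem norm_pair_diffC_mul_le {σ : ℝ} (hσ : 0 < σ) {xL xR : ℝ} (hx : xL < xR) {N : ℕ}
    (hN : 0 < N) (hE : Even N) (X Y Z : Fin N → ℂ) :
    ‖pair (diffC xL xR N 1 *ᵥ (X * Y)) Z‖ ≤ convConst xL xR σ *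
      (energyNorm xL xR σ X * energyNorm xL xR σ Y * energyNorm xL xR σ Z) := by
  have hX := energyNorm_nonneg xL xR σ X
  have hZ := energyNorm_nonneg xL xR σ Z
  have hS := sobolevConst_nonneg xL xR σ
  calc _ ≤ 1 / √σ * gridNorm (X * Y) * energyNorm xL xR σ Z :=
        norm_pair_diffC_left_le hσ hx hN _ _
    _ ≤ 1 / √σ * ((sobolevConst xL xR σ * energyNorm xL xR σ X) * energyNorm xL xR σ Y) *
        energyNorm xL xR σ Z := by
      gcongr
      refine (gridNorm_mul_le hN hE (by positivity)
        (norm_apply_le_energyNorm hσ hx hN hE X)).trans ?_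
      exact mul_le_mul_of_nonneg_left (gridNorm_le_energyNorm hσ.le _ _ _) (by positivity)
    _ = _ := by rw [convConst]; ring

theorem gridNorm_mode {N : ℕ} (hN : 0 < N) (hE : Even N) (k : ℤ) : gridNorm (mode N k) = 1 := by
  have hN' : (N : ℝ) ≠ 0 := by exact_mod_cast hN.ne'
  rw [← sq_eq_sq₀ (gridNorm_nonneg _) zero_le_one, gridNorm_sq hN hE]
  simp [norm_mode, hN']

theorem energyNorm_mode_le {σ : ℝ} (hσ : 0 ≤ σ) (xL xR : ℝ) {N : ℕ} (hN : 0 < N) (hE : Even N)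
    (k : ℤ) : energyNorm xL xR σ (mode N k) ≤ √(symbol xL xR σ k) := by
  by_cases hk : 2 * |k| < N
  · refine Real.le_sqrt_of_sq_le ?_
    have h : ∀ p ∈ freqs N, 1 / modeFactor N p * (symbol xL xR σ p * ‖dft (mode N k) p‖ ^ 2) =
        symbol xL xR σ k * (1 / modeFactor N p * (1 * ‖dft (mode N k) p‖ ^ 2)) := by
      intro p hp
      rw [dft_mode_of_low hN hk hp]
      split_ifs with hpk
      · rw [hpk, symbol_neg]; ring
      · simp
    rw [energyNorm, weightedNorm_sq (symbol_nonneg hσ _ _), Finset.sum_congr rfl h,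
      ← Finset.mul_sum, ← weightedNorm_sq (w := fun _ => 1) (fun _ => zero_le_one)]
    have := gridNorm_mode hN hE k
    rw [gridNorm] at this
    rw [this]; simp
  · refine (energyNorm_le_gridNorm hσ xL xR _).trans ?_
    rw [gridNorm_mode hN hE, mul_one]
    refine Real.sqrt_le_sqrt ?_
    unfold symbol
    have h1 : (N : ℝ) ≤ 2 * |(k : ℝ)| := by
      push Not at hk
      exact_mod_cast hk
    have h2 : ((N : ℝ) / 2) ^ 2 ≤ (k : ℝ) ^ 2 := by
      rw [← sq_abs (k : ℝ)]; gcongr; linarith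
    rw [mul_pow, mul_pow]
    gcongr

theorem energyNorm_le_of_hasSum {σ : ℝ} (hσ : 0 ≤ σ) (xL xR : ℝ) {N : ℕ} (hN : 0 < N)
    (hE : Even N) {c : ℤ → ℂ} {V : Fin N → ℂ} {B : ℝ}
    (hV : ∀ j, HasSum (fun k => c k * mode N k j) (V j))
    (hc : HasSum (fun k => ‖c k‖ * √(symbol xL xR σ k)) B) : energyNorm xL xR σ V ≤ B := by
  have h1 : HasSum (fun k => c k • mode N k) V := by
    rw [Pi.hasSum]; simpa using hV
  have h2 := (weightedDft N (symbol xL xR σ)).toContinuousLinearMap.hasSum h1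
  refine h2.norm_le_of_bounded hc fun k => ?_
  simp only [LinearMap.coe_toContinuousLinearMap', map_smul, norm_smul]
  exact mul_le_mul_of_nonneg_left (energyNorm_mode_le hσ xL xR hN hE k) (norm_nonneg _)

/-! ### Aliasing -/

/-- Cauchy-Schwarz for square summable families of nonnegative numbers. -/
theorem summable_mul_and_tsum_le {ι : Type*} {f g : ι → ℝ} (hf : ∀ i, 0 ≤ f i)
    (hg : ∀ i, 0 ≤ g i) (hf2 : Summable fun i => f i ^ 2) (hg2 : Summable fun i => g i ^ 2) :
    (Summable fun i => f i * g i) ∧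
      ∑' i, f i * g i ≤ √(∑' i, f i ^ 2) * √(∑' i, g i ^ 2) := by
  have := Real.summable_and_inner_le_Lp_mul_Lq_tsum_of_nonneg Real.HolderConjugate.two_two hf hg
    (by simpa using hf2) (by simpa using hg2)
  simpa [Real.sqrt_eq_rpow] using this

/-- Aliasing: the discrete Fourier coefficient at `p` collects all frequencies congruent to `-p`. -/
theorem hasSum_dft {N : ℕ} (hN : 0 < N) {c : ℤ → ℂ} {V : Fin N → ℂ}
    (hV : ∀ j, HasSum (fun k => c k * mode N k j) (V j)) (p : ℤ) :
    HasSum (fun k => if (N : ℤ) ∣ k + p then c k else 0) (dft V p) := by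
  have h1 : HasSum (fun k => (1 / (N : ℂ)) * ∑ l, (c k * mode N k l) * mode N p l) (dft V p) :=
    (hasSum_sum fun l _ => (hV l).mul_right (mode N p l)).mul_left _
  refine h1.congr_fun fun k => ?_
  have h2 := dft_mode hN k p
  calc (if (N : ℤ) ∣ k + p then c k else 0) = c k * dft (mode N k) p := by rw [h2]; simp
    _ = _ := by
      simp only [dft, mul_assoc, ← Finset.mul_sum]; ring

/-- The tail of a residue class modulo `N` beyond `N/4` is summed with a factor `N^{-2s}`. -/
theorem summable_residue_tail {N : ℕ} (hN : 0 < N) {s : ℝ} (hs : 1 / 2 < s) {p : ℤ}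
    (hp : p ∈ freqs N) :
    (Summable fun k : ℤ => (if (N : ℤ) ∣ k + p ∧ ¬ 4 * |k| < N then |(k : ℝ)| ^ (-s) else 0) ^ 2) ∧
    ∑' k : ℤ, (if (N : ℤ) ∣ k + p ∧ ¬ 4 * |k| < N then |(k : ℝ)| ^ (-s) else 0) ^ 2 ≤
      ((N : ℝ) / 4) ^ (-(2 * s)) * ∑' m : ℤ, (1 + |(m : ℝ)|) ^ (-(2 * s)) := by
  set F : ℤ → ℝ := fun k => (if (N : ℤ) ∣ k + p ∧ ¬ 4 * |k| < N then |(k : ℝ)| ^ (-s) else 0) ^ 2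
    with hF
  have hNr : (0 : ℝ) < N := by exact_mod_cast hN
  have hinj : Function.Injective fun m : ℤ => m * (N : ℤ) - p := by
    intro a b hab
    have hN0 : (N : ℤ) ≠ 0 := by omega
    exact mul_right_cancel₀ hN0 (sub_left_injective hab)
  have hF0 : ∀ x ∉ Set.range (fun m : ℤ => m * (N : ℤ) - p), F x = 0 := by
    intro x hxr
    have : ¬ (N : ℤ) ∣ x + p := by
      rintro ⟨m, hm⟩
      exact hxr ⟨m, by simp only; rw [mul_comm, ← hm]; ring⟩
    simp [hF, this]
  have hle : ∀ m : ℤ, F (m * (N : ℤ) - p) ≤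
      ((N : ℝ) / 4) ^ (-(2 * s)) * (1 + |(m : ℝ)|) ^ (-(2 * s)) := by
    intro m
    have hm0 : (0 : ℝ) < 1 + |(m : ℝ)| := by positivity
    simp only [hF]
    split_ifs with h
    · have hlow : (N : ℝ) / 4 * (1 + |(m : ℝ)|) ≤ |((m * (N : ℤ) - p : ℤ) : ℝ)| := by
        rcases eq_or_ne m 0 with rfl | hm
        · have : (N : ℤ) ≤ 4 * |0 * (N : ℤ) - p| := not_lt.1 h.2
          have : (N : ℝ) ≤ 4 * |((0 * (N : ℤ) - p : ℤ) : ℝ)| := by exact_mod_cast this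
          simp only [Int.cast_zero, abs_zero]
          linarith
        · have hm1 : (1 : ℝ) ≤ |(m : ℝ)| := by exact_mod_cast Int.one_le_abs hm
          have hpb := abs_le_of_mem_freqs hp
          have h1 : |(m : ℝ) * N| - |(p : ℝ)| ≤ |(m : ℝ) * N - p| := abs_sub_abs_le_abs_sub _ _
          rw [abs_mul, abs_of_pos hNr] at h1
          push_cast
          nlinarith
      rw [← Real.rpow_mul_natCast (abs_nonneg _), ← Real.mul_rpow (by positivity) hm0.le]
      have : -s * ((2 : ℕ) : ℝ) = -(2 * s) := by push_cast; ring
      rw [this]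
      exact Real.rpow_le_rpow_of_nonpos (by positivity) hlow (by linarith)
    · simp only [ne_eq, OfNat.ofNat_ne_zero, not_false_eq_true, zero_pow]
      positivity
  have hsum := (summable_one_add_abs_rpow (q := 2 * s) (by linarith)).mul_left
    (((N : ℝ) / 4) ^ (-(2 * s)))
  have hcomp : Summable (F ∘ fun m : ℤ => m * (N : ℤ) - p) :=
    Summable.of_nonneg_of_le (fun m => sq_nonneg _) hle hsum
  refine ⟨(hinj.summable_iff hF0).1 hcomp, ?_⟩
  rw [← hinj.tsum_eq (f := F) (fun x hx => by
    by_contra h; exact hx (hF0 x h)), ← tsum_mul_left]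
  exact hcomp.tsum_le_tsum hle hsum

/-- The constant of the aliasing estimate. -/
def aliasConst (s : ℝ) : ℝ := 4 ^ s * √(∑' m : ℤ, (1 + |(m : ℝ)|) ^ (-(2 * s)))

theorem aliasConst_nonneg (s : ℝ) : 0 ≤ aliasConst s := by unfold aliasConst; positivity

/-- Aliasing estimate: a series over the frequencies `|k| ≥ N/4` whose coefficients are in the
Sobolev space of order `s > 1/2` is `O(N^{-s})` in the discrete `L²` norm. Summing absolute values
would lose half a power of `N`; orthogonality of the residue classes is essential. -/
theorem gridNorm_le_of_hasSum_high {N : ℕ} (hN : 0 < N) (hE : Even N) {s : ℝ} (hs : 1 / 2 < s)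
    {c : ℤ → ℂ} {d : ℤ → ℝ} {V : Fin N → ℂ} (hd0 : ∀ k, 0 ≤ d k)
    (hd : Summable fun k => d k ^ 2)
    (hV : ∀ j, HasSum (fun k => c k * mode N k j) (V j))
    (hc : ∀ k, ‖c k‖ ≤ if 4 * |k| < N then 0 else |(k : ℝ)| ^ (-s) * d k) :
    gridNorm V ≤ aliasConst s * (N : ℝ) ^ (-s) * √(∑' k, d k ^ 2) := by
  have hNr : (0 : ℝ) < N := by exact_mod_cast hN
  set A : ℝ := ((N : ℝ) / 4) ^ (-(2 * s)) * ∑' m : ℤ, (1 + |(m : ℝ)|) ^ (-(2 * s)) with hA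
  have hA0 : 0 ≤ A := mul_nonneg (by positivity) (tsum_nonneg fun m => by positivity)
  have hχ : ∀ p : ℤ, Summable fun k => (if (N : ℤ) ∣ k + p then d k else 0) ^ 2 := fun p => by
    refine Summable.of_nonneg_of_le (fun k => sq_nonneg _) (fun k => ?_) hd
    split_ifs
    · exact le_rfl
    · simpa using sq_nonneg (d k)
  have hdft : ∀ p ∈ freqs N, ‖dft V p‖ ^ 2 ≤
      A * ∑' k, (if (N : ℤ) ∣ k + p then d k else 0) ^ 2 := by
    intro p hp
    obtain ⟨hs1, hs2⟩ := summable_residue_tail hN hs hp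
    obtain ⟨ht1, ht2⟩ := summable_mul_and_tsum_le
      (fun k : ℤ => by split_ifs <;> positivity)
      (fun k => by split_ifs <;> [exact hd0 k; exact le_rfl]) hs1 (hχ p)
    have h1 : ‖dft V p‖ ≤ _ := (hasSum_dft hN hV p).norm_le_of_bounded ht1.hasSum (fun k => by
      have := hc k
      by_cases h1 : (N : ℤ) ∣ k + p <;> by_cases h2 : 4 * |k| < N <;> simp_all)
    have h2 := h1.trans ht2
    have h3 : 0 ≤ ∑' k, (if (N : ℤ) ∣ k + p then d k else 0) ^ 2 := tsum_nonneg fun k => sq_nonneg _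
    calc ‖dft V p‖ ^ 2 ≤ _ := pow_le_pow_left₀ (norm_nonneg _) h2 2
      _ ≤ A * ∑' k, (if (N : ℤ) ∣ k + p then d k else 0) ^ 2 := by
        rw [mul_pow, Real.sq_sqrt (tsum_nonneg fun k => sq_nonneg _), Real.sq_sqrt h3]
        exact mul_le_mul_of_nonneg_right hs2 h3
  have hsq : gridNorm V ^ 2 ≤ A * ∑' k, d k ^ 2 := by
    rw [gridNorm, weightedNorm_sq fun _ => zero_le_one]
    calc _ ≤ ∑ p ∈ freqs N, 1 / modeFactor N p *
          (A * ∑' k, (if (N : ℤ) ∣ k + p then d k else 0) ^ 2) := by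
          refine Finset.sum_le_sum fun p hp => ?_
          rw [one_mul]
          exact mul_le_mul_of_nonneg_left (hdft p hp) (one_div_pos.2 (modeFactor_pos _ _)).le
      _ = A * ∑' k, ∑ p ∈ freqs N,
          1 / modeFactor N p * (if (N : ℤ) ∣ k + p then d k else 0) ^ 2 := by
          rw [Summable.tsum_finsetSum fun p _ => (hχ p).mul_left _, Finset.mul_sum]
          refine Finset.sum_congr rfl fun p _ => ?_
          rw [tsum_mul_left]; ring
      _ = A * ∑' k, d k ^ 2 := by
          congr 2
          ext k
          -- the weights of the residue class of a frequency add up to one, by Parseval for a mode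
          have h1 := gridNorm_mode hN hE k
          have h2 : gridNorm (mode N k) ^ 2 = 1 := by rw [h1, one_pow]
          rw [gridNorm, weightedNorm_sq fun _ => zero_le_one] at h2
          refine Eq.trans ?_ ((congrArg (· * d k ^ 2) h2).trans (one_mul _))
          simp only [Finset.sum_mul]
          refine Finset.sum_congr rfl fun p _ => ?_
          rw [dft_mode hN]
          split_ifs <;> simp
  refine le_of_sq_le_sq ?_ (mul_nonneg (mul_nonneg (aliasConst_nonneg s) (by positivity))
    (Real.sqrt_nonneg _))
  refine hsq.trans (le_of_eq ?_)
  rw [mul_pow, mul_pow, Real.sq_sqrt (tsum_nonneg fun k => sq_nonneg _), aliasConst, mul_pow,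
    Real.sq_sqrt (tsum_nonneg fun m => by positivity), hA,
    Real.div_rpow hNr.le (by norm_num), ← Real.rpow_mul_natCast hNr.le,
    ← Real.rpow_mul_natCast (by norm_num : (0 : ℝ) ≤ 4),
    Real.rpow_neg (by norm_num : (0 : ℝ) ≤ 4)]
  have : -s * ((2 : ℕ) : ℝ) = -(2 * s) := by push_cast; ring
  have h' : s * ((2 : ℕ) : ℝ) = 2 * s := by push_cast; ring
  rw [this, h']
  field_simp

/-! ### Grid values of Fourier series -/

/-- The grid values of the Fourier series with coefficients `c`. -/
def synth (N : ℕ) (c : ℤ → ℂ) (j : Fin N) : ℂ := ∑' k, c k * mode N k j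

/-- The frequencies below `N/4`; products of two such modes are still resolved exactly. -/
def lowFreqs (N : ℕ) : Finset ℤ := {k ∈ Finset.Icc (-(N : ℤ)) N | 4 * |k| < N}

theorem mem_lowFreqs {N : ℕ} {k : ℤ} : k ∈ lowFreqs N ↔ 4 * |k| < N := by
  simp only [lowFreqs, Finset.mem_filter, Finset.mem_Icc, and_iff_right_iff_imp]
  intro h; rcases abs_cases k with h' | h' <;> omega

/-- The part of a coefficient family with `|k| ≥ N/4`. -/
def highPart (N : ℕ) (c : ℤ → ℂ) (k : ℤ) : ℂ := if 4 * |k| < N then 0 else c k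

/-- The grid values of the part of the Fourier series with `|k| < N/4`. -/
def synthLow (N : ℕ) (c : ℤ → ℂ) : Fin N → ℂ := ∑ k ∈ lowFreqs N, c k • mode N k

theorem summable_mul_mode {c : ℤ → ℂ} (hc : Summable fun k => ‖c k‖) {N : ℕ} (j : Fin N) :
    Summable fun k => c k * mode N k j :=
  Summable.of_norm (by simpa [norm_mode] using hc)

theorem hasSum_synth {c : ℤ → ℂ} (hc : Summable fun k => ‖c k‖) {N : ℕ} (j : Fin N) :
    HasSum (fun k => c k * mode N k j) (synth N c j) := (summable_mul_mode hc j).hasSum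

theorem summable_norm_highPart {c : ℤ → ℂ} (hc : Summable fun k => ‖c k‖) (N : ℕ) :
    Summable fun k => ‖highPart N c k‖ :=
  Summable.of_nonneg_of_le (fun _ => norm_nonneg _)
    (fun k => by unfold highPart; split_ifs <;> simp) hc

theorem synth_eq_low_add_high {c : ℤ → ℂ} (hc : Summable fun k => ‖c k‖) (N : ℕ) :
    synth N c = synthLow N c + synth N (highPart N c) := by
  ext j
  have h1 : HasSum (fun k => if k ∈ lowFreqs N then c k * mode N k j else 0)
      (∑ k ∈ lowFreqs N, if k ∈ lowFreqs N then c k * mode N k j else 0) :=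
    hasSum_sum_of_ne_finset_zero fun k hk => if_neg hk
  have h2 := h1.add (hasSum_synth (summable_norm_highPart hc N) j)
  refine (hasSum_synth hc j).unique ?_
  convert h2 using 1
  · ext k
    by_cases h : 4 * |k| < N <;> simp [mem_lowFreqs, highPart, h]
  · rw [Pi.add_apply, synthLow, Finset.sum_apply]
    congr 1
    refine Finset.sum_congr rfl fun k hk => ?_
    simp [hk]

/-! ### Sobolev weights -/

/-- The constant comparing `(1 + |k|)²` with `1 + (μ k)²`. -/
def weightConst (xL xR : ℝ) : ℝ := 2 * (1 + 1 / baseFreq xL xR ^ 2)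

theorem weightConst_pos (xL xR : ℝ) : 0 < weightConst xL xR := by unfold weightConst; positivity

theorem sobolevWeight_eq (xL xR s : ℝ) (k : ℤ) :
    sobolevWeight (xR - xL) s k = symbol xL xR 1 k ^ (s / 2) := by
  unfold sobolevWeight symbol baseFreq
  congr 2; ring

theorem sobolevWeight_pos (xL xR s : ℝ) (k : ℤ) : 0 < sobolevWeight (xR - xL) s k := by
  unfold sobolevWeight; positivity

theorem inv_sobolevWeight_le {xL xR : ℝ} (hx : xL < xR) {s : ℝ} (hs : 0 ≤ s) (k : ℤ) :
    (sobolevWeight (xR - xL) s k)⁻¹ ≤ weightConst xL xR ^ (s / 2) * (1 + |(k : ℝ)|) ^ (-s) := by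
  have h0 := one_add_abs_sq_le one_pos hx k
  rw [one_mul] at h0
  have hX : 0 < symbol xL xR 1 k := zero_lt_one.trans_le (one_le_symbol zero_le_one _ _ _)
  have hk : 0 < 1 + |(k : ℝ)| := by positivity
  have h1 : (1 + |(k : ℝ)|) ^ s ≤ weightConst xL xR ^ (s / 2) * symbol xL xR 1 k ^ (s / 2) := by
    rw [← Real.mul_rpow (weightConst_pos _ _).le hX.le]
    have h2 : (1 + |(k : ℝ)|) ^ s = ((1 + |(k : ℝ)|) ^ 2) ^ (s / 2) := by
      rw [← Real.rpow_natCast_mul hk.le]; congr 1; push_cast; ring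
    rw [h2]
    exact Real.rpow_le_rpow (by positivity) h0 (by positivity)
  rw [sobolevWeight_eq, Real.rpow_neg hk.le, ← div_eq_mul_inv, inv_eq_one_div,
    div_le_div_iff₀ (by positivity) (by positivity)]
  linarith

theorem inv_sobolevWeight_mul_sqrt_symbol_le {xL xR : ℝ} (hx : xL < xR) {σ : ℝ} (hσ : 0 ≤ σ)
    {r : ℝ} (hr : 0 ≤ r) (k : ℤ) :
    (sobolevWeight (xR - xL) (r + 1) k)⁻¹ * √(symbol xL xR σ k) ≤
      √(1 + σ) * weightConst xL xR ^ (r / 2) * (1 + |(k : ℝ)|) ^ (-r) := by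
  have hX : 0 < symbol xL xR 1 k := zero_lt_one.trans_le (one_le_symbol zero_le_one _ _ _)
  have h1 : symbol xL xR σ k ≤ (1 + σ) * symbol xL xR 1 k := by
    unfold symbol; nlinarith [sq_nonneg (baseFreq xL xR * k)]
  have h2 : √(symbol xL xR σ k) ≤ √(1 + σ) * √(symbol xL xR 1 k) := by
    rw [← Real.sqrt_mul (by positivity)]; exact Real.sqrt_le_sqrt h1
  have h3 : (sobolevWeight (xR - xL) (r + 1) k)⁻¹ * √(symbol xL xR 1 k) =
      (sobolevWeight (xR - xL) r k)⁻¹ := by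
    rw [sobolevWeight_eq, sobolevWeight_eq, ← Real.rpow_neg hX.le, ← Real.rpow_neg hX.le,
      Real.sqrt_eq_rpow, ← Real.rpow_add hX]
    congr 1; ring
  have hw := sobolevWeight_pos xL xR (r + 1) k
  calc _ ≤ (sobolevWeight (xR - xL) (r + 1) k)⁻¹ * (√(1 + σ) * √(symbol xL xR 1 k)) := by gcongr
    _ = √(1 + σ) * (sobolevWeight (xR - xL) r k)⁻¹ := by rw [← h3]; ring
    _ ≤ _ := by
      rw [mul_assoc]
      exact mul_le_mul_of_nonneg_left (inv_sobolevWeight_le hx hr k) (Real.sqrt_nonneg _)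

/-- The space `ℓ²(ℤ)` carrying the weighted Fourier coefficients. -/
abbrev SeqSpace : Type := lp (fun _ : ℤ => ℂ) 2

theorem hasSum_norm_sq (y : SeqSpace) : HasSum (fun k => ‖y k‖ ^ 2) (‖y‖ ^ 2) := by
  have := lp.hasSum_norm (p := 2) (by simp) y
  simpa using this

/-- The coefficients with respect to the grid modes of the function of `H_p^s` with weighted Fourier
coefficients `y`; the exponential accounts for the grid starting at `xL` and not at `0`. -/
def gridCoeff (xL xR s : ℝ) (y : ℤ → ℂ) (k : ℤ) : ℂ :=
  ((sobolevWeight (xR - xL) s k)⁻¹ : ℝ) * y k *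
    Complex.exp ((baseFreq xL xR * k * xL : ℝ) * Complex.I)

theorem norm_gridCoeff (xL xR s : ℝ) (y : ℤ → ℂ) (k : ℤ) :
    ‖gridCoeff xL xR s y k‖ = (sobolevWeight (xR - xL) s k)⁻¹ * ‖y k‖ := by
  rw [gridCoeff, norm_mul, norm_mul, Complex.norm_exp_ofReal_mul_I, mul_one, Complex.norm_real,
    Real.norm_of_nonneg (inv_nonneg.2 (sobolevWeight_pos _ _ _ _).le)]

/-- The norm of grid evaluation from `H_p^{r+1}` to the discrete energy norm. -/
def evalConst (xL xR σ r : ℝ) : ℝ :=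
  √(1 + σ) * weightConst xL xR ^ (r / 2) * √(∑' m : ℤ, (1 + |(m : ℝ)|) ^ (-(2 * r)))

theorem evalConst_nonneg (xL xR σ r : ℝ) : 0 ≤ evalConst xL xR σ r := by
  have := weightConst_pos xL xR
  unfold evalConst; positivity

theorem summable_norm_gridCoeff_mul {xL xR : ℝ} (hx : xL < xR) {σ : ℝ} (hσ : 0 ≤ σ) {r : ℝ}
    (hr : 1 / 2 < r) (y : SeqSpace) :
    (Summable fun k => ‖gridCoeff xL xR (r + 1) y k‖ * √(symbol xL xR σ k)) ∧
    ∑' k, ‖gridCoeff xL xR (r + 1) y k‖ * √(symbol xL xR σ k) ≤ evalConst xL xR σ r * ‖y‖ := by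
  set C := √(1 + σ) * weightConst xL xR ^ (r / 2) with hC
  have hC0 : 0 ≤ C := by have := weightConst_pos xL xR; positivity
  have he : ∀ m : ℤ, ((1 + |(m : ℝ)|) ^ (-r)) ^ 2 = (1 + |(m : ℝ)|) ^ (-(2 * r)) := fun m => by
    rw [← Real.rpow_mul_natCast (by positivity)]; congr 1; push_cast; ring
  have hs := summable_one_add_abs_rpow (q := 2 * r) (by linarith)
  obtain ⟨h1, h2⟩ := summable_mul_and_tsum_le (f := fun m : ℤ => (1 + |(m : ℝ)|) ^ (-r))
    (g := fun k => ‖y k‖) (fun m => by positivity) (fun k => norm_nonneg _)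
    (by simpa only [he] using hs) (hasSum_norm_sq y).summable
  simp only [he] at h2
  rw [(hasSum_norm_sq y).tsum_eq, Real.sqrt_sq (norm_nonneg _)] at h2
  have hle : ∀ k, ‖gridCoeff xL xR (r + 1) y k‖ * √(symbol xL xR σ k) ≤
      C * ((1 + |(k : ℝ)|) ^ (-r) * ‖y k‖) := fun k => by
    have := inv_sobolevWeight_mul_sqrt_symbol_le hx hσ (by linarith : 0 ≤ r) k
    calc _ = ((sobolevWeight (xR - xL) (r + 1) k)⁻¹ * √(symbol xL xR σ k)) * ‖y k‖ := by
          rw [norm_gridCoeff]; ring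
      _ ≤ (C * (1 + |(k : ℝ)|) ^ (-r)) * ‖y k‖ := by gcongr
      _ = _ := by ring
  have hsum := Summable.of_nonneg_of_le (fun k => by positivity) hle (h1.mul_left C)
  refine ⟨hsum, (hsum.tsum_le_tsum hle (h1.mul_left C)).trans ?_⟩
  rw [tsum_mul_left]
  refine (mul_le_mul_of_nonneg_left h2 hC0).trans (le_of_eq ?_)
  rw [evalConst]; ring

theorem summable_norm_gridCoeff {xL xR : ℝ} (hx : xL < xR) {r : ℝ}
    (hr : 1 / 2 < r) (y : SeqSpace) : Summable fun k => ‖gridCoeff xL xR (r + 1) y k‖ := by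
  have := (summable_norm_gridCoeff_mul hx le_rfl hr y).1
  simpa [symbol] using this

/-- Grid evaluation of the functions of `H_p^{r+1}`, given by their weighted Fourier
coefficients. -/
def gridEval {xL xR : ℝ} (hx : xL < xR) (N : ℕ) {r : ℝ} (hr : 1 / 2 < r) :
    SeqSpace →ₗ[ℝ] (Fin N → ℂ) where
  toFun y := synth N (gridCoeff xL xR (r + 1) y)
  map_add' y z := by
    ext j
    have hy := hasSum_synth (summable_norm_gridCoeff hx hr y) j
    have hz := hasSum_synth (summable_norm_gridCoeff hx hr z) j
    refine (hasSum_synth (summable_norm_gridCoeff hx hr (y + z)) j).unique ?_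
    refine (hy.add hz).congr_fun fun k => ?_
    simp only [gridCoeff, lp.coeFn_add, Pi.add_apply]; ring
  map_smul' a y := by
    ext j
    have hy := hasSum_synth (summable_norm_gridCoeff hx hr y) j
    refine (hasSum_synth (summable_norm_gridCoeff hx hr (a • y)) j).unique ?_
    simp only [RingHom.id_apply, Pi.smul_apply, Complex.real_smul]
    refine (hy.mul_left (a : ℂ)).congr_fun fun k => ?_
    simp only [gridCoeff, lp.coeFn_smul, Pi.smul_apply, Complex.real_smul]; ring

theorem energyNorm_gridEval_le {xL xR : ℝ} (hx : xL < xR) {σ : ℝ} (hσ : 0 ≤ σ) {N : ℕ}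
    (hN : 0 < N) (hE : Even N) {r : ℝ} (hr : 1 / 2 < r) (y : SeqSpace) :
    energyNorm xL xR σ (gridEval hx N hr y) ≤ evalConst xL xR σ r * ‖y‖ := by
  obtain ⟨h1, h2⟩ := summable_norm_gridCoeff_mul hx hσ hr y
  exact (energyNorm_le_of_hasSum hσ xL xR hN hE
    (hasSum_synth (summable_norm_gridCoeff hx hr y)) h1.hasSum).trans h2

theorem not_low_ne_zero {N : ℕ} (hN : 0 < N) {k : ℤ} (hk : ¬ 4 * |k| < N) : k ≠ 0 := by
  rintro rfl; simp at hk; omega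

theorem one_add_abs_rpow_neg_le {k : ℤ} (hk : k ≠ 0) {s : ℝ} (hs : 0 ≤ s) :
    (1 + |(k : ℝ)|) ^ (-s) ≤ |(k : ℝ)| ^ (-s) := by
  have : (0 : ℝ) < |(k : ℝ)| := by positivity
  exact Real.rpow_le_rpow_of_nonpos this (by linarith) (by linarith)

/-- The constant of the high frequency estimate in the energy norm. -/
def tailConst (xL xR σ r : ℝ) : ℝ :=
  √(1 + σ * baseFreq xL xR ^ 2) * (aliasConst (r + 1) * weightConst xL xR ^ ((r + 1) / 2))

theorem tailConst_nonneg (xL xR σ r : ℝ) : 0 ≤ tailConst xL xR σ r := by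
  have := weightConst_pos xL xR
  have := aliasConst_nonneg (r + 1)
  unfold tailConst; positivity

/-- The high frequency part of a function of `H_p^{r+1}` is `O(N^{-r})` in the discrete energy
norm. -/
theorem energyNorm_synth_highPart_le {xL xR : ℝ} (hx : xL < xR) {σ : ℝ} (hσ : 0 ≤ σ) {N : ℕ}
    (hN : 0 < N) (hE : Even N) {r : ℝ} (hr : 1 / 2 < r) (y : SeqSpace) :
    energyNorm xL xR σ (synth N (highPart N (gridCoeff xL xR (r + 1) y))) ≤
      tailConst xL xR σ r * (N : ℝ) ^ (-r) * ‖y‖ := by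
  have hNr : (1 : ℝ) ≤ N := by exact_mod_cast hN
  have hN0 : (0 : ℝ) < N := by linarith
  set W := weightConst xL xR ^ ((r + 1) / 2) with hW
  have hW0 : 0 ≤ W := by have := weightConst_pos xL xR; positivity
  have h1 : gridNorm (synth N (highPart N (gridCoeff xL xR (r + 1) y))) ≤
      aliasConst (r + 1) * (N : ℝ) ^ (-(r + 1)) * (W * ‖y‖) := by
    have hsum : HasSum (fun k => (W * ‖y k‖) ^ 2) (W ^ 2 * ‖y‖ ^ 2) := by
      simpa only [mul_pow] using (hasSum_norm_sq y).mul_left (W ^ 2)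
    have h := gridNorm_le_of_hasSum_high hN hE (s := r + 1) (by linarith)
      (d := fun k => W * ‖y k‖) (fun k => by positivity) hsum.summable
      (hasSum_synth (summable_norm_highPart (summable_norm_gridCoeff hx hr y) N)) (fun k => by
        unfold highPart
        split_ifs with hk
        · simp
        · rw [norm_gridCoeff]
          have h2 := inv_sobolevWeight_le hx (by linarith : 0 ≤ r + 1) k
          have h3 := one_add_abs_rpow_neg_le (not_low_ne_zero hN hk) (by linarith : 0 ≤ r + 1)
          calc _ ≤ (W * |(k : ℝ)| ^ (-(r + 1))) * ‖y k‖ := by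
                gcongr; exact h2.trans (by gcongr)
            _ = _ := by ring)
    rwa [hsum.tsum_eq, Real.sqrt_mul (sq_nonneg _), Real.sqrt_sq hW0,
      Real.sqrt_sq (norm_nonneg _)] at h
  have h2 : √(1 + σ * (baseFreq xL xR * (N / 2)) ^ 2) ≤
      √(1 + σ * baseFreq xL xR ^ 2) * N := by
    refine Real.sqrt_le_iff.2 ⟨by positivity, ?_⟩
    rw [mul_pow (√_), Real.sq_sqrt (by positivity)]
    have h3 : 0 ≤ σ * baseFreq xL xR ^ 2 * (N : ℝ) ^ 2 := by positivity
    have h4 : (1 : ℝ) ≤ (N : ℝ) ^ 2 := one_le_pow₀ hNr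
    nlinarith
  have hA := aliasConst_nonneg (r + 1)
  calc _ ≤ _ := energyNorm_le_gridNorm hσ xL xR _
    _ ≤ (√(1 + σ * baseFreq xL xR ^ 2) * N) *
        (aliasConst (r + 1) * (N : ℝ) ^ (-(r + 1)) * (W * ‖y‖)) :=
      mul_le_mul h2 h1 (gridNorm_nonneg _) (by positivity)
    _ = √(1 + σ * baseFreq xL xR ^ 2) * (aliasConst (r + 1) * W) *
        ((N : ℝ) * (N : ℝ) ^ (-(r + 1))) * ‖y‖ := by ring
    _ = _ := by
      rw [tailConst, ← Real.rpow_one_add' hN0.le (by linarith)]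
      congr 3; ring

/-! ### The exact solution in Fourier variables -/

theorem baseFreq_pos {xL xR : ℝ} (hx : xL < xR) : 0 < baseFreq xL xR :=
  div_pos (by positivity) (sub_pos.2 hx)

/-- Pointwise convergence of a Fourier series with summable coefficients. -/
theorem hasSum_fourierCoeffOn {xL xR : ℝ} (hx : xL < xR) {f : ℝ → ℂ} (hf : Continuous f)
    (hp : Function.Periodic f (xR - xL)) (hs : Summable (fourierCoeffOn hx f)) (x : ℝ) :
    HasSum (fun k => fourierCoeffOn hx f k *
      Complex.exp ((baseFreq xL xR * k * x : ℝ) * Complex.I)) (f x) := by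
  have : Fact (0 < xR - xL) := ⟨sub_pos.2 hx⟩
  let g : C(AddCircle (xR - xL), ℂ) := ⟨hp.lift, continuous_coinduced_dom.mpr hf⟩
  have hg : fourierCoeff g = fourierCoeffOn hx f := by
    ext n
    rw [fourierCoeffOn_eq_integral, fourierCoeff_eq_intervalIntegral g n xL]
    simp only [add_sub_cancel]
    rfl
  have h := has_pointwise_sum_fourier_series_of_summable (f := g) (by rw [hg]; exact hs) x
  rw [hg] at h
  refine h.congr_fun fun k => ?_
  rw [fourier_coe_apply, smul_eq_mul]
  congr 2
  simp only [baseFreq]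
  push_cast
  ring

theorem fourierCoeffOn_eq_integral_exp {xL xR : ℝ} (hx : xL < xR) (f : ℝ → ℝ) (k : ℤ) :
    fourierCoeffOn hx (fun x => (f x : ℂ)) k = (1 / (xR - xL) : ℝ) *
      ∫ x in xL..xR, (f x : ℂ) * Complex.exp ((-(baseFreq xL xR * k * x) : ℝ) * Complex.I) := by
  rw [fourierCoeffOn_eq_integral, Complex.real_smul]
  congr 1
  refine intervalIntegral.integral_congr fun x _ => ?_
  rw [fourier_coe_apply, smul_eq_mul, mul_comm]
  congr 2
  simp only [baseFreq]
  push_cast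
  ring

theorem fourierCoeffOn_eq_cos_sub_sin {xL xR : ℝ} (hx : xL < xR) {f : ℝ → ℝ} (hf : Continuous f)
    (k : ℤ) : fourierCoeffOn hx (fun x => (f x : ℂ)) k = (1 / (xR - xL) : ℝ) *
      (((∫ x in xL..xR, f x * Real.cos (baseFreq xL xR * k * x) : ℝ) : ℂ) -
        Complex.I * ((∫ x in xL..xR, f x * Real.sin (baseFreq xL xR * k * x) : ℝ) : ℂ)) := by
  rw [fourierCoeffOn_eq_integral_exp]
  congr 1
  rw [← intervalIntegral.integral_ofReal, ← intervalIntegral.integral_ofReal,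
    ← intervalIntegral.integral_const_mul, ← intervalIntegral.integral_sub]
  · refine intervalIntegral.integral_congr fun x _ => ?_
    rw [Complex.exp_ofReal_mul_I, Real.cos_neg, Real.sin_neg]
    push_cast; ring
  · exact Continuous.intervalIntegrable (by fun_prop) _ _
  · exact Continuous.intervalIntegrable (by fun_prop) _ _

theorem gridPoint_phase {xL xR : ℝ} (hx : xL < xR) {N : ℕ} (hN : 0 < N) (k : ℤ) (j : Fin N) :
    Complex.exp ((baseFreq xL xR * k * gridPoint xL xR N j : ℝ) * Complex.I) =
      Complex.exp ((baseFreq xL xR * k * xL : ℝ) * Complex.I) * mode N k j := by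
  have hN' : (N : ℂ) ≠ 0 := by exact_mod_cast hN.ne'
  have hL : ((xR : ℂ) - xL) ≠ 0 := by
    have := (sub_pos.2 hx).ne'
    exact_mod_cast this
  rw [mode, ← Complex.exp_add]
  congr 1
  simp only [baseFreq, gridPoint, meshSize]
  push_cast
  field_simp

/-- The flux `a w + F'(w) = a w + γ w² / 2`. -/
def flux (a γ w : ℝ) : ℝ := a * w + γ / 2 * w ^ 2

theorem deriv_potential (γ w : ℝ) : deriv (potential γ) w = γ / 2 * w ^ 2 := by
  have : HasDerivAt (potential γ) (γ * (3 * w ^ 2) / 6) w := by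
    have h := ((hasDerivAt_pow 3 w).const_mul γ).div_const 6
    simp only [Nat.cast_ofNat, Nat.add_one_sub_one] at h
    exact h
  rw [this.deriv]; ring

theorem periodic_trig {xL xR : ℝ} (hx : xL < xR) (k : ℤ) :
    Function.Periodic (fun x => Real.cos (baseFreq xL xR * k * x)) (xR - xL) ∧
    Function.Periodic (fun x => Real.sin (baseFreq xL xR * k * x)) (xR - xL) := by
  have hL : xR - xL ≠ 0 := (sub_pos.2 hx).ne'
  have h : ∀ x, baseFreq xL xR * k * (x + (xR - xL)) =
      baseFreq xL xR * k * x + k * (2 * Real.pi) := fun x => by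
    rw [baseFreq]; field_simp
  exact ⟨fun x => by simp only [h, Real.cos_add_int_mul_two_pi],
    fun x => by simp only [h, Real.sin_add_int_mul_two_pi]⟩

/-- The equation tested with the trigonometric functions of frequency `k`, in complex form:
`(1 + σ μ² k²) û_k' + iμk f̂_k = 0`, where `f` is the flux. -/
theorem IsSolution.hasDerivWithinAt_fourierCoeffOn {a σ γ xL xR T : ℝ} {u₀ : ℝ → ℝ}
    {u : ℝ → ℝ → ℝ} (hx : xL < xR) (hsol : IsSolution a σ γ xL xR T u₀ u)
    {t : ℝ} (ht : t ∈ Set.Icc 0 T) (k : ℤ) :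
    HasDerivWithinAt
      (fun t' => (symbol xL xR σ k : ℂ) * fourierCoeffOn hx (fun x => (u x t' : ℂ)) k)
      (-(Complex.I * baseFreq xL xR * k *
        fourierCoeffOn hx (fun x => (flux a γ (u x t) : ℂ)) k)) (Set.Icc 0 T) t := by
  set b : ℝ := baseFreq xL xR * k with hb
  have hlin : ∀ x : ℝ, HasDerivAt (fun x : ℝ => b * x) b x := fun x => by
    simpa using (hasDerivAt_id x).const_mul b
  have dcos : deriv (fun x => Real.cos (b * x)) = fun x => -Real.sin (b * x) * b := by
    ext x; exact (hlin x).cos.deriv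
  have dsin : deriv (fun x => Real.sin (b * x)) = fun x => Real.cos (b * x) * b := by
    ext x; exact (hlin x).sin.deriv
  have d2cos : iteratedDeriv 2 (fun x => Real.cos (b * x)) = fun x => -b ^ 2 * Real.cos (b * x) := by
    rw [iteratedDeriv_succ, iteratedDeriv_one, dcos]
    ext x; rw [((hlin x).sin.fun_neg.mul_const b).deriv]; ring
  have d2sin : iteratedDeriv 2 (fun x => Real.sin (b * x)) = fun x => -b ^ 2 * Real.sin (b * x) := by
    rw [iteratedDeriv_succ, iteratedDeriv_one, dsin]
    ext x; rw [((hlin x).cos.mul_const b).deriv]; ring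
  have hs : symbol xL xR σ k = 1 + σ * b ^ 2 := rfl
  obtain ⟨pc, ps⟩ := periodic_trig hx k
  have ec := hsol.equation (fun x => Real.cos (b * x)) (by fun_prop) pc t ht
  have es := hsol.equation (fun x => Real.sin (b * x)) (by fun_prop) ps t ht
  rw [d2cos, dcos] at ec
  rw [d2sin, dsin] at es
  have hfl : ∀ x, a * u x t + deriv (potential γ) (u x t) = flux a γ (u x t) := fun x => by
    rw [deriv_potential, flux]
  simp only [hfl] at ec es
  have hcd := (ec.ofReal_comp.sub (es.ofReal_comp.const_mul Complex.I)).const_mul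
    ((1 / (xR - xL) : ℝ) : ℂ)
  have hfcont : Continuous fun x => flux a γ (u x t) := by
    have := hsol.continuous t ht
    unfold flux; fun_prop
  refine (hcd.congr_of_mem (fun t' ht' => ?_) ht).congr_deriv ?_
  · rw [fourierCoeffOn_eq_cos_sub_sin hx (hsol.continuous t' ht'), hs]
    simp only [Pi.sub_apply]
    rw [mul_left_comm]
    congr 1
    have e1 : ∀ g : ℝ → ℝ, (∫ x in xL..xR, u x t' * (g x - σ * (-b ^ 2 * g x))) =
        (1 + σ * b ^ 2) * ∫ x in xL..xR, u x t' * g x := fun g => by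
      rw [← intervalIntegral.integral_const_mul]
      refine intervalIntegral.integral_congr fun x _ => ?_
      ring
    rw [e1 fun x => Real.cos (b * x), e1 fun x => Real.sin (b * x)]
    push_cast; ring
  · rw [fourierCoeffOn_eq_cos_sub_sin hx hfcont]
    have e1 : (∫ x in xL..xR, flux a γ (u x t) * (-Real.sin (b * x) * b)) =
        -b * ∫ x in xL..xR, flux a γ (u x t) * Real.sin (b * x) := by
      rw [← intervalIntegral.integral_const_mul]
      refine intervalIntegral.integral_congr fun x _ => ?_
      ring
    have e2 : (∫ x in xL..xR, flux a γ (u x t) * (Real.cos (b * x) * b)) =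
        b * ∫ x in xL..xR, flux a γ (u x t) * Real.cos (b * x) := by
      rw [← intervalIntegral.integral_const_mul]
      refine intervalIntegral.integral_congr fun x _ => ?_
      ring
    rw [e1, e2, ← hb]
    have hbc : (baseFreq xL xR : ℂ) * k = (b : ℂ) := by rw [hb]; push_cast; rfl
    rw [mul_assoc Complex.I, hbc]
    push_cast
    linear_combination (-(1 / ((xR : ℂ) - xL)) * b *
      (∫ x in xL..xR, flux a γ (u x t) * Real.sin (b * x) : ℝ)) * Complex.I_sq

/-- The constant bounding the Fourier coefficients of the flux. -/
def fluxConst (xL xR σ r : ℝ) : ℝ :=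
  √(1 / baseFreq xL xR ^ 2 + σ) * (√(1 + σ) * weightConst xL xR ^ (r / 2))

theorem fluxConst_nonneg (xL xR σ r : ℝ) : 0 ≤ fluxConst xL xR σ r := by
  have := weightConst_pos xL xR
  unfold fluxConst; positivity

theorem symbol_mul_inv_sobolevWeight_le {xL xR : ℝ} (hx : xL < xR) {σ : ℝ} (hσ : 0 ≤ σ)
    {r : ℝ} (hr : 0 ≤ r) {k : ℤ} (hk : k ≠ 0) :
    symbol xL xR σ k * (sobolevWeight (xR - xL) (r + 1) k)⁻¹ ≤
      fluxConst xL xR σ r * (1 + |(k : ℝ)|) ^ (-r) * (baseFreq xL xR * |(k : ℝ)|) := by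
  have hμ := baseFreq_pos hx
  have h1 := inv_sobolevWeight_mul_sqrt_symbol_le hx hσ hr k
  have hk1 : (1 : ℝ) ≤ (k : ℝ) ^ 2 := by
    have := Int.one_le_abs hk
    have h : (1 : ℝ) ≤ |(k : ℝ)| := by exact_mod_cast this
    rw [← sq_abs]; exact one_le_pow₀ h
  have h2 : √(symbol xL xR σ k) ≤ √(1 / baseFreq xL xR ^ 2 + σ) * (baseFreq xL xR * |(k : ℝ)|) := by
    refine Real.sqrt_le_iff.2 ⟨by positivity, ?_⟩
    rw [mul_pow (√_), Real.sq_sqrt (by positivity), mul_pow, sq_abs, symbol]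
    field_simp
    nlinarith
  have hS := symbol_nonneg hσ xL xR k
  calc _ = √(symbol xL xR σ k) *
        ((sobolevWeight (xR - xL) (r + 1) k)⁻¹ * √(symbol xL xR σ k)) := by
        nth_rewrite 1 [← Real.mul_self_sqrt hS]; ring
    _ ≤ (√(1 / baseFreq xL xR ^ 2 + σ) * (baseFreq xL xR * |(k : ℝ)|)) *
        (√(1 + σ) * weightConst xL xR ^ (r / 2) * (1 + |(k : ℝ)|) ^ (-r)) := by
        have := inv_nonneg.2 (sobolevWeight_pos xL xR (r + 1) k).le
        gcongr
    _ = _ := by rw [fluxConst]; ring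

/-- `F` is the family of Fourier coefficients, with respect to the grid modes, of the flux of the
solution at a time at which the solution is `u` and its time derivative is represented by `z'`. The
decay of `F` away from the frequency `0` is a consequence of the equation. -/
structure IsFluxCoeff (a γ xL xR σ r : ℝ) (u : ℝ → ℝ) (z' : SeqSpace) (F : ℤ → ℂ) : Prop where
  summable : Summable fun k => ‖F k‖
  hasSum : ∀ N : ℕ, 0 < N → ∀ j : Fin N,
    HasSum (fun k => F k * mode N k j) (flux a γ (u (gridPoint xL xR N j)) : ℂ)
  equation : ∀ k, (symbol xL xR σ k : ℂ) * gridCoeff xL xR (r + 1) z' k +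
    Complex.I * k * baseFreq xL xR * F k = 0
  norm_le : ∀ k, k ≠ 0 → ‖F k‖ ≤ fluxConst xL xR σ r * ((1 + |(k : ℝ)|) ^ (-r) * ‖z' k‖)

theorem gridEval_eq {xL xR : ℝ} (hx : xL < xR) {N : ℕ} (hN : 0 < N) {r : ℝ} (hr : 1 / 2 < r)
    {f : ℝ → ℝ} (hf : Continuous f) (hp : Function.Periodic f (xR - xL)) {z : SeqSpace}
    (hz : ∀ k : ℤ, z k = (sobolevWeight (xR - xL) (r + 1) k : ℂ) *
      fourierCoeffOn hx (fun x => (f x : ℂ)) k) (j : Fin N) :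
    gridEval hx N hr z j = (f (gridPoint xL xR N j) : ℂ) := by
  have hw : ∀ k, (sobolevWeight (xR - xL) (r + 1) k : ℂ) ≠ 0 := fun k => by
    exact_mod_cast (sobolevWeight_pos xL xR (r + 1) k).ne'
  have hc : ∀ k, gridCoeff xL xR (r + 1) z k = fourierCoeffOn hx (fun x => (f x : ℂ)) k *
      Complex.exp ((baseFreq xL xR * k * xL : ℝ) * Complex.I) := fun k => by
    rw [gridCoeff, hz k, Complex.ofReal_inv, inv_mul_cancel_left₀ (hw k)]
  have hn : ∀ k, ‖gridCoeff xL xR (r + 1) z k‖ =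
      ‖fourierCoeffOn hx (fun x => (f x : ℂ)) k‖ := fun k => by
    rw [hc, norm_mul, Complex.norm_exp_ofReal_mul_I, mul_one]
  have hs := summable_norm_gridCoeff hx hr z
  have h1 := hasSum_fourierCoeffOn hx (f := fun x => (f x : ℂ)) (by fun_prop)
    (fun x => by simp only [hp x]) (Summable.of_norm (by simpa only [hn] using hs))
    (gridPoint xL xR N j)
  refine (hasSum_synth hs j).unique (h1.congr_fun fun k => ?_)
  rw [hc, gridPoint_phase hx hN]; ring

/-- The flux coefficients exist at every time. Their decay is read off from the equation, so that no
multiplication theorem in Sobolev spaces is needed. -/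
theorem exists_isFluxCoeff {a σ γ xL xR T r : ℝ} {u₀ : ℝ → ℝ}
    {u : ℝ → ℝ → ℝ} (hx : xL < xR) (hσ : 0 ≤ σ) (hT : 0 < T) (hr : 1 / 2 < r)
    (hsol : IsSolution a σ γ xL xR T u₀ u) {v v₁ : ℝ → SeqSpace}
    (hv : ∀ t ∈ Set.Icc 0 T, ∀ k : ℤ, v t k = (sobolevWeight (xR - xL) (r + 1) k : ℂ) *
      fourierCoeffOn hx (fun x => (u x t : ℂ)) k)
    (hd : ∀ t ∈ Set.Icc 0 T, HasDerivWithinAt v (v₁ t) (Set.Icc 0 T) t)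
    {t : ℝ} (ht : t ∈ Set.Icc 0 T) :
    ∃ F, IsFluxCoeff a γ xL xR σ r (fun x => u x t) (v₁ t) F := by
  have hw0 : ∀ k, 0 < sobolevWeight (xR - xL) (r + 1) k := fun k => sobolevWeight_pos _ _ _ _
  have hw : ∀ k, (sobolevWeight (xR - xL) (r + 1) k : ℂ) ≠ 0 := fun k => by
    exact_mod_cast (hw0 k).ne'
  set G : ℤ → ℂ := fourierCoeffOn hx (fun x => (flux a γ (u x t) : ℂ)) with hG
  set ph : ℤ → ℂ := fun k => Complex.exp ((baseFreq xL xR * k * xL : ℝ) * Complex.I) with hph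
  have hphn : ∀ k, ‖ph k‖ = 1 := fun k => Complex.norm_exp_ofReal_mul_I _
  have heq : ∀ k, (symbol xL xR σ k : ℂ) * gridCoeff xL xR (r + 1) (v₁ t) k +
      Complex.I * k * baseFreq xL xR * (G k * ph k) = 0 := by
    intro k
    have h1 := hsol.hasDerivWithinAt_fourierCoeffOn hx ht k
    have h2 : HasDerivWithinAt (fun t' => v t' k) (v₁ t k) (Set.Icc 0 T) t :=
      (lp.evalCLM ℝ (fun _ : ℤ => ℂ) 2 k).hasFDerivAt.comp_hasDerivWithinAt t (hd t ht)
    have h3 := h2.const_mul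
      ((symbol xL xR σ k : ℂ) * (sobolevWeight (xR - xL) (r + 1) k : ℂ)⁻¹)
    have h4 := h3.congr_of_mem (f₁ := fun t' => (symbol xL xR σ k : ℂ) *
      fourierCoeffOn hx (fun x => (u x t' : ℂ)) k) (fun t' ht' => by
        rw [hv t' ht' k]
        have := hw k
        field_simp) ht
    have h5 := (uniqueDiffOn_Icc hT t ht).eq_deriv _ h1 h4
    rw [gridCoeff, Complex.ofReal_inv]
    linear_combination -(ph k) * h5
  have hnorm : ∀ k, k ≠ 0 → ‖G k * ph k‖ ≤
      fluxConst xL xR σ r * ((1 + |(k : ℝ)|) ^ (-r) * ‖v₁ t k‖) := by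
    intro k hk
    have hμ := baseFreq_pos hx
    have hμk : 0 < baseFreq xL xR * |(k : ℝ)| := by positivity
    have h1 := congrArg norm (eq_neg_of_add_eq_zero_left (heq k))
    rw [norm_neg, norm_mul, norm_gridCoeff, Complex.norm_real,
      Real.norm_of_nonneg (symbol_nonneg hσ _ _ _), norm_mul, norm_mul, norm_mul, Complex.norm_I,
      Complex.norm_real, Complex.norm_intCast, one_mul, Real.norm_of_nonneg hμ.le] at h1
    have h2 := symbol_mul_inv_sobolevWeight_le hx hσ (by linarith : 0 ≤ r) hk
    refine le_of_mul_le_mul_left ?_ hμk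
    calc baseFreq xL xR * |(k : ℝ)| * ‖G k * ph k‖
        = (symbol xL xR σ k * (sobolevWeight (xR - xL) (r + 1) k)⁻¹) * ‖v₁ t k‖ := by
          rw [mul_comm (baseFreq xL xR), ← h1]; ring
      _ ≤ _ := mul_le_mul_of_nonneg_right h2 (norm_nonneg _)
      _ = _ := by ring
  have he : ∀ m : ℤ, ((1 + |(m : ℝ)|) ^ (-r)) ^ 2 = (1 + |(m : ℝ)|) ^ (-(2 * r)) := fun m => by
    rw [← Real.rpow_mul_natCast (by positivity)]; congr 1; push_cast; ring
  have hsum : Summable fun k => ‖G k * ph k‖ := by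
    have h1 := (summable_mul_and_tsum_le (f := fun m : ℤ => (1 + |(m : ℝ)|) ^ (-r))
      (g := fun k => ‖v₁ t k‖) (fun m => by positivity) (fun k => norm_nonneg _)
      (by simpa only [he] using summable_one_add_abs_rpow (q := 2 * r) (by linarith))
      (hasSum_norm_sq (v₁ t)).summable).1.mul_left (fluxConst xL xR σ r)
    refine Summable.of_norm_bounded_eventually h1 ?_
    rw [Filter.eventually_cofinite]
    refine (Set.finite_singleton (0 : ℤ)).subset fun k hk => ?_
    by_contra hk0
    exact hk (by rw [norm_norm]; exact hnorm k hk0)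
  refine ⟨fun k => G k * ph k, hsum, fun N hN j => ?_, heq, hnorm⟩
  have hc := hsol.continuous t ht
  have h1 := hasSum_fourierCoeffOn hx (f := fun x => (flux a γ (u x t) : ℂ))
    (by unfold flux; fun_prop) (fun x => by simp only [← hsol.periodic t ht x])
    (Summable.of_norm (hsum.congr fun k => by rw [norm_mul, hphn, mul_one]))
    (gridPoint xL xR N j)
  refine h1.congr_fun fun k => ?_
  rw [gridPoint_phase hx hN]; ring

/-! ### Taylor estimates for curves in a normed space -/

theorem norm_sub_le_of_hasDerivWithinAt_of_le {E : Type*} [NormedAddCommGroup E]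
    [NormedSpace ℝ E] {T : ℝ} {f f' : ℝ → E}
    (hf : ∀ t ∈ Set.Icc 0 T, HasDerivWithinAt f (f' t) (Set.Icc 0 T) t) {c s B : ℝ}
    (hc : c ∈ Set.Icc 0 T) (hs : s ∈ Set.Icc 0 T)
    (hB : ∀ x ∈ Set.Icc 0 T, |x - c| ≤ |s - c| → ‖f' x‖ ≤ B) : ‖f s - f c‖ ≤ B * |s - c| := by
  have hsub : Set.uIcc c s ⊆ Set.Icc 0 T := Set.uIcc_subset_Icc hc hs
  refine Convex.norm_image_sub_le_of_norm_hasDerivWithin_le (f' := f')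
    (fun x hx => (hf x (hsub hx)).mono hsub) (fun x hx => hB x (hsub hx) ?_)
    (convex_uIcc c s) Set.left_mem_uIcc Set.right_mem_uIcc
  rw [abs_sub_comm x c, abs_sub_comm s c, abs_sub_comm c x]
  have := Set.abs_sub_left_of_mem_uIcc hx
  rwa [abs_sub_comm s c] at this

/-- First and second order Taylor estimates, about an arbitrary centre, for a `C³` curve on a
compact interval. -/
theorem exists_taylor_bounds {E : Type*} [NormedAddCommGroup E] [NormedSpace ℝ E] {T : ℝ}
    (hT : 0 < T) {v : ℝ → E} (hv : ContDiffOn ℝ 3 v (Set.Icc 0 T)) :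
    ∃ (v₁ v₂ : ℝ → E) (B : ℝ), 0 ≤ B ∧
      (∀ t ∈ Set.Icc 0 T, HasDerivWithinAt v (v₁ t) (Set.Icc 0 T) t) ∧
      (∀ t ∈ Set.Icc 0 T, ‖v t‖ ≤ B ∧ ‖v₁ t‖ ≤ B) ∧
      (∀ c ∈ Set.Icc 0 T, ∀ s ∈ Set.Icc 0 T, ‖v s - v c - (s - c) • v₁ c‖ ≤ B * |s - c| ^ 2) ∧
      (∀ c ∈ Set.Icc 0 T, ∀ s ∈ Set.Icc 0 T,
        ‖v s - v c - (s - c) • v₁ c - ((s - c) ^ 2 / 2) • v₂ c‖ ≤ B * |s - c| ^ 3) := by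
  have hu : UniqueDiffOn ℝ (Set.Icc 0 T) := uniqueDiffOn_Icc hT
  set v₁ := derivWithin v (Set.Icc 0 T)
  set v₂ := derivWithin v₁ (Set.Icc 0 T)
  set v₃ := derivWithin v₂ (Set.Icc 0 T)
  have c1 : ContDiffOn ℝ 2 v₁ (Set.Icc 0 T) := hv.derivWithin hu (by norm_num)
  have c2 : ContDiffOn ℝ 1 v₂ (Set.Icc 0 T) := c1.derivWithin hu (by norm_num)
  have c3 : ContDiffOn ℝ 0 v₃ (Set.Icc 0 T) := c2.derivWithin hu (by norm_num)
  have d0 : ∀ t ∈ Set.Icc 0 T, HasDerivWithinAt v (v₁ t) (Set.Icc 0 T) t := fun t ht =>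
    ((hv.differentiableOn (by norm_num)) t ht).hasDerivWithinAt
  have d1 : ∀ t ∈ Set.Icc 0 T, HasDerivWithinAt v₁ (v₂ t) (Set.Icc 0 T) t := fun t ht =>
    ((c1.differentiableOn (by norm_num)) t ht).hasDerivWithinAt
  have d2 : ∀ t ∈ Set.Icc 0 T, HasDerivWithinAt v₂ (v₃ t) (Set.Icc 0 T) t := fun t ht =>
    ((c2.differentiableOn (by norm_num)) t ht).hasDerivWithinAt
  obtain ⟨B0, h0⟩ := isCompact_Icc.exists_bound_of_continuousOn hv.continuousOn
  obtain ⟨B1, h1⟩ := isCompact_Icc.exists_bound_of_continuousOn c1.continuousOn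
  obtain ⟨B2, h2⟩ := isCompact_Icc.exists_bound_of_continuousOn c2.continuousOn
  obtain ⟨B3, h3⟩ := isCompact_Icc.exists_bound_of_continuousOn c3.continuousOn
  set B := max (max B0 B1) (max B2 B3)
  have hB0 : B0 ≤ B := (le_max_left _ _).trans (le_max_left _ _)
  have hB1 : B1 ≤ B := (le_max_right _ _).trans (le_max_left _ _)
  have hB2 : B2 ≤ B := (le_max_left _ _).trans (le_max_right _ _)
  have hB3 : B3 ≤ B := (le_max_right _ _).trans (le_max_right _ _)
  have hB : 0 ≤ B := (norm_nonneg _).trans ((h0 0 ⟨le_rfl, hT.le⟩).trans hB0)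
  have e2 : ∀ c ∈ Set.Icc 0 T, ∀ s ∈ Set.Icc 0 T, ‖v₂ s - v₂ c‖ ≤ B * |s - c| :=
    fun c hc s hs => norm_sub_le_of_hasDerivWithinAt_of_le d2 hc hs
      fun x hx _ => (h3 x hx).trans hB3
  have e1 : ∀ c ∈ Set.Icc 0 T, ∀ s ∈ Set.Icc 0 T, ‖v₁ s - v₁ c‖ ≤ B * |s - c| :=
    fun c hc s hs => norm_sub_le_of_hasDerivWithinAt_of_le d1 hc hs
      fun x hx _ => (h2 x hx).trans hB2
  have e11 : ∀ c ∈ Set.Icc 0 T, ∀ s ∈ Set.Icc 0 T,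
      ‖v₁ s - v₁ c - (s - c) • v₂ c‖ ≤ B * |s - c| ^ 2 := by
    intro c hc s hs
    have hd : ∀ t ∈ Set.Icc 0 T, HasDerivWithinAt (fun t => v₁ t - (t - c) • v₂ c)
        (v₂ t - v₂ c) (Set.Icc 0 T) t := fun t ht => by
      simpa using (d1 t ht).fun_sub (((hasDerivWithinAt_id t _).sub_const c).smul_const (v₂ c))
    have := norm_sub_le_of_hasDerivWithinAt_of_le hd hc hs (B := B * |s - c|)
      fun x hx hxs => (e2 c hc x hx).trans (mul_le_mul_of_nonneg_left hxs hB)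
    calc _ = ‖(v₁ s - (s - c) • v₂ c) - (v₁ c - (c - c) • v₂ c)‖ := by
          congr 1; rw [sub_self, zero_smul]; abel
      _ ≤ _ := this.trans (le_of_eq (by ring))
  refine ⟨v₁, v₂, B, hB, d0, fun t ht => ⟨(h0 t ht).trans hB0, (h1 t ht).trans hB1⟩, ?_, ?_⟩
  · intro c hc s hs
    have hd : ∀ t ∈ Set.Icc 0 T, HasDerivWithinAt (fun t => v t - (t - c) • v₁ c)
        (v₁ t - v₁ c) (Set.Icc 0 T) t := fun t ht => by
      simpa using (d0 t ht).fun_sub (((hasDerivWithinAt_id t _).sub_const c).smul_const (v₁ c))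
    have := norm_sub_le_of_hasDerivWithinAt_of_le hd hc hs (B := B * |s - c|)
      fun x hx hxs => (e1 c hc x hx).trans (mul_le_mul_of_nonneg_left hxs hB)
    calc _ = ‖(v s - (s - c) • v₁ c) - (v c - (c - c) • v₁ c)‖ := by
          congr 1; rw [sub_self, zero_smul]; abel
      _ ≤ _ := this.trans (le_of_eq (by ring))
  · intro c hc s hs
    have hd : ∀ t ∈ Set.Icc 0 T,
        HasDerivWithinAt (fun t => v t - (t - c) • v₁ c - ((t - c) ^ 2 / 2) • v₂ c)
        (v₁ t - v₁ c - (t - c) • v₂ c) (Set.Icc 0 T) t := fun t ht => by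
      have hq : HasDerivWithinAt (fun t : ℝ => (t - c) ^ 2 / 2) (t - c) (Set.Icc 0 T) t := by
        have := ((((hasDerivWithinAt_id t (Set.Icc 0 T)).sub_const c).pow 2).div_const 2)
        refine this.congr_deriv ?_
        simp
      simpa using ((d0 t ht).fun_sub
        (((hasDerivWithinAt_id t _).sub_const c).smul_const (v₁ c))).fun_sub (hq.smul_const (v₂ c))
    have := norm_sub_le_of_hasDerivWithinAt_of_le hd hc hs (B := B * |s - c| ^ 2)
      fun x hx hxs => (e11 c hc x hx).trans
        (mul_le_mul_of_nonneg_left (pow_le_pow_left₀ (abs_nonneg _) hxs 2) hB)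
    calc _ = ‖(v s - (s - c) • v₁ c - ((s - c) ^ 2 / 2) • v₂ c) -
          (v c - (c - c) • v₁ c - ((c - c) ^ 2 / 2) • v₂ c)‖ := by
          congr 1; simp; abel
      _ ≤ _ := this.trans (le_of_eq (by ring))

/-- The three consistency estimates behind the second order time accuracy: the centred difference
quotient, the average and the extrapolation, all compared with the midpoint. -/
theorem exists_midpoint_bounds {E : Type*} [NormedAddCommGroup E] [NormedSpace ℝ E] {T : ℝ}
    (hT : 0 < T) {v : ℝ → E} (hv : ContDiffOn ℝ 3 v (Set.Icc 0 T)) :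
    ∃ (v₁ : ℝ → E) (B : ℝ), 0 ≤ B ∧
      (∀ t ∈ Set.Icc 0 T, HasDerivWithinAt v (v₁ t) (Set.Icc 0 T) t) ∧
      (∀ t ∈ Set.Icc 0 T, ‖v t‖ ≤ B ∧ ‖v₁ t‖ ≤ B) ∧
      (∀ t τ, 0 < τ → 0 ≤ t → t + τ ≤ T →
        ‖τ⁻¹ • (v (t + τ) - v t) - v₁ (t + τ / 2)‖ ≤ B * τ ^ 2 ∧
        ‖(1 / 2 : ℝ) • (v (t + τ) + v t) - v (t + τ / 2)‖ ≤ B * τ ^ 2) ∧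
      (∀ t τ, 0 < τ → 0 ≤ t - τ → t + τ ≤ T →
        ‖(1 / 2 : ℝ) • ((3 : ℝ) • v t - v (t - τ)) - v (t + τ / 2)‖ ≤ B * τ ^ 2) := by
  obtain ⟨v₁, v₂, B, hB, hd, hb, h1, h2⟩ := exists_taylor_bounds hT hv
  refine ⟨v₁, 2 * B, by positivity, hd, fun t ht => ?_, ?_, ?_⟩
  · have := hb t ht; constructor <;> linarith
  · intro t τ hτ ht htT
    have mc : t + τ / 2 ∈ Set.Icc 0 T := ⟨by linarith, by linarith⟩
    have m1 : t + τ ∈ Set.Icc 0 T := ⟨by linarith, by linarith⟩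
    have m0 : t ∈ Set.Icc 0 T := ⟨by linarith, by linarith⟩
    have d1 : t + τ - (t + τ / 2) = τ / 2 := by ring
    have d0 : t - (t + τ / 2) = -(τ / 2) := by ring
    have a1 : |τ / 2| = τ / 2 := abs_of_pos (by positivity)
    constructor
    · have e1 := h2 _ mc _ m1
      have e0 := h2 _ mc _ m0
      rw [d1, a1] at e1
      rw [d0, abs_neg, a1] at e0
      have key : τ⁻¹ • (v (t + τ) - v t) - v₁ (t + τ / 2) = τ⁻¹ •
          ((v (t + τ) - v (t + τ / 2) - (τ / 2) • v₁ (t + τ / 2) -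
            ((τ / 2) ^ 2 / 2) • v₂ (t + τ / 2)) -
           (v t - v (t + τ / 2) - (-(τ / 2)) • v₁ (t + τ / 2) -
            ((-(τ / 2)) ^ 2 / 2) • v₂ (t + τ / 2))) := by
        have := hτ.ne'
        match_scalars <;> field_simp <;> ring
      rw [key, norm_smul, norm_inv, Real.norm_of_nonneg hτ.le, inv_mul_le_iff₀ hτ]
      refine (norm_sub_le _ _).trans ((add_le_add e1 e0).trans ?_)
      have : 0 ≤ B * τ ^ 3 := by positivity
      linarith
    · have e1 := h1 _ mc _ m1
      have e0 := h1 _ mc _ m0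
      rw [d1, a1] at e1
      rw [d0, abs_neg, a1] at e0
      have key : (1 / 2 : ℝ) • (v (t + τ) + v t) - v (t + τ / 2) = (1 / 2 : ℝ) •
          ((v (t + τ) - v (t + τ / 2) - (τ / 2) • v₁ (t + τ / 2)) +
           (v t - v (t + τ / 2) - (-(τ / 2)) • v₁ (t + τ / 2))) := by
        match_scalars <;> ring
      rw [key, norm_smul, Real.norm_of_nonneg (by norm_num)]
      have := (norm_add_le _ _).trans (add_le_add e1 e0)
      have h3 : 0 ≤ B * τ ^ 2 := by positivity
      linarith
  · intro t τ hτ ht htT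
    have mc : t + τ / 2 ∈ Set.Icc 0 T := ⟨by linarith, by linarith⟩
    have m1 : t - τ ∈ Set.Icc 0 T := ⟨by linarith, by linarith⟩
    have m0 : t ∈ Set.Icc 0 T := ⟨by linarith, by linarith⟩
    have d1 : t - τ - (t + τ / 2) = -(3 * τ / 2) := by ring
    have d0 : t - (t + τ / 2) = -(τ / 2) := by ring
    have e1 := h1 _ mc _ m1
    have e0 := h1 _ mc _ m0
    rw [d1, abs_neg, abs_of_pos (by positivity : (0 : ℝ) < 3 * τ / 2)] at e1
    rw [d0, abs_neg, abs_of_pos (by positivity : (0 : ℝ) < τ / 2)] at e0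
    have key : (1 / 2 : ℝ) • ((3 : ℝ) • v t - v (t - τ)) - v (t + τ / 2) = (1 / 2 : ℝ) •
        ((3 : ℝ) • (v t - v (t + τ / 2) - (-(τ / 2)) • v₁ (t + τ / 2)) -
          (v (t - τ) - v (t + τ / 2) - (-(3 * τ / 2)) • v₁ (t + τ / 2))) := by
      match_scalars <;> ring
    rw [key, norm_smul, Real.norm_of_nonneg (by norm_num)]
    have := norm_sub_le ((3 : ℝ) • (v t - v (t + τ / 2) - (-(τ / 2)) • v₁ (t + τ / 2)))
      (v (t - τ) - v (t + τ / 2) - (-(3 * τ / 2)) • v₁ (t + τ / 2))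
    rw [norm_smul, Real.norm_of_nonneg (by norm_num : (0 : ℝ) ≤ 3)] at this
    have h3 : 0 ≤ B * τ ^ 2 := by positivity
    linarith

/-! ### Consistency of the scheme -/

theorem pair_add_left {N : ℕ} (V V' W : Fin N → ℂ) :
    pair (V + V') W = pair V W + pair V' W := by
  simp only [pair, Pi.add_apply, add_mul, Finset.sum_add_distrib, mul_add]

theorem pair_sub_left {N : ℕ} (V V' W : Fin N → ℂ) :
    pair (V - V') W = pair V W - pair V' W := by
  simp only [pair, Pi.sub_apply, sub_mul, Finset.sum_sub_distrib, mul_sub]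

theorem pair_smul_left {N : ℕ} (c : ℂ) (V W : Fin N → ℂ) : pair (c • V) W = c * pair V W := by
  simp only [pair, Pi.smul_apply, smul_eq_mul, mul_assoc, ← Finset.mul_sum]; ring

/-- The left-hand side of one step of the scheme, as a function of the difference quotient `d`, the
extrapolated state `w` and the mean state `m`. -/
def schemeOp (a σ γ xL xR : ℝ) {N : ℕ} (d w m : Fin N → ℂ) : Fin N → ℂ :=
  d - (σ : ℂ) • (diffC xL xR N 2 *ᵥ d) + (a : ℂ) • (diffC xL xR N 1 *ᵥ m) +
    ((γ / 3 : ℝ) : ℂ) • (w * (diffC xL xR N 1 *ᵥ m) + diffC xL xR N 1 *ᵥ (w * m))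

theorem norm_pair_helmholtz_left_le {σ : ℝ} (hσ : 0 ≤ σ) {xL xR : ℝ} (hx : xL < xR) {N : ℕ}
    (hN : 0 < N) (hE : Even N) (V W : Fin N → ℂ) :
    ‖pair (V - (σ : ℂ) • (diffC xL xR N 2 *ᵥ V)) W‖ ≤
      energyNorm xL xR σ V * energyNorm xL xR σ W := by
  rw [pair_sub_left, pair_smul_left, pair_diffC_two_left hx hN]
  exact norm_pair_helmholtz_le hσ hx hN hE V W

theorem norm_pair_mul_diffC_le_of_le {σ : ℝ} (hσ : 0 < σ) {xL xR : ℝ} (hx : xL < xR) {N : ℕ}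
    (hN : 0 < N) (hE : Even N) {X Y : Fin N → ℂ} {b b' : ℝ} (hX : energyNorm xL xR σ X ≤ b)
    (hY : energyNorm xL xR σ Y ≤ b') (Z : Fin N → ℂ) :
    ‖pair (X * (diffC xL xR N 1 *ᵥ Y)) Z‖ ≤
      convConst xL xR σ * (b * b' * energyNorm xL xR σ Z) := by
  have h1 := energyNorm_nonneg xL xR σ Y
  have h2 := energyNorm_nonneg xL xR σ Z
  have h3 := (energyNorm_nonneg xL xR σ X).trans hX
  refine (norm_pair_mul_diffC_le hσ hx hN hE X Y Z).trans ?_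
  exact mul_le_mul_of_nonneg_left
    (mul_le_mul_of_nonneg_right (mul_le_mul hX hY h1 h3) h2) (convConst_nonneg _ _ _)

theorem norm_pair_diffC_mul_le_of_le {σ : ℝ} (hσ : 0 < σ) {xL xR : ℝ} (hx : xL < xR) {N : ℕ}
    (hN : 0 < N) (hE : Even N) {X Y : Fin N → ℂ} {b b' : ℝ} (hX : energyNorm xL xR σ X ≤ b)
    (hY : energyNorm xL xR σ Y ≤ b') (Z : Fin N → ℂ) :
    ‖pair (diffC xL xR N 1 *ᵥ (X * Y)) Z‖ ≤
      convConst xL xR σ * (b * b' * energyNorm xL xR σ Z) := by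
  have h1 := energyNorm_nonneg xL xR σ Y
  have h2 := energyNorm_nonneg xL xR σ Z
  have h3 := (energyNorm_nonneg xL xR σ X).trans hX
  refine (norm_pair_diffC_mul_le hσ hx hN hE X Y Z).trans ?_
  exact mul_le_mul_of_nonneg_left
    (mul_le_mul_of_nonneg_right (mul_le_mul hX hY h1 h3) h2) (convConst_nonneg _ _ _)

theorem diffC_mulVec_synthLow {xL xR : ℝ} (hx : xL < xR) {N : ℕ} (hN : 0 < N) (hE : Even N)
    (m : ℕ) (c : ℤ → ℂ) :
    diffC xL xR N m *ᵥ synthLow N c =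
      synthLow N fun k => (Complex.I * k * baseFreq xL xR) ^ m * c k := by
  rw [synthLow, synthLow, Matrix.mulVec_sum]
  refine Finset.sum_congr rfl fun k hk => ?_
  have hk' : 2 * |k| < N := by have := mem_lowFreqs.1 hk; have := abs_nonneg k; omega
  rw [Matrix.mulVec_smul, diffC_mulVec_mode hx hN hE m hk', smul_smul, mul_comm]

/-- The pseudo-spectral product rule is exact on frequencies below `N/4`. -/
theorem synthLow_mul_diffC {xL xR : ℝ} (hx : xL < xR) {N : ℕ} (hN : 0 < N) (hE : Even N)
    (c : ℤ → ℂ) :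
    diffC xL xR N 1 *ᵥ (synthLow N c * synthLow N c) =
      (2 : ℂ) • (synthLow N c * (diffC xL xR N 1 *ᵥ synthLow N c)) := by
  have hprod : ∀ c' : ℤ → ℂ, synthLow N c * synthLow N c' =
      ∑ k ∈ lowFreqs N, ∑ l ∈ lowFreqs N, (c k * c' l) • mode N (k + l) := by
    intro c'
    rw [synthLow, synthLow, Finset.sum_mul_sum]
    refine Finset.sum_congr rfl fun k _ => Finset.sum_congr rfl fun l _ => ?_
    ext j
    simp only [Pi.mul_apply, Pi.smul_apply, smul_eq_mul, mode_add]; ring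
  rw [diffC_mulVec_synthLow hx hN hE, hprod, hprod, Matrix.mulVec_sum]
  simp_rw [Matrix.mulVec_sum, Matrix.mulVec_smul]
  have h1 : ∀ k ∈ lowFreqs N, ∀ l ∈ lowFreqs N,
      (c k * c l) • (diffC xL xR N 1 *ᵥ mode N (k + l)) =
      ((c l * ((Complex.I * k * baseFreq xL xR) ^ 1 * c k)) • mode N (l + k) +
        (c k * ((Complex.I * l * baseFreq xL xR) ^ 1 * c l)) • mode N (k + l) : Fin N → ℂ) := by
    intro k hk l hl
    have hk' : 2 * |k + l| < N := by
      have := mem_lowFreqs.1 hk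
      have := mem_lowFreqs.1 hl
      have := abs_add_le k l
      omega
    rw [diffC_mulVec_mode hx hN hE 1 hk', smul_smul, add_comm l k, ← add_smul]
    congr 1; push_cast; ring
  rw [Finset.sum_congr rfl fun k hk => Finset.sum_congr rfl fun l hl => h1 k hk l hl]
  simp_rw [Finset.sum_add_distrib]
  rw [Finset.sum_comm, two_smul]

theorem rpow_neg_le_one {N : ℕ} (hN : 0 < N) {r : ℝ} (hr : 0 ≤ r) : (N : ℝ) ^ (-r) ≤ 1 :=
  Real.rpow_le_one_of_one_le_of_nonpos (by exact_mod_cast hN) (by linarith)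

/-- The constant of `norm_pair_helmholtz_add_flux_le`. -/
def linearConst (xL xR σ r : ℝ) : ℝ :=
  tailConst xL xR σ r + 1 / √σ * (aliasConst r * fluxConst xL xR σ r)

/-- Space consistency of the linear part and of the flux: low frequencies cancel by the equation,
high ones are small. -/
theorem norm_pair_helmholtz_add_flux_le {a σ γ xL xR r : ℝ} (hσ : 0 < σ) (hx : xL < xR)
    (hr : 1 / 2 < r) {N : ℕ} (hN : 0 < N) (hE : Even N) {u : ℝ → ℝ} {z' : SeqSpace} {F : ℤ → ℂ}
    (hF : IsFluxCoeff a γ xL xR σ r u z' F) {f : Fin N → ℂ}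
    (hf : ∀ j, f j = (flux a γ (u (gridPoint xL xR N j)) : ℂ)) (φ : Fin N → ℂ) :
    ‖pair (gridEval hx N hr z' - (σ : ℂ) • (diffC xL xR N 2 *ᵥ gridEval hx N hr z')
      + diffC xL xR N 1 *ᵥ f) φ‖ ≤
      linearConst xL xR σ r * (N : ℝ) ^ (-r) * ‖z'‖ * energyNorm xL xR σ φ := by
  set c := gridCoeff xL xR (r + 1) z' with hc
  have hcs := summable_norm_gridCoeff hx hr z'
  have hfs : f = synth N F := by
    ext j; rw [hf]; exact (hF.hasSum N hN j).unique (hasSum_synth hF.summable j)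
  -- mode by mode, this is the equation for the exact solution
  have hlow : synthLow N c - (σ : ℂ) • (diffC xL xR N 2 *ᵥ synthLow N c) +
      diffC xL xR N 1 *ᵥ synthLow N F = 0 := by
    rw [diffC_mulVec_synthLow hx hN hE, diffC_mulVec_synthLow hx hN hE]
    simp only [synthLow, Finset.smul_sum, ← Finset.sum_sub_distrib, ← Finset.sum_add_distrib]
    refine Finset.sum_eq_zero fun k _ => ?_
    rw [smul_smul, ← sub_smul, ← add_smul]
    have h := hF.equation k
    have : c k - σ * ((Complex.I * k * baseFreq xL xR) ^ 2 * c k) +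
        (Complex.I * k * baseFreq xL xR) ^ 1 * F k = 0 := by
      rw [← h, symbol]
      push_cast
      linear_combination (-(σ : ℂ) * (k * baseFreq xL xR) ^ 2 * c k) * Complex.I_sq
    rw [this, zero_smul]
  set q := synth N (highPart N c) with hq
  set g := synth N (highPart N F) with hg
  have hsplit : gridEval hx N hr z' - (σ : ℂ) • (diffC xL xR N 2 *ᵥ gridEval hx N hr z')
      + diffC xL xR N 1 *ᵥ f = (q - (σ : ℂ) • (diffC xL xR N 2 *ᵥ q)) + diffC xL xR N 1 *ᵥ g := by
    have h1 : gridEval hx N hr z' = synthLow N c + q := synth_eq_low_add_high hcs N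
    rw [h1, hfs, synth_eq_low_add_high hF.summable N, Matrix.mulVec_add, Matrix.mulVec_add,
      smul_add, ← sub_eq_zero, ← hlow]
    abel
  have hgn : gridNorm g ≤ aliasConst r * (N : ℝ) ^ (-r) * (fluxConst xL xR σ r * ‖z'‖) := by
    have hC := fluxConst_nonneg xL xR σ r
    have hsum : HasSum (fun k => (fluxConst xL xR σ r * ‖z' k‖) ^ 2)
        (fluxConst xL xR σ r ^ 2 * ‖z'‖ ^ 2) := by
      simpa only [mul_pow] using (hasSum_norm_sq z').mul_left (fluxConst xL xR σ r ^ 2)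
    have h := gridNorm_le_of_hasSum_high hN hE hr
      (d := fun k => fluxConst xL xR σ r * ‖z' k‖) (fun k => by positivity) hsum.summable
      (hasSum_synth (summable_norm_highPart hF.summable N)) (fun k => by
        unfold highPart
        split_ifs with hk
        · simp
        · have hk0 := not_low_ne_zero hN hk
          have h3 := one_add_abs_rpow_neg_le hk0 (by linarith : 0 ≤ r)
          calc _ ≤ _ := hF.norm_le k hk0
            _ ≤ fluxConst xL xR σ r * (|(k : ℝ)| ^ (-r) * ‖z' k‖) := by gcongr
            _ = _ := by ring)
    rwa [hsum.tsum_eq, Real.sqrt_mul (sq_nonneg _), Real.sqrt_sq hC,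
      Real.sqrt_sq (norm_nonneg _)] at h
  have hφ := energyNorm_nonneg xL xR σ φ
  rw [hsplit, pair_add_left]
  calc _ ≤ _ := norm_add_le _ _
    _ ≤ energyNorm xL xR σ q * energyNorm xL xR σ φ +
        1 / √σ * gridNorm g * energyNorm xL xR σ φ :=
      add_le_add (norm_pair_helmholtz_left_le hσ.le hx hN hE _ _)
        (norm_pair_diffC_left_le hσ hx hN _ _)
    _ ≤ (tailConst xL xR σ r * (N : ℝ) ^ (-r) * ‖z'‖) * energyNorm xL xR σ φ +
        1 / √σ * (aliasConst r * (N : ℝ) ^ (-r) * (fluxConst xL xR σ r * ‖z'‖)) *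
          energyNorm xL xR σ φ := by
      have := energyNorm_synth_highPart_le hx hσ.le hN hE hr z'
      gcongr
    _ = _ := by rw [linearConst]; ring

/-- The constant of `norm_pair_product_rule_le`. -/
def productConst (xL xR σ r : ℝ) : ℝ :=
  3 * (convConst xL xR σ * tailConst xL xR σ r) * (evalConst xL xR σ r + tailConst xL xR σ r)

/-- The pseudo-spectral product rule `v 𝔻₁ v = 𝔻₁ (v²) / 2` holds up to `O(N^{-r})` in the dual of
the energy norm: it is exact on the low frequencies, and every remaining term has a high frequency
factor. -/
theorem norm_pair_product_rule_le {σ xL xR r : ℝ} (hσ : 0 < σ) (hx : xL < xR)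
    (hr : 1 / 2 < r) {N : ℕ} (hN : 0 < N) (hE : Even N) (z : SeqSpace) (φ : Fin N → ℂ) :
    ‖pair (gridEval hx N hr z * (diffC xL xR N 1 *ᵥ gridEval hx N hr z) -
      (1 / 2 : ℂ) • (diffC xL xR N 1 *ᵥ (gridEval hx N hr z * gridEval hx N hr z))) φ‖ ≤
      productConst xL xR σ r * (N : ℝ) ^ (-r) * ‖z‖ ^ 2 * energyNorm xL xR σ φ := by
  set V := gridEval hx N hr z with hV
  set c := gridCoeff xL xR (r + 1) z with hc
  set p := synthLow N c with hp
  set q := synth N (highPart N c) with hq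
  have hVpq : V = p + q := synth_eq_low_add_high (summable_norm_gridCoeff hx hr z) N
  have hlow := synthLow_mul_diffC hx hN hE c
  rw [← hp] at hlow
  have hdec : V * (diffC xL xR N 1 *ᵥ V) - (1 / 2 : ℂ) • (diffC xL xR N 1 *ᵥ (V * V)) =
      q * (diffC xL xR N 1 *ᵥ V) + p * (diffC xL xR N 1 *ᵥ q) -
        (1 / 2 : ℂ) • (diffC xL xR N 1 *ᵥ (q * (V + p))) := by
    have h1 : V * V = p * p + q * (V + p) := by rw [hVpq]; ring
    have h2 : V * (diffC xL xR N 1 *ᵥ V) = q * (diffC xL xR N 1 *ᵥ V) +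
        p * (diffC xL xR N 1 *ᵥ q) + p * (diffC xL xR N 1 *ᵥ p) := by
      rw [hVpq, Matrix.mulVec_add]; ring
    rw [h1, h2, Matrix.mulVec_add, hlow, smul_add, smul_smul]
    norm_num
    abel
  set ε := (N : ℝ) ^ (-r) with hε
  have hε0 : 0 ≤ ε := by positivity
  have hε1 : ε ≤ 1 := rpow_neg_le_one hN (by linarith)
  have hEc := evalConst_nonneg xL xR σ r
  have hT := tailConst_nonneg xL xR σ r
  have hK := convConst_nonneg xL xR σ
  have eq : energyNorm xL xR σ q ≤ tailConst xL xR σ r * ε * ‖z‖ :=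
    energyNorm_synth_highPart_le hx hσ.le hN hE hr z
  have eV : energyNorm xL xR σ V ≤ (evalConst xL xR σ r + tailConst xL xR σ r) * ‖z‖ :=
    (energyNorm_gridEval_le hx hσ.le hN hE hr z).trans
      (mul_le_mul_of_nonneg_right (by linarith) (norm_nonneg _))
  have ep : energyNorm xL xR σ p ≤ (evalConst xL xR σ r + tailConst xL xR σ r) * ‖z‖ := by
    have h1 : p = V - q := by rw [hVpq]; ring
    have h2 : energyNorm xL xR σ p ≤ energyNorm xL xR σ V + energyNorm xL xR σ q := by
      rw [h1]; exact weightedNorm_sub_le _ _ _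
    have h3 := energyNorm_gridEval_le hx hσ.le hN hE hr z
    have h4 : tailConst xL xR σ r * ε * ‖z‖ ≤ tailConst xL xR σ r * 1 * ‖z‖ := by gcongr
    calc _ ≤ _ := h2
      _ ≤ evalConst xL xR σ r * ‖z‖ + tailConst xL xR σ r * 1 * ‖z‖ :=
        add_le_add h3 (eq.trans h4)
      _ = _ := by ring
  have eVp : energyNorm xL xR σ (V + p) ≤
      2 * ((evalConst xL xR σ r + tailConst xL xR σ r) * ‖z‖) := by
    have : energyNorm xL xR σ (V + p) ≤ _ := weightedNorm_add_le _ _ _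
    exact this.trans ((add_le_add eV ep).trans (le_of_eq (by ring)))
  set Q := tailConst xL xR σ r * ε * ‖z‖ with hQ
  set P := (evalConst xL xR σ r + tailConst xL xR σ r) * ‖z‖ with hP
  have hφ := energyNorm_nonneg xL xR σ φ
  have nq := energyNorm_nonneg xL xR σ q
  have np := energyNorm_nonneg xL xR σ p
  have nV := energyNorm_nonneg xL xR σ V
  have nVp := energyNorm_nonneg xL xR σ (V + p)
  have hQ0 : 0 ≤ Q := nq.trans eq
  have hP0 : 0 ≤ P := nV.trans eV
  have t1 : ‖pair (q * (diffC xL xR N 1 *ᵥ V)) φ‖ ≤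
      convConst xL xR σ * (Q * P * energyNorm xL xR σ φ) :=
    norm_pair_mul_diffC_le_of_le hσ hx hN hE eq eV φ
  have t2 : ‖pair (p * (diffC xL xR N 1 *ᵥ q)) φ‖ ≤
      convConst xL xR σ * (P * Q * energyNorm xL xR σ φ) :=
    norm_pair_mul_diffC_le_of_le hσ hx hN hE ep eq φ
  have t3 : ‖(1 / 2 : ℂ) * pair (diffC xL xR N 1 *ᵥ (q * (V + p))) φ‖ ≤
      1 / 2 * (convConst xL xR σ * (Q * (2 * P) * energyNorm xL xR σ φ)) := by
    rw [norm_mul]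
    have : ‖(1 / 2 : ℂ)‖ = 1 / 2 := by norm_num
    rw [this]
    refine mul_le_mul_of_nonneg_left ?_ (by norm_num)
    exact norm_pair_diffC_mul_le_of_le hσ hx hN hE eq eVp φ
  rw [hdec, pair_sub_left, pair_add_left, pair_smul_left]
  calc _ ≤ _ := norm_sub_le _ _
    _ ≤ _ := add_le_add ((norm_add_le _ _).trans (add_le_add t1 t2)) t3
    _ = _ := by rw [hQ, hP, productConst]; ring

theorem schemeOp_eq_add (a σ γ xL xR : ℝ) {N : ℕ} (d w m z z' : Fin N → ℂ) :
    schemeOp a σ γ xL xR d w m =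
      ((d - z') - (σ : ℂ) • (diffC xL xR N 2 *ᵥ (d - z'))) +
      (a : ℂ) • (diffC xL xR N 1 *ᵥ (m - z)) +
      ((γ / 3 : ℝ) : ℂ) • (w * (diffC xL xR N 1 *ᵥ (m - z)) + (w - z) * (diffC xL xR N 1 *ᵥ z) +
        diffC xL xR N 1 *ᵥ (w * (m - z)) + diffC xL xR N 1 *ᵥ ((w - z) * z)) +
      (z' - (σ : ℂ) • (diffC xL xR N 2 *ᵥ z') +
        diffC xL xR N 1 *ᵥ ((a : ℂ) • z + ((γ / 2 : ℝ) : ℂ) • (z * z))) +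
      ((γ / 3 : ℝ) : ℂ) • (z * (diffC xL xR N 1 *ᵥ z) -
        (1 / 2 : ℂ) • (diffC xL xR N 1 *ᵥ (z * z))) := by
  rw [schemeOp]
  simp only [mul_sub, sub_mul, Matrix.mulVec_sub, Matrix.mulVec_add, Matrix.mulVec_smul]
  ext j
  simp only [Pi.add_apply, Pi.sub_apply, Pi.smul_apply, Pi.mul_apply, smul_eq_mul]
  push_cast
  ring

/-- Consistency: inserted into the scheme, the exact solution leaves a residual of size
`ε + N^{-r}` in the dual of the energy norm, where `ε` bounds the time discretization errors in the
Sobolev space and `B` bounds the norms of all states involved. -/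
theorem exists_consistency_bound {a σ γ xL xR r B : ℝ} (ha : 0 ≤ a) (hσ : 0 < σ) (hγ : 0 ≤ γ)
    (hx : xL < xR) (hr : 1 / 2 < r) (hB : 0 ≤ B) :
    ∃ C : ℝ, 0 ≤ C ∧ ∀ N : ℕ, 0 < N → Even N → ∀ (u : ℝ → ℝ) (F : ℤ → ℂ)
      (d w m z z' : SeqSpace) (ε : ℝ), 0 ≤ ε → IsFluxCoeff a γ xL xR σ r u z' F →
      (∀ j : Fin N, gridEval hx N hr z j = (u (gridPoint xL xR N j) : ℂ)) →
      ‖w‖ ≤ B → ‖z‖ ≤ B → ‖z'‖ ≤ B → ‖d - z'‖ ≤ ε → ‖w - z‖ ≤ ε → ‖m - z‖ ≤ ε →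
      ∀ φ : Fin N → ℂ, ‖pair (schemeOp a σ γ xL xR (gridEval hx N hr d) (gridEval hx N hr w)
        (gridEval hx N hr m)) φ‖ ≤ C * (ε + (N : ℝ) ^ (-r)) * energyNorm xL xR σ φ := by
  have hEc := evalConst_nonneg xL xR σ r
  have hTc := tailConst_nonneg xL xR σ r
  have hK := convConst_nonneg xL xR σ
  have hLc : 0 ≤ linearConst xL xR σ r := by
    have := aliasConst_nonneg r
    have := fluxConst_nonneg xL xR σ r
    unfold linearConst; positivity
  have hPc : 0 ≤ productConst xL xR σ r := by unfold productConst; positivity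
  set E := evalConst xL xR σ r
  set K := convConst xL xR σ
  set C₁ := E + a * (1 / √σ * E) + γ / 3 * (4 * (K * (E ^ 2 * B))) with hC₁
  set C₂ := linearConst xL xR σ r * B + γ / 3 * (productConst xL xR σ r * B ^ 2) with hC₂
  have hC₁0 : 0 ≤ C₁ := by positivity
  have hC₂0 : 0 ≤ C₂ := by positivity
  refine ⟨C₁ + C₂, by positivity, ?_⟩
  intro N hN hE u F d w m z z' ε hε hF hz hw hzB hz'B hd hwz hmz φ
  have hφ := energyNorm_nonneg xL xR σ φ
  set A := gridEval hx N hr with hA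
  have hAle : ∀ (y : SeqSpace) (b : ℝ), ‖y‖ ≤ b → energyNorm xL xR σ (A y) ≤ E * b :=
    fun y b hy => (energyNorm_gridEval_le hx hσ.le hN hE hr y).trans
      (mul_le_mul_of_nonneg_left hy hEc)
  have e1 := hAle _ _ hd
  have e2 := hAle _ _ hwz
  have e3 := hAle _ _ hmz
  have e4 := hAle _ _ hw
  have e5 := hAle _ _ hzB
  rw [map_sub] at e1 e2 e3
  have n1 := energyNorm_nonneg xL xR σ (A d - A z')
  have n2 := energyNorm_nonneg xL xR σ (A w - A z)
  have n3 := energyNorm_nonneg xL xR σ (A m - A z)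
  have n4 := energyNorm_nonneg xL xR σ (A w)
  have n5 := energyNorm_nonneg xL xR σ (A z)
  have hn : ∀ x : ℝ, 0 ≤ x → ‖(x : ℂ)‖ = x := fun x hx => by
    rw [Complex.norm_real, Real.norm_of_nonneg hx]
  have hγ3 : 0 ≤ γ / 3 := by positivity
  have t1 := (norm_pair_helmholtz_left_le hσ.le hx hN hE (A d - A z') φ).trans
    (mul_le_mul_of_nonneg_right e1 hφ)
  have t2 : ‖pair (diffC xL xR N 1 *ᵥ (A m - A z)) φ‖ ≤
      1 / √σ * (E * ε) * energyNorm xL xR σ φ :=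
    (norm_pair_diffC_left_le hσ hx hN (A m - A z) φ).trans (by
      have := (gridNorm_le_energyNorm hσ.le xL xR (A m - A z)).trans e3
      gcongr)
  have t3 : ‖pair (A w * (diffC xL xR N 1 *ᵥ (A m - A z))) φ‖ ≤
      K * ((E * B) * (E * ε) * energyNorm xL xR σ φ) :=
    norm_pair_mul_diffC_le_of_le hσ hx hN hE e4 e3 φ
  have t4 : ‖pair ((A w - A z) * (diffC xL xR N 1 *ᵥ A z)) φ‖ ≤
      K * ((E * ε) * (E * B) * energyNorm xL xR σ φ) :=
    norm_pair_mul_diffC_le_of_le hσ hx hN hE e2 e5 φ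
  have t5 : ‖pair (diffC xL xR N 1 *ᵥ (A w * (A m - A z))) φ‖ ≤
      K * ((E * B) * (E * ε) * energyNorm xL xR σ φ) :=
    norm_pair_diffC_mul_le_of_le hσ hx hN hE e4 e3 φ
  have t6 : ‖pair (diffC xL xR N 1 *ᵥ ((A w - A z) * A z)) φ‖ ≤
      K * ((E * ε) * (E * B) * energyNorm xL xR σ φ) :=
    norm_pair_diffC_mul_le_of_le hσ hx hN hE e2 e5 φ
  have t7 := norm_pair_helmholtz_add_flux_le hσ hx hr hN hE hF
    (f := (a : ℂ) • A z + ((γ / 2 : ℝ) : ℂ) • (A z * A z)) (fun j => by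
      simp only [Pi.add_apply, Pi.smul_apply, Pi.mul_apply, smul_eq_mul, hz j, flux]
      push_cast; ring) φ
  have t8 := norm_pair_product_rule_le hσ hx hr hN hE z φ
  rw [← hA] at t7 t8
  have hδ : (0 : ℝ) ≤ (N : ℝ) ^ (-r) := by positivity
  have t7' : _ ≤ linearConst xL xR σ r * (N : ℝ) ^ (-r) * B * energyNorm xL xR σ φ :=
    t7.trans (by gcongr)
  have t8' : _ ≤ productConst xL xR σ r * (N : ℝ) ^ (-r) * B ^ 2 * energyNorm xL xR σ φ :=
    t8.trans (by gcongr)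
  rw [schemeOp_eq_add a σ γ xL xR (A d) (A w) (A m) (A z) (A z')]
  simp only [pair_add_left _ _ φ, pair_smul_left _ _ φ] at t7' ⊢
  have tt1 : ‖(a : ℂ) * pair (diffC xL xR N 1 *ᵥ (A m - A z)) φ‖ ≤
      a * (1 / √σ * (E * ε) * energyNorm xL xR σ φ) := by
    rw [norm_mul, hn a ha]; exact mul_le_mul_of_nonneg_left t2 ha
  have tt2 := mul_le_mul_of_nonneg_left ((norm_add_le _ _).trans (add_le_add
    ((norm_add_le _ _).trans (add_le_add ((norm_add_le _ _).trans (add_le_add t3 t4)) t5)) t6)) hγ3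
  have tt3 := mul_le_mul_of_nonneg_left t8' hγ3
  rw [← hn _ hγ3, ← norm_mul, hn _ hγ3] at tt2 tt3
  refine (norm_add_le _ _).trans ((add_le_add ((norm_add_le _ _).trans (add_le_add
    ((norm_add_le _ _).trans (add_le_add ((norm_add_le _ _).trans (add_le_add t1 tt1)) tt2))
    t7')) tt3).trans ?_)
  have hfin : C₁ * ε + C₂ * (N : ℝ) ^ (-r) ≤ (C₁ + C₂) * (ε + (N : ℝ) ^ (-r)) := by
    have h1 := mul_nonneg hC₁0 hδ
    have h2 := mul_nonneg hC₂0 hε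
    linarith
  refine le_trans (le_of_eq ?_) (mul_le_mul_of_nonneg_right hfin hφ)
  rw [hC₁, hC₂]; ring

/-! ### Stability of the scheme -/

/-- A real grid vector, regarded as a complex one. -/
def complexify {N : ℕ} : (Fin N → ℝ) →ₗ[ℝ] (Fin N → ℂ) where
  toFun V j := (V j : ℂ)
  map_add' V W := by ext j; simp
  map_smul' c V := by ext j; simp

theorem complexify_apply {N : ℕ} (V : Fin N → ℝ) (j : Fin N) : complexify V j = (V j : ℂ) := rfl

theorem complexify_mul {N : ℕ} (V W : Fin N → ℝ) :
    complexify (V * W) = complexify V * complexify W := by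
  ext j; simp [complexify_apply]

theorem complexify_diffMatrix_mulVec (xL xR : ℝ) (N m : ℕ) (V : Fin N → ℝ) :
    complexify (diffMatrix xL xR N m *ᵥ V) = diffC xL xR N m *ᵥ complexify V := by
  ext j
  simp [complexify_apply, Matrix.mulVec, dotProduct, diffC]

theorem convMatrix_mulVec (a γ xL xR : ℝ) {N : ℕ} (w m : Fin N → ℝ) :
    convMatrix a γ xL xR N w *ᵥ m = a • (diffMatrix xL xR N 1 *ᵥ m) +
      (γ / 3) • (w * (diffMatrix xL xR N 1 *ᵥ m) + diffMatrix xL xR N 1 *ᵥ (w * m)) := by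
  have hdiag : ∀ v : Fin N → ℝ, Matrix.diagonal w *ᵥ v = w * v := fun v => by
    ext j; rw [Matrix.mulVec_diagonal, Pi.mul_apply]
  rw [convMatrix, Matrix.add_mulVec, Matrix.smul_mulVec, Matrix.smul_mulVec, Matrix.add_mulVec,
    ← Matrix.mulVec_mulVec, ← Matrix.mulVec_mulVec, hdiag, hdiag]

/-- One step of the scheme of `IsLCNMP` in complex form. -/
theorem complexify_scheme (a σ γ xL xR : ℝ) {N : ℕ} (d w m : Fin N → ℝ) :
    complexify ((1 - σ • diffMatrix xL xR N 2) *ᵥ d + convMatrix a γ xL xR N w *ᵥ m) =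
      schemeOp a σ γ xL xR (complexify d) (complexify w) (complexify m) := by
  rw [Matrix.sub_mulVec, Matrix.one_mulVec, Matrix.smul_mulVec, convMatrix_mulVec]
  simp only [map_add, map_sub, map_smul, complexify_diffMatrix_mulVec, complexify_mul, schemeOp,
    ← Complex.coe_smul]
  abel

theorem real_smul_eq_complex_smul {N : ℕ} (c : ℝ) (V : Fin N → ℂ) : c • V = (c : ℂ) • V := by
  ext j; simp

theorem energyNorm_real_smul (xL xR σ : ℝ) {N : ℕ} (c : ℝ) (V : Fin N → ℂ) :
    energyNorm xL xR σ (c • V) = |c| * energyNorm xL xR σ V := by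
  rw [real_smul_eq_complex_smul, energyNorm, weightedNorm_smul, Complex.norm_real,
    Real.norm_eq_abs]; rfl

/-- On real grid vectors, the energy norm is the quadratic form of `1 - σ 𝔻₂`. -/
theorem ofReal_energyNorm_sq {σ : ℝ} (hσ : 0 ≤ σ) {xL xR : ℝ} (hx : xL < xR) {N : ℕ}
    (hN : 0 < N) (hE : Even N) (V : Fin N → ℝ) :
    ((energyNorm xL xR σ (complexify V) ^ 2 : ℝ) : ℂ) =
      pair (complexify V) (complexify V) -
        σ * pair (complexify V) (diffC xL xR N 2 *ᵥ complexify V) := by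
  have hconj : ∀ p, dft (complexify V) (-p) = (starRingEnd ℂ) (dft (complexify V) p) := fun p => by
    rw [← dft_conj]
    congr 1
    ext j
    rw [complexify_apply, Complex.conj_ofReal]
  rw [pair_diffC hx hN, pair_eq_sum_dft hN hE, Finset.mul_sum, ← Finset.sum_sub_distrib,
    energyNorm, weightedNorm_sq (symbol_nonneg hσ xL xR), Complex.ofReal_sum]
  refine Finset.sum_congr rfl fun p _ => ?_
  rw [hconj, Complex.mul_conj']
  simp only [symbol]
  push_cast
  linear_combination (1 / (modeFactor N p : ℂ)) * σ * (p * baseFreq xL xR) ^ 2 *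
    ‖dft (complexify V) p‖ ^ 2 * Complex.I_sq

/-- The convective part of the scheme is skew: it does not contribute to the energy. -/
theorem pair_schemeOp_self {a σ γ xL xR : ℝ} (hx : xL < xR) {N : ℕ} (hN : 0 < N)
    (d w m : Fin N → ℂ) :
    pair (schemeOp a σ γ xL xR d w m) m = pair d m - σ * pair d (diffC xL xR N 2 *ᵥ m) := by
  have h1 : pair (diffC xL xR N 1 *ᵥ m) m = 0 := by
    have h := pair_diffC_one_left hx hN m m
    rw [pair_comm m] at h
    exact self_eq_neg.1 h
  have h2 : pair (diffC xL xR N 1 *ᵥ (w * m)) m = -pair (w * (diffC xL xR N 1 *ᵥ m)) m := by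
    rw [pair_diffC_one_left hx hN]
    simp only [pair, Pi.mul_apply]
    congr 2
    exact Finset.sum_congr rfl fun j _ => by ring
  rw [schemeOp]
  simp only [pair_add_left, pair_sub_left, pair_smul_left, pair_diffC_two_left hx hN, h1, h2]
  ring

theorem pair_add_right {N : ℕ} (V W W' : Fin N → ℂ) :
    pair V (W + W') = pair V W + pair V W' := by
  rw [pair_comm, pair_add_left, pair_comm W, pair_comm W']

theorem pair_smul_right {N : ℕ} (c : ℂ) (V W : Fin N → ℂ) : pair V (c • W) = c * pair V W := by
  rw [pair_comm, pair_smul_left, pair_comm]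

/-- The discrete energy balance over one time step. -/
theorem pair_schemeOp_step {a σ γ xL xR : ℝ} (hσ : 0 ≤ σ) (hx : xL < xR) {N : ℕ} (hN : 0 < N)
    (hE : Even N) (e₀ e₁ : Fin N → ℝ) (w : Fin N → ℂ) (τ : ℝ) :
    pair (schemeOp a σ γ xL xR (τ⁻¹ • (complexify e₁ - complexify e₀)) w
        ((1 / 2 : ℝ) • (complexify e₁ + complexify e₀)))
        ((1 / 2 : ℝ) • (complexify e₁ + complexify e₀)) =
      (((energyNorm xL xR σ (complexify e₁) ^ 2 - energyNorm xL xR σ (complexify e₀) ^ 2) *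
        (τ⁻¹ / 2) : ℝ) : ℂ) := by
  have hs := pair_diffC_two_left hx hN (complexify e₁) (complexify e₀)
  rw [pair_comm] at hs
  rw [pair_schemeOp_self hx hN, Complex.ofReal_mul, Complex.ofReal_sub,
    ofReal_energyNorm_sq hσ hx hN hE, ofReal_energyNorm_sq hσ hx hN hE]
  simp only [real_smul_eq_complex_smul, pair_smul_left, pair_smul_right, pair_sub_left,
    pair_add_right, Matrix.mulVec_smul, Matrix.mulVec_add, hs,
    pair_comm (complexify e₀) (complexify e₁)]
  push_cast
  ring

theorem energyNorm_mean_le (xL xR σ : ℝ) {N : ℕ} (V W : Fin N → ℂ) :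
    energyNorm xL xR σ ((1 / 2 : ℝ) • (V + W)) ≤
      (energyNorm xL xR σ V + energyNorm xL xR σ W) / 2 := by
  have h : energyNorm xL xR σ (V + W) ≤ _ := weightedNorm_add_le _ _ _
  have : |(1 / 2 : ℝ)| = 1 / 2 := by norm_num
  rw [energyNorm_real_smul, this]
  have h' : energyNorm xL xR σ (V + W) ≤ energyNorm xL xR σ V + energyNorm xL xR σ W := h
  linarith

/-- A bound on the residual, tested with the mean state, controls the growth of the energy norm.
Only first powers occur, so that no smallness of the time step is needed. -/
theorem energyNorm_le_of_residual {a σ γ xL xR : ℝ} (hσ : 0 ≤ σ) (hx : xL < xR) {N : ℕ}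
    (hN : 0 < N) (hE : Even N) (e₀ e₁ : Fin N → ℝ) (w : Fin N → ℂ) {τ R : ℝ} (hτ : 0 < τ)
    (hR : 0 ≤ R)
    (h : ‖pair (schemeOp a σ γ xL xR (τ⁻¹ • (complexify e₁ - complexify e₀)) w
        ((1 / 2 : ℝ) • (complexify e₁ + complexify e₀)))
        ((1 / 2 : ℝ) • (complexify e₁ + complexify e₀))‖ ≤
      R * energyNorm xL xR σ ((1 / 2 : ℝ) • (complexify e₁ + complexify e₀))) :
    energyNorm xL xR σ (complexify e₁) ≤ energyNorm xL xR σ (complexify e₀) + τ * R := by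
  rw [pair_schemeOp_step hσ hx hN hE, Complex.norm_real] at h
  have hm := energyNorm_mean_le xL xR σ (complexify e₁) (complexify e₀)
  have n0 := energyNorm_nonneg xL xR σ (complexify e₀)
  have n1 := energyNorm_nonneg xL xR σ (complexify e₁)
  generalize energyNorm xL xR σ (complexify e₁) = s₁ at *
  generalize energyNorm xL xR σ (complexify e₀) = s₀ at *
  have h1 : (s₁ ^ 2 - s₀ ^ 2) * (τ⁻¹ / 2) ≤ R * ((s₁ + s₀) / 2) :=
    (le_abs_self _).trans (h.trans (mul_le_mul_of_nonneg_left hm hR))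
  have h2 : (s₁ - s₀) * (s₁ + s₀) ≤ τ * R * (s₁ + s₀) := by
    have := mul_le_mul_of_nonneg_left h1 (by positivity : 0 ≤ 2 * τ)
    calc _ = 2 * τ * ((s₁ ^ 2 - s₀ ^ 2) * (τ⁻¹ / 2)) := by field_simp; ring
      _ ≤ _ := this
      _ = _ := by ring
  rcases (add_nonneg n1 n0).eq_or_lt with h0 | h0
  · have : 0 ≤ τ * R := by positivity
    linarith
  · linarith [le_of_mul_le_mul_right h2 h0]

theorem schemeOp_sub_schemeOp (a σ γ xL xR : ℝ) {N : ℕ} (d w m d' w' m' : Fin N → ℂ) :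
    schemeOp a σ γ xL xR (d - d') w' (m - m') =
      schemeOp a σ γ xL xR d w m - schemeOp a σ γ xL xR d' w' m' -
        ((γ / 3 : ℝ) : ℂ) • ((w - w') * (diffC xL xR N 1 *ᵥ m) +
          diffC xL xR N 1 *ᵥ ((w - w') * m)) := by
  simp only [schemeOp, mul_sub, sub_mul, Matrix.mulVec_sub]
  ext j
  simp only [Pi.add_apply, Pi.sub_apply, Pi.smul_apply, Pi.mul_apply, smul_eq_mul]
  ring

/-- Stability: growth of the error over one step, in terms of the residual of the exact solution
and of the error of the extrapolated state. -/
theorem energyNorm_error_step {a σ γ xL xR : ℝ} (hσ : 0 < σ) (hγ : 0 ≤ γ) (hx : xL < xR) {N : ℕ}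
    (hN : 0 < N) (hE : Even N) {u₀ u₁ U₀ U₁ : Fin N → ℝ} {w w' : Fin N → ℂ} {τ R P : ℝ}
    (hτ : 0 < τ) (hR : 0 ≤ R)
    (hU : schemeOp a σ γ xL xR (τ⁻¹ • (complexify U₁ - complexify U₀)) w'
      ((1 / 2 : ℝ) • (complexify U₁ + complexify U₀)) = 0)
    (hu : ∀ φ, ‖pair (schemeOp a σ γ xL xR (τ⁻¹ • (complexify u₁ - complexify u₀)) w
      ((1 / 2 : ℝ) • (complexify u₁ + complexify u₀))) φ‖ ≤ R * energyNorm xL xR σ φ)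
    (hP : energyNorm xL xR σ ((1 / 2 : ℝ) • (complexify u₁ + complexify u₀)) ≤ P) :
    energyNorm xL xR σ (complexify (u₁ - U₁)) ≤ energyNorm xL xR σ (complexify (u₀ - U₀)) +
      τ * (R + γ / 3 * (2 * (convConst xL xR σ * (energyNorm xL xR σ (w - w') * P)))) := by
  have hK := convConst_nonneg xL xR σ
  have hP0 := (energyNorm_nonneg _ _ _ _).trans hP
  have hw0 := energyNorm_nonneg xL xR σ (w - w')
  refine energyNorm_le_of_residual (a := a) (γ := γ) hσ.le hx hN hE _ _ w' hτ (by positivity) ?_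
  set d := τ⁻¹ • (complexify u₁ - complexify u₀) with hd
  set m := (1 / 2 : ℝ) • (complexify u₁ + complexify u₀) with hm
  set d' := τ⁻¹ • (complexify U₁ - complexify U₀) with hd'
  set m' := (1 / 2 : ℝ) • (complexify U₁ + complexify U₀) with hm'
  have e1 : τ⁻¹ • (complexify (u₁ - U₁) - complexify (u₀ - U₀)) = d - d' := by
    rw [hd, hd', map_sub, map_sub, ← smul_sub]; congr 1; abel
  have e2 : (1 / 2 : ℝ) • (complexify (u₁ - U₁) + complexify (u₀ - U₀)) = m - m' := by
    rw [hm, hm', map_sub, map_sub, ← smul_sub]; congr 1; abel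
  rw [e1, e2, schemeOp_sub_schemeOp a σ γ xL xR d w m d' w' m', hU, sub_zero]
  generalize m - m' = φ
  have h1 := norm_pair_mul_diffC_le_of_le hσ hx hN hE (le_refl (energyNorm xL xR σ (w - w'))) hP φ
  have h2 := norm_pair_diffC_mul_le_of_le hσ hx hN hE (le_refl (energyNorm xL xR σ (w - w'))) hP φ
  rw [pair_sub_left, pair_smul_left, pair_add_left]
  have hγ3 : 0 ≤ γ / 3 := by positivity
  have h3 : ‖((γ / 3 : ℝ) : ℂ) * (pair ((w - w') * (diffC xL xR N 1 *ᵥ m)) φ +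
      pair (diffC xL xR N 1 *ᵥ ((w - w') * m)) φ)‖ ≤ γ / 3 *
      (convConst xL xR σ * (energyNorm xL xR σ (w - w') * P * energyNorm xL xR σ φ) +
        convConst xL xR σ * (energyNorm xL xR σ (w - w') * P * energyNorm xL xR σ φ)) := by
    rw [norm_mul, Complex.norm_real, Real.norm_of_nonneg hγ3]
    exact mul_le_mul_of_nonneg_left ((norm_add_le _ _).trans (add_le_add h1 h2)) hγ3
  refine (norm_sub_le _ _).trans ((add_le_add (hu φ) h3).trans (le_of_eq ?_))
  ring

/-- The scheme conserves the discrete momentum. -/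
theorem energyNorm_eq_of_schemeOp_eq_zero {a σ γ xL xR : ℝ} (hσ : 0 ≤ σ) (hx : xL < xR) {N : ℕ}
    (hN : 0 < N) (hE : Even N) {U₀ U₁ : Fin N → ℝ} {w : Fin N → ℂ} {τ : ℝ} (hτ : 0 < τ)
    (hU : schemeOp a σ γ xL xR (τ⁻¹ • (complexify U₁ - complexify U₀)) w
      ((1 / 2 : ℝ) • (complexify U₁ + complexify U₀)) = 0) :
    energyNorm xL xR σ (complexify U₁) ≤ energyNorm xL xR σ (complexify U₀) := by
  have := energyNorm_le_of_residual hσ hx hN hE U₀ U₁ w hτ le_rfl (by rw [hU]; simp [pair])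
  simpa using this

/-- A discrete Gronwall inequality for a two-step recursion. -/
theorem two_step_gronwall {s : ℕ → ℝ} {n₀ : ℕ} {τ T K δ A : ℝ} (hτ : 0 ≤ τ) (hK : 0 ≤ K)
    (hδ : 0 ≤ δ) (hA : 0 ≤ A) (hT : n₀ * τ ≤ T) (h0 : s 0 = 0)
    (h1 : 1 ≤ n₀ → s 1 ≤ A * δ)
    (hstep : ∀ n, 1 ≤ n → n + 1 ≤ n₀ →
      s (n + 1) ≤ s n + τ * (K * δ + K * ((3 * s n + s (n - 1)) / 2))) :
    ∀ n ≤ n₀, s n ≤ (A + 1) * Real.exp (2 * K * T) * δ := by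
  set q := 1 + 2 * K * τ with hq
  have hq1 : 1 ≤ q := by have : 0 ≤ 2 * K * τ := by positivity
                         linarith
  have key : ∀ n, n ≤ n₀ → s n + δ ≤ q ^ n * ((A + 1) * δ) := by
    intro n
    induction n using Nat.strong_induction_on with
    | _ n ih =>
      intro hn
      rcases n with _ | _ | n
      · rw [h0]; nlinarith
      · have hAδ : 0 ≤ (A + 1) * δ := by positivity
        have := h1 hn
        rw [zero_add, pow_one]
        nlinarith
      · have i1 := ih (n + 1) (by omega) (by omega)
        have i0 := ih n (by omega) (by omega)
        have hst := hstep (n + 1) (by omega) hn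
        rw [Nat.add_sub_cancel] at hst
        set X := q ^ (n + 1) * ((A + 1) * δ) with hX
        have hmono : q ^ n * ((A + 1) * δ) ≤ X :=
          mul_le_mul_of_nonneg_right (pow_le_pow_right₀ hq1 (Nat.le_succ n)) (by positivity)
        have hX' : q ^ (n + 1 + 1) * ((A + 1) * δ) = X + τ * (K * (2 * X)) := by
          rw [hX, pow_succ q (n + 1), hq]; ring
        rw [hX']
        have h3 : K * δ + K * ((3 * s (n + 1) + s n) / 2) ≤ K * (2 * X) := by
          rw [← mul_add]
          refine mul_le_mul_of_nonneg_left ?_ hK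
          linarith
        have := mul_le_mul_of_nonneg_left h3 hτ
        linarith
  intro n hn
  have hexp : q ^ n ≤ Real.exp (2 * K * T) := by
    have h2 : q ≤ Real.exp (2 * K * τ) := by
      rw [hq, add_comm]; exact Real.add_one_le_exp _
    calc q ^ n ≤ Real.exp (2 * K * τ) ^ n := pow_le_pow_left₀ (by linarith) h2 n
      _ = Real.exp (n * (2 * K * τ)) := by rw [← Real.exp_nat_mul]
      _ ≤ _ := by
        refine Real.exp_le_exp.2 ?_
        have h3 : (n : ℝ) * τ ≤ T :=
          (mul_le_mul_of_nonneg_right (by exact_mod_cast hn) hτ).trans hT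
        calc (n : ℝ) * (2 * K * τ) = 2 * K * (n * τ) := by ring
          _ ≤ _ := mul_le_mul_of_nonneg_left h3 (by positivity)
  calc s n ≤ q ^ n * ((A + 1) * δ) := by linarith [key n hn]
    _ ≤ Real.exp (2 * K * T) * ((A + 1) * δ) := mul_le_mul_of_nonneg_right hexp (by positivity)
    _ = _ := by ring

/-! ### Comparison of the energy norm with the norms of the error estimate -/

theorem gridSup_le {σ xL xR : ℝ} (hσ : 0 < σ) (hx : xL < xR) {N : ℕ} (hN : 0 < N) (hE : Even N)
    (V : Fin N → ℝ) :
    gridSup V ≤ sobolevConst xL xR σ * energyNorm xL xR σ (complexify V) := by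
  have : Nonempty (Fin N) := ⟨⟨0, hN⟩⟩
  refine ciSup_le fun j => ?_
  have := norm_apply_le_energyNorm hσ hx hN hE (complexify V) j
  rwa [complexify_apply, Complex.norm_real, Real.norm_eq_abs] at this

theorem gridInner_eq {xL xR : ℝ} {N : ℕ} (V W : Fin N → ℝ) :
    ((gridInner xL xR V W : ℝ) : ℂ) = (xR - xL : ℝ) * pair (complexify V) (complexify W) := by
  simp only [gridInner, meshSize, pair, complexify_apply]
  push_cast
  ring

theorem gridInner_eq_gridNorm_sq {xL xR : ℝ} {N : ℕ} (hN : 0 < N) (hE : Even N) (V : Fin N → ℝ) :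
    gridInner xL xR V V = (xR - xL) * gridNorm (complexify V) ^ 2 := by
  rw [gridNorm_sq hN hE, gridInner, meshSize]
  simp only [complexify_apply, Complex.norm_real, Real.norm_eq_abs, sq_abs]
  simp only [← sq]
  ring

theorem gridL2_le {σ xL xR : ℝ} (hσ : 0 < σ) (hx : xL < xR) {N : ℕ} (hN : 0 < N) (hE : Even N)
    (V : Fin N → ℝ) :
    gridL2 xL xR V ≤ √(xR - xL) * energyNorm xL xR σ (complexify V) := by
  rw [gridL2, gridInner_eq_gridNorm_sq hN hE, Real.sqrt_mul (sub_pos.2 hx).le,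
    Real.sqrt_sq (gridNorm_nonneg _)]
  exact mul_le_mul_of_nonneg_left (gridNorm_le_energyNorm hσ.le _ _ _) (Real.sqrt_nonneg _)

theorem gridH1_le {σ xL xR : ℝ} (hσ : 0 < σ) (hx : xL < xR) {N : ℕ} (hN : 0 < N) (hE : Even N)
    (V : Fin N → ℝ) :
    gridH1 xL xR V ≤ √((xR - xL) / σ) * energyNorm xL xR σ (complexify V) := by
  have hL := sub_pos.2 hx
  have h1 : σ * gridInner xL xR ((-diffMatrix xL xR N 2) *ᵥ V) V =
      (xR - xL) * (energyNorm xL xR σ (complexify V) ^ 2 - gridNorm (complexify V) ^ 2) := by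
    have hE2 := ofReal_energyNorm_sq hσ.le hx hN hE V
    have hG := gridInner_eq (xL := xL) (xR := xR) V V
    rw [gridInner_eq_gridNorm_sq hN hE] at hG
    have hD := gridInner_eq (xL := xL) (xR := xR) ((-diffMatrix xL xR N 2) *ᵥ V) V
    rw [Matrix.neg_mulVec, map_neg, complexify_diffMatrix_mulVec, pair_comm] at hD
    have hneg : pair (complexify V) (-(diffC xL xR N 2 *ᵥ complexify V)) =
        -pair (complexify V) (diffC xL xR N 2 *ᵥ complexify V) := by
      rw [← neg_one_smul ℂ, pair_smul_right]; ring
    rw [hneg] at hD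
    rw [Matrix.neg_mulVec]
    apply Complex.ofReal_injective
    push_cast at hE2 hG hD ⊢
    rw [hD, hE2]
    linear_combination hG
  rw [gridH1, ← Real.sqrt_sq (energyNorm_nonneg xL xR σ (complexify V)),
    ← Real.sqrt_mul (by positivity)]
  refine Real.sqrt_le_sqrt ?_
  rw [div_mul_eq_mul_div, le_div_iff₀ hσ, mul_comm, h1]
  exact mul_le_mul_of_nonneg_left (by linarith [sq_nonneg (gridNorm (complexify V))]) hL.le

/-! ### The error estimate -/

theorem energyNorm_zero (xL xR σ : ℝ) {N : ℕ} : energyNorm xL xR σ (0 : Fin N → ℂ) = 0 := by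
  simp [energyNorm, weightedNorm]

theorem energyNorm_extrapolation_le (xL xR σ : ℝ) {N : ℕ} (V W : Fin N → ℂ) :
    energyNorm xL xR σ ((1 / 2 : ℝ) • ((3 : ℝ) • V - W)) ≤
      (3 * energyNorm xL xR σ V + energyNorm xL xR σ W) / 2 := by
  have h1 : energyNorm xL xR σ ((3 : ℝ) • V - W) ≤
      energyNorm xL xR σ ((3 : ℝ) • V) + energyNorm xL xR σ W := weightedNorm_sub_le _ _ _
  have habs : |(1 / 2 : ℝ)| = 1 / 2 := by norm_num
  have habs3 : |(3 : ℝ)| = 3 := by norm_num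
  rw [energyNorm_real_smul, habs3] at h1
  rw [energyNorm_real_smul, habs]
  linarith

theorem gridPoint_mem_Icc {xL xR : ℝ} (hx : xL < xR) {N : ℕ} (j : Fin N) :
    gridPoint xL xR N j ∈ Set.Icc xL xR := by
  have hL := sub_pos.2 hx
  have hN : (0 : ℝ) < N := by exact_mod_cast (Nat.zero_le _).trans_lt j.2
  have hj : ((j : ℕ) : ℝ) ≤ N := by exact_mod_cast j.2.le
  rw [gridPoint, meshSize]
  have h1 : ((j : ℕ) : ℝ) * ((xR - xL) / N) ≤ N * ((xR - xL) / N) := by gcongr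
  have h2 : (N : ℝ) * ((xR - xL) / N) = xR - xL := by field_simp
  have h3 : 0 ≤ ((j : ℕ) : ℝ) * ((xR - xL) / N) := by positivity
  constructor <;> linarith

/-- A bound for the first step, in which the error appears implicitly. For small time steps the
implicit term is absorbed; for large ones an a priori bound `M` is itself `O(τ²)`. -/
theorem first_step_bound {s τ T R K M δ : ℝ} (hs : 0 ≤ s) (hτ : 0 < τ) (hτT : τ ≤ T) (hR : 0 ≤ R)
    (hM : 0 ≤ M) (hδ : τ ^ 2 ≤ δ) (h : s ≤ τ * (R * δ + K * (s / 2))) (hsM : s ≤ M) :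
    s ≤ (2 * T * R + M * K ^ 2) * δ := by
  have hδ0 : 0 ≤ δ := (sq_nonneg τ).trans hδ
  have hMK : 0 ≤ M * K ^ 2 * δ := by positivity
  have hTR : 0 ≤ T * R * δ := by have := hτ.trans_le hτT; positivity
  rcases le_or_gt (K * τ) 1 with hK | hK
  · have h1 : K * τ * s ≤ 1 * s := mul_le_mul_of_nonneg_right hK hs
    have h2 : τ * (R * δ) ≤ T * (R * δ) := mul_le_mul_of_nonneg_right hτT (by positivity)
    nlinarith
  · have h1 : 1 ≤ (K * τ) ^ 2 := one_le_pow₀ hK.le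
    have h2 : M * 1 ≤ M * (K * τ) ^ 2 := mul_le_mul_of_nonneg_left h1 hM
    have h3 : M * K ^ 2 * τ ^ 2 ≤ M * K ^ 2 * δ := mul_le_mul_of_nonneg_left hδ (by positivity)
    nlinarith

set_option maxHeartbeats 800000 in
/-- The error estimate in the discrete energy norm. -/
theorem exists_energyNorm_error_le {a σ γ xL xR T r : ℝ} (ha : 0 ≤ a) (hσ : 0 < σ) (hγ : 0 ≤ γ)
    (hx : xL < xR) (hT : 0 < T) (hr : 1 / 2 < r) {u₀ : ℝ → ℝ} {u : ℝ → ℝ → ℝ}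
    (hsol : IsSolution a σ γ xL xR T u₀ u) (hreg : MemCmSobolev hx 3 T (r + 1) u) :
    ∃ C : ℝ, 0 ≤ C ∧ ∀ N : ℕ, 0 < N → Even N → ∀ Nt : ℕ, 0 < Nt → ∀ τ : ℝ, τ = T / Nt →
      ∀ U : ℕ → Fin N → ℝ, IsLCNMP a σ γ xL xR u₀ N Nt τ U → ∀ n ≤ Nt,
        energyNorm xL xR σ (complexify fun j => u (gridPoint xL xR N j) (n * τ) - U n j) ≤
          C * (τ ^ 2 + (N : ℝ) ^ (-r)) := by
  obtain ⟨v, hv, hvu⟩ := hreg.curve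
  obtain ⟨v₁, B, hB, hd, hb, hmid, hext⟩ := exists_midpoint_bounds hT (v := v) (by exact_mod_cast hv)
  obtain ⟨Cc, hCc, hcons⟩ := exists_consistency_bound (B := 2 * B) ha hσ hγ hx hr (by positivity)
  have hEc := evalConst_nonneg xL xR σ r
  have hKc := convConst_nonneg xL xR σ
  set E := evalConst xL xR σ r
  set R₀ := Cc * (B + 1) with hR₀
  set K₀ := γ / 3 * (2 * (convConst xL xR σ * (E * B))) with hK₀
  have hR₀0 : 0 ≤ R₀ := by positivity
  have hK₀0 : 0 ≤ K₀ := by positivity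
  set A := 2 * T * R₀ + 2 * (E * B) * K₀ ^ 2 with hA
  have hA0 : 0 ≤ A := by positivity
  refine ⟨(A + 1) * Real.exp (2 * (R₀ + K₀) * T), by positivity, ?_⟩
  intro N hN hE Nt hNt τ hτ U hU n hn
  have hNt' : (0 : ℝ) < Nt := by exact_mod_cast hNt
  have hτ0 : 0 < τ := by rw [hτ]; positivity
  have hNtτ : (Nt : ℝ) * τ = T := by rw [hτ]; field_simp
  have hle : ∀ k ≤ Nt, (k : ℝ) * τ ≤ T := fun k hk => by
    rw [← hNtτ]; exact mul_le_mul_of_nonneg_right (by exact_mod_cast hk) hτ0.le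
  have hmem : ∀ k ≤ Nt, (k : ℝ) * τ ∈ Set.Icc 0 T := fun k hk => ⟨by positivity, hle k hk⟩
  set δ := τ ^ 2 + (N : ℝ) ^ (-r) with hδ
  have hδN : 0 ≤ (N : ℝ) ^ (-r) := by positivity
  have hδτ : τ ^ 2 ≤ δ := by linarith
  have hδ0 : 0 ≤ δ := by positivity
  set G := gridEval hx N hr with hG
  set ug : ℕ → Fin N → ℝ := fun k j => u (gridPoint xL xR N j) (k * τ) with hug
  have heval : ∀ t ∈ Set.Icc 0 T, ∀ j : Fin N, G (v t) j = (u (gridPoint xL xR N j) t : ℂ) :=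
    fun t ht j => gridEval_eq hx hN hr (hreg.continuous t ht) (hreg.periodic t ht) (hvu t ht) j
  have hcug : ∀ k ≤ Nt, complexify (ug k) = G (v (k * τ)) := fun k hk => by
    ext j; rw [heval _ (hmem k hk), complexify_apply]
  have hGle : ∀ (y : SeqSpace) (b : ℝ), ‖y‖ ≤ b → energyNorm xL xR σ (G y) ≤ E * b :=
    fun y b hy => (energyNorm_gridEval_le hx hσ.le hN hE hr y).trans
      (mul_le_mul_of_nonneg_left hy hEc)
  set s : ℕ → ℝ := fun k => energyNorm xL xR σ (complexify (ug k - U k)) with hs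
  have hs0 : ∀ k, 0 ≤ s k := fun k => energyNorm_nonneg _ _ _ _
  have hadd : ∀ k : ℕ, ((k + 1 : ℕ) : ℝ) * τ = k * τ + τ := fun k => by push_cast; ring
  have hzero : ug 0 - U 0 = 0 := by
    ext j
    rw [Pi.sub_apply, hU.initial, Pi.zero_apply, hug]
    simp only [Nat.cast_zero, zero_mul]
    rw [hsol.initial _ (gridPoint_mem_Icc hx j), sub_self]
  have hsz : s 0 = 0 := by rw [hs]; simp only [hzero, map_zero, energyNorm_zero]
  -- stability and consistency for one step, for any extrapolated state within `B τ²` of the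
  -- midpoint
  have hstep : ∀ k, k + 1 ≤ Nt → ∀ (w : SeqSpace) (w' : Fin N → ℂ), ‖w‖ ≤ 2 * B →
      ‖w - v (k * τ + τ / 2)‖ ≤ B * τ ^ 2 →
      schemeOp a σ γ xL xR (τ⁻¹ • (complexify (U (k + 1)) - complexify (U k))) w'
        ((1 / 2 : ℝ) • (complexify (U (k + 1)) + complexify (U k))) = 0 →
      s (k + 1) ≤ s k + τ * (R₀ * δ + K₀ * energyNorm xL xR σ (G w - w')) := by
    intro k hk w w' hwB hw hUk
    have hk' : k ≤ Nt := by omega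
    have htT : (k : ℝ) * τ + τ ≤ T := by rw [← hadd]; exact hle _ hk
    have ht0 : 0 ≤ (k : ℝ) * τ := by positivity
    have hmidmem : (k : ℝ) * τ + τ / 2 ∈ Set.Icc 0 T := ⟨by linarith, by linarith⟩
    obtain ⟨hm1, hm2⟩ := hmid (k * τ) τ hτ0 ht0 htT
    obtain ⟨F, hF⟩ := exists_isFluxCoeff hx hσ.le hT hr hsol hvu hd hmidmem
    obtain ⟨hvB, hv₁B⟩ := hb _ hmidmem
    have hc := hcons N hN hE (fun x => u x (k * τ + τ / 2)) F
      (τ⁻¹ • (v (k * τ + τ) - v (k * τ))) w ((1 / 2 : ℝ) • (v (k * τ + τ) + v (k * τ)))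
      (v (k * τ + τ / 2)) (v₁ (k * τ + τ / 2)) (B * τ ^ 2) (by positivity) hF
      (heval _ hmidmem) hwB (by linarith) (by linarith) hm1 hw hm2
    rw [← hG] at hc
    simp only [map_smul, map_sub, map_add] at hc
    have e1 : G (v (k * τ + τ)) = complexify (ug (k + 1)) := by rw [hcug _ hk, hadd]
    rw [e1, ← hcug k hk'] at hc
    have hP : energyNorm xL xR σ ((1 / 2 : ℝ) • (complexify (ug (k + 1)) + complexify (ug k))) ≤
        E * B := by
      refine (energyNorm_mean_le _ _ _ _ _).trans ?_
      have h1 := hGle _ _ (hb _ (hmem _ hk)).1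
      have h2 := hGle _ _ (hb _ (hmem _ hk')).1
      rw [← hcug _ hk] at h1
      rw [← hcug _ hk'] at h2
      linarith
    have hRle : Cc * (B * τ ^ 2 + (N : ℝ) ^ (-r)) ≤ R₀ * δ := by
      rw [hR₀, mul_assoc]
      refine mul_le_mul_of_nonneg_left ?_ hCc
      have h1 : 0 ≤ B * (N : ℝ) ^ (-r) := by positivity
      have h2 : 0 ≤ τ ^ 2 := by positivity
      rw [hδ]; nlinarith
    have := energyNorm_error_step hσ hγ hx hN hE hτ0 (by positivity) hUk hc hP
    refine this.trans ?_
    have e2 : γ / 3 * (2 * (convConst xL xR σ * (energyNorm xL xR σ (G w - w') * (E * B)))) =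
        K₀ * energyNorm xL xR σ (G w - w') := by rw [hK₀]; ring
    rw [e2]
    have h3 := mul_le_mul_of_nonneg_left
      (add_le_add_left hRle (K₀ * energyNorm xL xR σ (G w - w'))) hτ0.le
    have h4 : energyNorm xL xR σ (complexify (ug k - U k)) = s k := rfl
    rw [h4]
    linarith
  -- in the first step the extrapolated state is the mean of the two levels, so its error is half
  -- the new error, the old one being zero
  have hone : 1 ≤ Nt → s 1 ≤ A * δ := by
    intro h1
    have hUk := congrArg complexify hU.first
    rw [complexify_scheme] at hUk
    simp only [map_smul, map_sub, map_add, map_zero] at hUk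
    have ht1 : (0 : ℝ) + τ ≤ T := by have := hle 1 h1; simpa using this
    have hm2 := (hmid 0 τ hτ0 le_rfl ht1).2
    have hv1 : ‖v (0 + τ)‖ ≤ B := (hb _ ⟨by linarith, ht1⟩).1
    have hv0 : ‖v 0‖ ≤ B := (hb 0 ⟨le_rfl, hT.le⟩).1
    have e1 : G (v (0 + τ)) = complexify (ug 1) := by rw [hcug 1 h1]; simp
    have e0 : G (v 0) = complexify (ug 0) := by rw [hcug 0 (Nat.zero_le _)]; simp
    have hst := hstep 0 h1 ((1 / 2 : ℝ) • (v (0 + τ) + v 0))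
      ((1 / 2 : ℝ) • (complexify (U 1) + complexify (U 0))) (by
        rw [norm_smul, Real.norm_of_nonneg (by norm_num)]
        have := norm_add_le (v (0 + τ)) (v 0)
        linarith) (by simpa using hm2) hUk
    rw [map_smul, map_add, e1, e0] at hst
    have hU0 : complexify (ug 0) = complexify (U 0) := by rw [sub_eq_zero.1 hzero]
    have hdiff : (1 / 2 : ℝ) • (complexify (ug 1) + complexify (ug 0)) -
        (1 / 2 : ℝ) • (complexify (U 1) + complexify (U 0)) =
        (1 / 2 : ℝ) • complexify (ug 1 - U 1) := by
      rw [hU0, ← smul_sub, map_sub]; congr 1; abel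
    have habs : |(1 / 2 : ℝ)| = 1 / 2 := by norm_num
    rw [hdiff, energyNorm_real_smul, habs, zero_add, hsz, zero_add] at hst
    -- a priori bound without restriction on `τ`, by conservation of the discrete momentum
    have hap : s 1 ≤ 2 * (E * B) := by
      have h2 : energyNorm xL xR σ (complexify (ug 1) - complexify (U 1)) ≤ _ :=
        weightedNorm_sub_le _ _ _
      have h3 := energyNorm_eq_of_schemeOp_eq_zero hσ.le hx hN hE hτ0 hUk
      have h4 := hGle _ _ hv1
      have h5 := hGle _ _ hv0
      rw [e1] at h4
      rw [e0, hU0] at h5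
      have h6 : s 1 = energyNorm xL xR σ (complexify (ug 1) - complexify (U 1)) := by
        rw [← map_sub]
      have h7 : s 1 ≤ energyNorm xL xR σ (complexify (ug 1)) +
          energyNorm xL xR σ (complexify (U 1)) := by rw [h6]; exact h2
      linarith
    refine first_step_bound (hs0 1) hτ0 (by linarith) hR₀0 (by positivity) hδτ ?_ hap
    refine hst.trans (le_of_eq ?_)
    have h4 : energyNorm xL xR σ (complexify (ug 1 - U 1)) = s 1 := rfl
    rw [h4]; ring
  have hmulti : ∀ k, 1 ≤ k → k + 1 ≤ Nt → s (k + 1) ≤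
      s k + τ * ((R₀ + K₀) * δ + (R₀ + K₀) * ((3 * s k + s (k - 1)) / 2)) := by
    intro k hk1 hk
    have hUk := congrArg complexify (hU.step k hk1 hk)
    rw [complexify_scheme] at hUk
    simp only [map_smul, map_sub, map_add, map_zero] at hUk
    have hkτ : (1 : ℝ) * τ ≤ k * τ :=
      mul_le_mul_of_nonneg_right (by exact_mod_cast hk1) hτ0.le
    have htT : (k : ℝ) * τ + τ ≤ T := by rw [← hadd]; exact hle _ hk
    have hpred : ((k - 1 : ℕ) : ℝ) * τ = k * τ - τ := by
      rw [Nat.cast_sub hk1]; push_cast; ring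
    have hvk : ‖v (k * τ)‖ ≤ B := (hb _ (hmem k (by omega))).1
    have hvp : ‖v (k * τ - τ)‖ ≤ B := by rw [← hpred]; exact (hb _ (hmem _ (by omega))).1
    have e1 : G (v (k * τ)) = complexify (ug k) := (hcug k (by omega)).symm
    have e0 : G (v (k * τ - τ)) = complexify (ug (k - 1)) := by
      rw [hcug (k - 1) (by omega), hpred]
    have hst := hstep k hk ((1 / 2 : ℝ) • ((3 : ℝ) • v (k * τ) - v (k * τ - τ)))
      ((1 / 2 : ℝ) • ((3 : ℝ) • complexify (U k) - complexify (U (k - 1)))) (by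
        rw [norm_smul, Real.norm_of_nonneg (by norm_num)]
        have := norm_sub_le ((3 : ℝ) • v (k * τ)) (v (k * τ - τ))
        rw [norm_smul, Real.norm_of_nonneg (by norm_num : (0 : ℝ) ≤ 3)] at this
        linarith) (hext (k * τ) τ hτ0 (by linarith) htT) hUk
    rw [map_smul, map_sub, map_smul, e1, e0] at hst
    have hdiff : (1 / 2 : ℝ) • ((3 : ℝ) • complexify (ug k) - complexify (ug (k - 1))) -
        (1 / 2 : ℝ) • ((3 : ℝ) • complexify (U k) - complexify (U (k - 1))) =
        (1 / 2 : ℝ) • ((3 : ℝ) • complexify (ug k - U k) -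
          complexify (ug (k - 1) - U (k - 1))) := by
      rw [map_sub, map_sub]; module
    have hw : _ ≤ (3 * s k + s (k - 1)) / 2 :=
      energyNorm_extrapolation_le xL xR σ (complexify (ug k - U k))
        (complexify (ug (k - 1) - U (k - 1)))
    rw [hdiff] at hst
    refine hst.trans (add_le_add_right (mul_le_mul_of_nonneg_left ?_ hτ0.le) _)
    have hq : 0 ≤ (3 * s k + s (k - 1)) / 2 := by linarith [hs0 k, hs0 (k - 1)]
    have h1 := mul_le_mul_of_nonneg_left hw hK₀0
    have h2 := mul_nonneg hR₀0 hq
    have h3 := mul_nonneg hK₀0 hδ0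
    linarith
  exact two_step_gronwall hτ0.le (by positivity) hδ0 hA0 hNtτ.le hsz hone hmulti n hn

end RLW

end

theorem theorem4p2 (a σ γ xL xR T r : ℝ) (ha : 0 < a) (hσ : 0 < σ) (hγ : 0 < γ)
    (hx : xL < xR) (hT : 0 < T) (hr : 1 / 2 < r)
    (u₀ : ℝ → ℝ) (u : ℝ → ℝ → ℝ)
    (hsol : RLW.IsSolution a σ γ xL xR T u₀ u)
    (hreg : RLW.MemCmSobolev hx 3 T (r + 1) u) :
    ∃ C : ℝ, 0 < C ∧
      ∀ N : ℕ, 0 < N → Even N → ∀ Nt : ℕ, 0 < Nt →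
      ∀ τ : ℝ, τ = T / Nt →
      ∀ U : ℕ → Fin N → ℝ, RLW.IsLCNMP a σ γ xL xR u₀ N Nt τ U →
      ∀ n : ℕ, n ≤ Nt →
      ∀ e : Fin N → ℝ, (∀ j, e j = u (RLW.gridPoint xL xR N j) (n * τ) - U n j) →
        RLW.gridSup e ≤ C * (τ ^ 2 + (N : ℝ) ^ (-r)) ∧
        RLW.gridL2 xL xR e ≤ C * (τ ^ 2 + (N : ℝ) ^ (-r)) ∧
        RLW.gridH1 xL xR e ≤ C * (τ ^ 2 + (N : ℝ) ^ (-r)) := by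
  obtain ⟨C₀, hC₀, hmain⟩ := RLW.exists_energyNorm_error_le ha.le hσ hγ.le hx hT hr hsol hreg
  have hS := RLW.sobolevConst_nonneg xL xR σ
  set k₁ := RLW.sobolevConst xL xR σ
  set k₂ := √(xR - xL)
  set k₃ := √((xR - xL) / σ)
  have hk₂ : 0 ≤ k₂ := Real.sqrt_nonneg _
  have hk₃ : 0 ≤ k₃ := Real.sqrt_nonneg _
  refine ⟨(k₁ + k₂ + k₃) * C₀ + 1, by positivity, ?_⟩
  intro N hN hE Nt hNt τ hτ U hU n hn e he
  obtain rfl : e = fun j => u (RLW.gridPoint xL xR N j) (n * τ) - U n j := funext he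
  have hen := hmain N hN hE Nt hNt τ hτ U hU n hn
  have hδ : 0 ≤ τ ^ 2 + (N : ℝ) ^ (-r) := by positivity
  have hfin : ∀ k x : ℝ, 0 ≤ k → k ≤ k₁ + k₂ + k₃ → x ≤ k * RLW.energyNorm xL xR σ
      (RLW.complexify fun j => u (RLW.gridPoint xL xR N j) (n * τ) - U n j) →
      x ≤ ((k₁ + k₂ + k₃) * C₀ + 1) * (τ ^ 2 + (N : ℝ) ^ (-r)) := by
    intro k x hk hk' hxk
    calc x ≤ k * (C₀ * (τ ^ 2 + (N : ℝ) ^ (-r))) := hxk.trans (mul_le_mul_of_nonneg_left hen hk)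
      _ ≤ (k₁ + k₂ + k₃) * (C₀ * (τ ^ 2 + (N : ℝ) ^ (-r))) :=
        mul_le_mul_of_nonneg_right hk' (by positivity)
      _ ≤ _ := by linarith
  exact ⟨hfin k₁ _ hS (by linarith) (RLW.gridSup_le hσ hx hN hE _),
    hfin k₂ _ hk₂ (by linarith) (RLW.gridL2_le hσ hx hN hE _),
    hfin k₃ _ hk₃ (by linarith) (RLW.gridH1_le hσ hx hN hE _)⟩
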